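/- Let $A$ be a Noetherian commutative ring and let $R=\bigoplus_{\nu\ge 0}R_\nu$ be a positively graded finitely generated commutative algebra over $R_0=A$. Let $S=A[x_1,\ldots,x_n]$ be a polynomial ring graded by $\deg(x_i)=\delta_i>0$, together with a graded surjection of $A$-algebras $S\twoheadrightarrow R$. Assume that $R$ is $A$-flat and that either $\operatorname{Spec}(A)$ is connected or $R$ is a finitely generated $A$-module. Then there is an integer $e$ with $0\le e\le n$ such that every fiber $R\otimes_A\kappa(\mathfrak p)$, $\mathfrak p\in\operatorname{Spec}(A)$, has Krull dimension $e$, and for this common fiber dimension $e$ the following holds. $R$ is a Gorenstein algebra over $A$ (that is, $R$ is $A$-flat and the fiber $R\otimes_A\kappa(\mathfrak p)$ is a Gorenstein ring for every $\mathfrak p\in\operatorname{Spec}(A)$) if and only if the following two conditions are satisfied: (a) $\operatorname{Ext}_S^i(R,S)=0$ for all $0\le i\le n$ with $i\ne n-e$; (b) $\operatorname{Ext}_S^{n-e}(R,S)$ is $A$-flat, and it is locally generated by one element as an $R$-module, i.e. for every prime $P$ of $R$ the localization $\operatorname{Ext}_S^{n-e}(R,S)_P$ is generated by one element over $R_P$.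 (If $A=0$ there are no fibers and $e$ may be any integer with $0\le e\le n$.) -/

import Mathlib

open CategoryTheory TensorProduct

universe u

noncomputable section

/-- A commutative ring is Gorenstein if it is Noetherian and each of its localizations at a prime
ideal has finite injective dimension as a module over itself. -/
def IsGorensteinRing (B : Type u) [CommRing B] : Prop :=
  IsNoetherianRing B ∧ ∀ (P : Ideal B) [P.IsPrime], ∃ d : ℕ,
    HasInjectiveDimensionLE
      (ModuleCat.of (Localization.AtPrime P) (Localization.AtPrime P)) d

/-- `R` is a Gorenstein algebra over `A`: it is `A`-flat, and the fiber `κ(p) ⊗[A] R` is a Gorenstein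
ring for every prime `p` of `A`. -/
def IsGorensteinAlgebra (A R : Type u) [CommRing A] [CommRing R] [Algebra A R] : Prop :=
  Module.Flat A R ∧ ∀ (p : Ideal A) [p.IsPrime], IsGorensteinRing (p.Fiber R)

/-- A module over `B` is locally cyclic if its localization at every prime `P` of `B` is generated
by one element over `B_P`. -/
def IsLocallyCyclic (B M : Type*) [CommRing B] [AddCommGroup M] [Module B M] : Prop :=
  ∀ (P : Ideal B) [P.IsPrime], ∃ x : LocalizedModule P.primeCompl M,
    Submodule.span (Localization.AtPrime P) {x} = ⊤

section Ext

variable (S R N : Type u) [CommRing S] [CommRing R] [Algebra S R] [AddCommGroup N] [Module S N]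

/-- `Ext^i_S(R, N)` for an `S`-algebra `R` and an `S`-module `N`. -/
def ExtAlg (i : ℕ) : Type u :=
  Abelian.Ext.{u} (ModuleCat.of.{u} S R) (ModuleCat.of.{u} S N) i

namespace ExtAlg

variable {S R N} in
/-- Multiplication by `r` on `R`, as an endomorphism of the `S`-module `R`. -/
def mulHom (r : R) : ModuleCat.of.{u} S R ⟶ ModuleCat.of.{u} S R :=
  ModuleCat.ofHom (LinearMap.mulLeft S r)

variable (i : ℕ)

instance : AddCommGroup (ExtAlg S R N i) :=
  inferInstanceAs (AddCommGroup (Abelian.Ext.{u} (ModuleCat.of.{u} S R) (ModuleCat.of.{u} S N) i))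

/-- The `R`-module structure on `Ext^i_S(R, N)` by functoriality in the first argument:
`r` acts as the map induced by multiplication by `r` on `R`. -/
instance : Module R (ExtAlg S R N i) where
  smul r x := (Abelian.Ext.mk₀ (mulHom (S := S) r)).comp
    (show Abelian.Ext.{u} (ModuleCat.of.{u} S R) (ModuleCat.of.{u} S N) i from x) (zero_add i)
  one_smul x := by
    have h : mulHom (S := S) (1 : R) = 𝟙 _ := by
      ext x; simp [mulHom]
    change (Abelian.Ext.mk₀ (mulHom (S := S) (1 : R))).comp _ _ = _
    rw [h]; exact Abelian.Ext.mk₀_id_comp _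
  mul_smul r s x := by
    have h : mulHom (S := S) (r * s) = mulHom r ≫ mulHom s := by
      ext x; simp [mulHom, mul_left_comm]
    change (Abelian.Ext.mk₀ (mulHom (S := S) (r * s))).comp _ _ =
      (Abelian.Ext.mk₀ (mulHom (S := S) r)).comp
        ((Abelian.Ext.mk₀ (mulHom (S := S) s)).comp _ _) _
    rw [h]; exact (Abelian.Ext.mk₀_comp_mk₀_assoc _ _ _).symm
  smul_zero r := Abelian.Ext.comp_zero _ _ _ _ _
  smul_add r x y := Abelian.Ext.comp_add _ _ _ _
  add_smul r s x := by
    have h : mulHom (S := S) (r + s) = mulHom r + mulHom s := by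
      ext x; simp [mulHom, add_mul]
    change (Abelian.Ext.mk₀ (mulHom (S := S) (r + s))).comp _ _ = _
    rw [h, Abelian.Ext.mk₀_add]; exact Abelian.Ext.add_comp _ _ _ _
  zero_smul x := by
    have h : mulHom (S := S) (0 : R) = 0 := by
      ext x; simp [mulHom]
    change (Abelian.Ext.mk₀ (mulHom (S := S) (0 : R))).comp _ _ = _
    rw [h, Abelian.Ext.mk₀_zero, Abelian.Ext.zero_comp]
    rfl

end ExtAlg

end Ext

end

/-! Write `S = A[x₁,…,xₙ]`. Every graded piece of `R` is finite and flat over the Noetherian ring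
`A`, so `R` is `A`-projective (`projective_of_graded`), and therefore `R` has projective dimension
at most `n` over `S` (`hasProjectiveDimensionLE_mvPolynomial`). Take a resolution `F` of `R` of
length `n` by finite projective `S`-modules. Its syzygies are `A`-flat, so `F` stays a resolution
after passing to a fiber `T = κ(p)[x₁,…,xₙ]` and then to a localization of `T`. Thus `Hom(F, S)`
computes `Ext_S(R, S)`, and its base changes compute the corresponding `Ext` of the fibers. The
theorem becomes a comparison between one bounded complex of `A`-flat modules and its fibers.

Fiber dimension: the ranks of the graded pieces are locally constant on `Spec A`. By Noether
normalization the growth of the Hilbert function determines the Krull dimension, so over a connected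
base the dimension is constant; if `R` is finite over `A`, all fibers are Artinian
(`exists_ringKrullDim_fiber_eq`).

Gorenstein implies (a) and (b): a local ring `B_P` of a fiber at a maximal ideal is a quotient of an
`n`-dimensional regular local ring. Cutting by nonzerodivisors reduces to depth zero, where finite
self-injective dimension means self-injectivity and a simple socle; this shows that `Ext` is cyclic
and lives only in degree `n - dim B_P` (`ext_concentrated_of_hasInjectiveDimensionLE`). That degree
is locally constant on the spectrum of the fiber, which is connected because the fiber is positively
graded over a field; hence it is `n - e` everywhere
(`IsFlatResolution.concentrated_of_preconnected`). A bounded complex of flat modules whose fibers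
have cohomology in one degree only has the same property, with flat cohomology
(`exactAt_and_flatOver_of_fiberwise`). Cyclicity descends from the fibers by Nakayama.

Conversely, flatness makes the cohomology commute with base change (`cohomology_baseChange_equiv`),
so locally on each fiber `Ext` is cyclic and concentrated in one degree. Its annihilator is that of
`B_P` (`IsSyzygyChain.smul_eq_zero_of_cohomology`), so it is isomorphic to `B_P`. Applying `Hom(B_P,
-)` to an injective resolution of the regular local ring then bounds the self-injective dimension of
`B_P` (`exists_hasInjectiveDimensionLE_self_of_ext_equiv`). -/

noncomputable section

open Abelian

/-! ### Dimension shifting for `Ext` as linear isomorphisms. -/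

section ExtLinear

variable {R : Type u} [CommRing R]
variable {M' F M N : Type u} [AddCommGroup M'] [AddCommGroup F] [AddCommGroup M] [AddCommGroup N]
  [Module R M'] [Module R F] [Module R M] [Module R N]

/-- A short exact sequence of modules, as a short exact complex in `ModuleCat`. -/
theorem ModuleCat.shortExact_of_exact {f : M' →ₗ[R] F} {g : F →ₗ[R] M}
    (hf : Function.Injective f) (hfg : Function.Exact f g) (hg : Function.Surjective g) :
    (ShortComplex.mk (ModuleCat.ofHom f) (ModuleCat.ofHom g)
      (by ext x; exact hfg.apply_apply_eq_zero x)).ShortExact where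
  exact := (ShortComplex.ShortExact.moduleCat_exact_iff_function_exact _).mpr hfg
  mono_f := (ModuleCat.mono_iff_injective _).mpr hf
  epi_g := (ModuleCat.epi_iff_surjective _).mpr hg

/-- `Ext` modules over a commutative ring, for unbundled modules. -/
abbrev ExtMod (R : Type u) [CommRing R] (M N : Type u) [AddCommGroup M] [AddCommGroup N]
    [Module R M] [Module R N] (i : ℕ) : Type u :=
  Ext.{u} (ModuleCat.of.{u} R M) (ModuleCat.of.{u} R N) i

theorem ExtMod.subsingleton_of_projective [Module.Projective R M] (i : ℕ) :
    Subsingleton (ExtMod R M N (i + 1)) := by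
  have : Projective (ModuleCat.of R M) := (IsProjective.iff_projective _).mp ‹_›
  exact Ext.subsingleton_of_projective _ _ i

/-- If `0 → M' → F → M → 0` is exact with `F` projective, `Ext¹(M, N)` is the cokernel of
`Hom(F, N) → Hom(M', N)`. -/
theorem ExtMod.one_equiv [Module.Projective R F] {f : M' →ₗ[R] F} {g : F →ₗ[R] M}
    (hf : Function.Injective f) (hfg : Function.Exact f g) (hg : Function.Surjective g) :
    Nonempty (ExtMod R M N 1 ≃ₗ[R] ((M' →ₗ[R] N) ⧸ LinearMap.range (f.lcomp R N))) := by
  have hS := ModuleCat.shortExact_of_exact hf hfg hg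
  let Φ : (M' →ₗ[R] N) →ₗ[R] ExtMod R M N 1 :=
    (hS.extClass.precompOfLinear R (ModuleCat.of R N) (add_zero 1)) ∘ₗ
      (Ext.linearEquiv₀ (R := R)).symm.toLinearMap ∘ₗ
      (ModuleCat.homLinearEquiv (S := R) (M := ModuleCat.of R M')
        (N := ModuleCat.of R N)).symm.toLinearMap
  have hΦ (φ : M' →ₗ[R] N) : Φ φ = hS.extClass.comp (Ext.mk₀ (ModuleCat.ofHom φ)) (add_zero 1) :=
    rfl
  have hsurj : Function.Surjective Φ := by
    intro x
    have : Projective (ModuleCat.of R F) := (IsProjective.iff_projective _).mp ‹_›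
    obtain ⟨y, hy⟩ := Ext.contravariant_sequence_exact₃ hS (ModuleCat.of R N) x
      (Ext.eq_zero_of_projective _) (n₀ := 0) rfl
    obtain ⟨φ, rfl⟩ := (Ext.mk₀_bijective _ _).2 y
    exact ⟨φ.hom, by rw [hΦ]; exact hy⟩
  have hker : LinearMap.ker Φ = LinearMap.range (f.lcomp R N) := by
    ext φ
    rw [LinearMap.mem_ker, hΦ]
    constructor
    · intro h
      obtain ⟨y, hy⟩ := Ext.contravariant_sequence_exact₁ hS (ModuleCat.of R N) _ _ h
      obtain ⟨ψ, rfl⟩ := (Ext.mk₀_bijective _ _).2 y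
      rw [Ext.mk₀_comp_mk₀] at hy
      have := (Ext.mk₀_bijective _ _).1 hy
      refine ⟨ψ.hom, ?_⟩
      have h2 := congrArg ModuleCat.Hom.hom this
      exact h2
    · rintro ⟨ψ, rfl⟩
      have : ModuleCat.ofHom (f.lcomp R N ψ) = ModuleCat.ofHom f ≫ ModuleCat.ofHom ψ := rfl
      rw [this, ← Ext.mk₀_comp_mk₀]
      exact hS.extClass_comp_assoc _
  rw [← hker]
  exact ⟨(Φ.quotKerEquivOfSurjective hsurj).symm⟩

/-- Dimension shifting in the first variable along a sequence with acyclic middle term. -/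
theorem ExtMod.shift_equiv {f : M' →ₗ[R] F} {g : F →ₗ[R] M} {i : ℕ}
    (h1 : Subsingleton (ExtMod R F N i)) (h2 : Subsingleton (ExtMod R F N (i + 1)))
    (hf : Function.Injective f) (hfg : Function.Exact f g) (hg : Function.Surjective g) :
    Nonempty (ExtMod R M N (i + 1) ≃ₗ[R] ExtMod R M' N i) := by
  have hS := ModuleCat.shortExact_of_exact hf hfg hg
  let Φ : ExtMod R M' N i →ₗ[R] ExtMod R M N (i + 1) :=
    hS.extClass.precompOfLinear R (ModuleCat.of R N) (add_comm 1 i)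
  have hΦ (φ) : Φ φ = hS.extClass.comp φ (add_comm 1 i) := rfl
  refine ⟨(LinearEquiv.ofBijective Φ ⟨?_, ?_⟩).symm⟩
  · rw [injective_iff_map_eq_zero]
    intro x hx
    obtain ⟨y, rfl⟩ := Ext.contravariant_sequence_exact₁ hS (ModuleCat.of R N) _ (add_comm 1 i) hx
    rw [Subsingleton.elim y 0, Ext.comp_zero]
  · intro x
    obtain ⟨y, hy⟩ := Ext.contravariant_sequence_exact₃ hS (ModuleCat.of R N) x
      (Subsingleton.elim _ _) (n₀ := i) (add_comm 1 i)
    exact ⟨y, hy⟩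

/-- Dimension shifting in the second variable along a sequence with acyclic middle term. -/
theorem ExtMod.coshift_equiv {f : M' →ₗ[R] F} {g : F →ₗ[R] M} {i : ℕ}
    (h1 : Subsingleton (ExtMod R N F i)) (h2 : Subsingleton (ExtMod R N F (i + 1)))
    (hf : Function.Injective f) (hfg : Function.Exact f g) (hg : Function.Surjective g) :
    Nonempty (ExtMod R N M' (i + 1) ≃ₗ[R] ExtMod R N M i) := by
  have hS := ModuleCat.shortExact_of_exact hf hfg hg
  let Φ : ExtMod R N M i →ₗ[R] ExtMod R N M' (i + 1) :=
    hS.extClass.postcompOfLinear R (ModuleCat.of R N) (rfl : i + 1 = i + 1)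
  have hΦ (φ) : Φ φ = φ.comp hS.extClass rfl := rfl
  refine ⟨(LinearEquiv.ofBijective Φ ⟨?_, ?_⟩).symm⟩
  · rw [injective_iff_map_eq_zero]
    intro x hx
    obtain ⟨y, rfl⟩ := Ext.covariant_sequence_exact₃ (ModuleCat.of R N) hS _ rfl hx
    rw [Subsingleton.elim y 0, Ext.zero_comp]
  · intro x
    obtain ⟨y, hy⟩ := Ext.covariant_sequence_exact₁ (ModuleCat.of R N) hS x
      (Subsingleton.elim _ _) (n₀ := i) rfl
    exact ⟨y, hy⟩

/-- If `Ext¹(N, F) = 0`, then `Ext¹(N, M')` is the cokernel of `Hom(N, F) → Hom(N, M)`. -/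
theorem ExtMod.one_coequiv (hF : Subsingleton (ExtMod R N F 1))
    {f : M' →ₗ[R] F} {g : F →ₗ[R] M}
    (hf : Function.Injective f) (hfg : Function.Exact f g) (hg : Function.Surjective g) :
    Nonempty (ExtMod R N M' 1 ≃ₗ[R] ((N →ₗ[R] M) ⧸ LinearMap.range (g.compRight R (M := N)))) := by
  have hS := ModuleCat.shortExact_of_exact hf hfg hg
  let Φ : (N →ₗ[R] M) →ₗ[R] ExtMod R N M' 1 :=
    (hS.extClass.postcompOfLinear R (ModuleCat.of R N) (zero_add 1)) ∘ₗ
      (Ext.linearEquiv₀ (R := R)).symm.toLinearMap ∘ₗ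
      (ModuleCat.homLinearEquiv (S := R) (M := ModuleCat.of R N)
        (N := ModuleCat.of R M)).symm.toLinearMap
  have hΦ (φ : N →ₗ[R] M) : Φ φ = (Ext.mk₀ (ModuleCat.ofHom φ)).comp hS.extClass (zero_add 1) :=
    rfl
  have hsurj : Function.Surjective Φ := by
    intro x
    obtain ⟨y, hy⟩ := Ext.covariant_sequence_exact₁ (ModuleCat.of R N) hS x
      (Subsingleton.elim _ _) (n₀ := 0) rfl
    obtain ⟨φ, rfl⟩ := (Ext.mk₀_bijective _ _).2 y
    exact ⟨φ.hom, by rw [hΦ]; exact hy⟩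
  have hker : LinearMap.ker Φ = LinearMap.range (g.compRight R (M := N)) := by
    ext φ
    rw [LinearMap.mem_ker, hΦ]
    constructor
    · intro h
      obtain ⟨y, hy⟩ := Ext.covariant_sequence_exact₃ (ModuleCat.of R N) hS _ _ h
      obtain ⟨ψ, rfl⟩ := (Ext.mk₀_bijective _ _).2 y
      rw [Ext.mk₀_comp_mk₀] at hy
      have := (Ext.mk₀_bijective _ _).1 hy
      refine ⟨ψ.hom, ?_⟩
      have h2 := congrArg ModuleCat.Hom.hom this
      exact h2
    · rintro ⟨ψ, rfl⟩
      have : ModuleCat.ofHom (g.compRight R ψ) = ModuleCat.ofHom ψ ≫ ModuleCat.ofHom g := rfl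
      rw [this, ← Ext.mk₀_comp_mk₀, Ext.comp_assoc_of_second_deg_zero]
      erw [hS.comp_extClass]
      exact Ext.comp_zero _ _ _ _ _
  rw [← hker]
  exact ⟨(Φ.quotKerEquivOfSurjective hsurj).symm⟩

/-- `Ext⁰(M, N) = Hom(M, N)`. -/
def ExtMod.zeroEquiv : ExtMod R M N 0 ≃ₗ[R] (M →ₗ[R] N) :=
  (Ext.linearEquiv₀ (R := R)).trans (ModuleCat.homLinearEquiv (S := R))

theorem ExtMod.congr_left (e : M' ≃ₗ[R] M) (i : ℕ) :
    Nonempty (ExtMod R M N i ≃ₗ[R] ExtMod R M' N i) := by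
  let a := ModuleCat.ofHom e.toLinearMap
  let b := ModuleCat.ofHom e.symm.toLinearMap
  have hab : a ≫ b = 𝟙 _ := by ext x; simp [a, b]
  have hba : b ≫ a = 𝟙 _ := by ext x; simp [a, b]
  refine ⟨LinearEquiv.ofLinearMap
    ((Ext.mk₀ a).precompOfLinear R (ModuleCat.of R N) (zero_add i))
    ((Ext.mk₀ b).precompOfLinear R (ModuleCat.of R N) (zero_add i)) ?_ ?_⟩
  · ext x
    change (Ext.mk₀ a).comp ((Ext.mk₀ b).comp x (zero_add i)) (zero_add i) = x
    rw [Ext.mk₀_comp_mk₀_assoc, hab, Ext.mk₀_id_comp]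
  · ext x
    change (Ext.mk₀ b).comp ((Ext.mk₀ a).comp x (zero_add i)) (zero_add i) = x
    rw [Ext.mk₀_comp_mk₀_assoc, hba, Ext.mk₀_id_comp]

/-- Scalars annihilating the first argument annihilate `Ext`. -/
theorem ExtMod.smul_eq_zero_of_left {r : R} (h : ∀ m : M, r • m = 0) {i : ℕ}
    (x : ExtMod R M N i) : r • x = 0 := by
  have : r • 𝟙 (ModuleCat.of R M) = 0 := by
    ext m; exact h m
  rw [← Ext.mk₀_id_comp x, ← Ext.smul_comp, ← Ext.mk₀_smul, this, Ext.mk₀_zero, Ext.zero_comp]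

end ExtLinear

/-! ### Cohomology of cochain sequences indexed by `ℕ`. -/

section CochainSequence

variable {R : Type*} [CommRing R] {K : ℕ → Type*} [∀ i, AddCommGroup (K i)] [∀ i, Module R (K i)]

/-- The coboundaries of a sequence `K 0 → K 1 → ⋯`. -/
def coboundaries (d : ∀ i, K i →ₗ[R] K (i + 1)) : ∀ i, Submodule R (K i)
  | 0 => ⊥
  | i + 1 => LinearMap.range (d i)

/-- The cohomology of a sequence `K 0 → K 1 → ⋯`. -/
abbrev cohomology (d : ∀ i, K i →ₗ[R] K (i + 1)) (i : ℕ) : Type _ :=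
  LinearMap.ker (d i) ⧸ (coboundaries d i).submoduleOf (LinearMap.ker (d i))

/-- Every cocycle in degree `i` is a coboundary. -/
def ExactAt (d : ∀ i, K i →ₗ[R] K (i + 1)) (i : ℕ) : Prop :=
  LinearMap.ker (d i) ≤ coboundaries d i

theorem coboundaries_le_ker {d : ∀ i, K i →ₗ[R] K (i + 1)}
    (hd : ∀ i x, d (i + 1) (d i x) = 0) : ∀ i, coboundaries d i ≤ LinearMap.ker (d i)
  | 0 => bot_le
  | i + 1 => by rintro _ ⟨x, rfl⟩; exact hd i x

theorem subsingleton_cohomology_iff (d : ∀ i, K i →ₗ[R] K (i + 1)) (i : ℕ) :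
    Subsingleton (cohomology d i) ↔ ExactAt d i := by
  rw [Submodule.Quotient.subsingleton_iff, Submodule.submoduleOf_eq_top]
  exact Iff.rfl

end CochainSequence

/-! ### `Ext` computed from a resolution. -/

section Resolution

variable {R : Type u} [CommRing R] {M F : ℕ → Type u} [∀ i, AddCommGroup (M i)]
  [∀ i, Module R (M i)] [∀ i, AddCommGroup (F i)] [∀ i, Module R (F i)]

/-- Short exact sequences `0 → M (i + 1) → F i → M i → 0`, so that `F` resolves `M 0`. -/
structure IsSyzygyChain (ι : ∀ i, M (i + 1) →ₗ[R] F i) (π : ∀ i, F i →ₗ[R] M i) : Prop where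
  inj : ∀ i, Function.Injective (ι i)
  exact : ∀ i, Function.Exact (ι i) (π i)
  surj : ∀ i, Function.Surjective (π i)

/-- The differentials of `Hom(F, N)`. -/
def homDifferential (ι : ∀ i, M (i + 1) →ₗ[R] F i) (π : ∀ i, F i →ₗ[R] M i)
    (N : Type u) [AddCommGroup N] [Module R N] (i : ℕ) :
    (F i →ₗ[R] N) →ₗ[R] (F (i + 1) →ₗ[R] N) :=
  (ι i ∘ₗ π (i + 1)).lcomp R N

variable {ι : ∀ i, M (i + 1) →ₗ[R] F i} {π : ∀ i, F i →ₗ[R] M i}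
variable (N : Type u) [AddCommGroup N] [Module R N]

theorem IsSyzygyChain.tail (h : IsSyzygyChain ι π) :
    IsSyzygyChain (M := fun i => M (i + 1)) (F := fun i => F (i + 1))
      (fun i => ι (i + 1)) (fun i => π (i + 1)) :=
  ⟨fun _ => h.inj _, fun _ => h.exact _, fun _ => h.surj _⟩

theorem IsSyzygyChain.homDifferential_comp (h : IsSyzygyChain ι π) (i : ℕ) (x : F i →ₗ[R] N) :
    homDifferential ι π N (i + 1) (homDifferential ι π N i x) = 0 := by
  ext y
  simp [homDifferential, (h.exact _).apply_apply_eq_zero]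

theorem IsSyzygyChain.mem_ker_homDifferential (h : IsSyzygyChain ι π) (i : ℕ) (x : F i →ₗ[R] N) :
    x ∈ LinearMap.ker (homDifferential ι π N i) ↔ ∃ y : M i →ₗ[R] N, x = y ∘ₗ π i := by
  constructor
  · intro hx
    have hx' : ∀ z, x (ι i z) = 0 := fun z => by
      obtain ⟨w, rfl⟩ := h.surj (i + 1) z
      exact congrArg (fun f => f w) (LinearMap.mem_ker.mp hx)
    have hk : LinearMap.ker (π i) ≤ LinearMap.ker x := by
      intro a ha
      obtain ⟨b, rfl⟩ := (h.exact i a).mp ha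
      exact hx' b
    refine ⟨(LinearMap.ker (π i)).liftQ x hk ∘ₗ
      ((π i).quotKerEquivOfSurjective (h.surj i)).symm.toLinearMap, ?_⟩
    ext a
    have : ((π i).quotKerEquivOfSurjective (h.surj i)).symm (π i a) =
        (LinearMap.ker (π i)).mkQ a := by
      rw [LinearEquiv.symm_apply_eq]; simp
    simp [this]
  · rintro ⟨y, rfl⟩
    ext z
    simp [homDifferential, (h.exact _).apply_apply_eq_zero]

/-- `Hom(M i, N)` is the module of degree `i` cocycles of `Hom(F, N)`. -/
def IsSyzygyChain.kerEquiv (h : IsSyzygyChain ι π) (i : ℕ) :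
    (M i →ₗ[R] N) ≃ₗ[R] LinearMap.ker (homDifferential ι π N i) :=
  LinearEquiv.ofBijective
    (((π i).lcomp R N).codRestrict _ fun y => (h.mem_ker_homDifferential N i _).mpr ⟨y, rfl⟩)
    ⟨fun a b hab => by
      have := congrArg Subtype.val hab
      ext x
      obtain ⟨z, rfl⟩ := h.surj i x
      exact congrArg (fun f => f z) this,
    fun ⟨x, hx⟩ => by
      obtain ⟨y, rfl⟩ := (h.mem_ker_homDifferential N i _).mp hx
      exact ⟨y, rfl⟩⟩

theorem IsSyzygyChain.ext_succ_equiv : ∀ (i : ℕ) {M F : ℕ → Type u} [∀ i, AddCommGroup (M i)]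
    [∀ i, Module R (M i)] [∀ i, AddCommGroup (F i)] [∀ i, Module R (F i)]
    {ι : ∀ i, M (i + 1) →ₗ[R] F i} {π : ∀ i, F i →ₗ[R] M i}
    (_ : IsSyzygyChain ι π) (_ : ∀ i, Module.Projective R (F i)),
    Nonempty (ExtMod R (M 0) N (i + 1) ≃ₗ[R] cohomology (homDifferential ι π N) (i + 1)) := by
  intro i
  induction i with
  | zero =>
    intro M F _ _ _ _ ι π h hF
    obtain ⟨e⟩ := ExtMod.one_equiv (N := N) (h.inj 0) (h.exact 0) (h.surj 0)
    refine ⟨e.trans (Submodule.Quotient.equiv _ _ (h.kerEquiv N 1) ?_)⟩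
    ext x
    simp only [Submodule.mem_map, LinearMap.mem_range, Submodule.submoduleOf, Submodule.mem_comap, coboundaries]
    constructor
    · rintro ⟨_, ⟨y, rfl⟩, rfl⟩
      exact ⟨y, rfl⟩
    · rintro ⟨y, hy⟩
      exact ⟨_, ⟨y, rfl⟩, Subtype.ext hy⟩
  | succ i ih =>
    intro M F _ _ _ _ ι π h hF
    obtain ⟨e⟩ := ExtMod.shift_equiv (N := N) (i := i + 1)
      (ExtMod.subsingleton_of_projective _) (ExtMod.subsingleton_of_projective _)
      (h.inj 0) (h.exact 0) (h.surj 0)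
    obtain ⟨e'⟩ := ih h.tail (fun i => hF _)
    exact ⟨e.trans e'⟩

/-- `Ext` is computed by projective resolutions. -/
theorem IsSyzygyChain.ext_equiv (h : IsSyzygyChain ι π) (hF : ∀ i, Module.Projective R (F i))
    (i : ℕ) :
    Nonempty (ExtMod R (M 0) N i ≃ₗ[R] cohomology (homDifferential ι π N) i) := by
  cases i with
  | succ i => exact ext_succ_equiv N i h hF
  | zero =>
    refine ⟨ExtMod.zeroEquiv.trans ((h.kerEquiv N 0).trans
      (Submodule.quotEquivOfEqBot _ ?_).symm)⟩
    rw [eq_bot_iff]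
    intro x hx
    exact Subtype.ext hx

end Resolution

/-! ### Null-homotopy of scalars that kill the only cohomology. -/

section Faithful

variable {R : Type*} [CommRing R] {K : ℕ → Type*} [∀ i, AddCommGroup (K i)] [∀ i, Module R (K i)]
  {d : ∀ i, K i →ₗ[R] K (i + 1)}

/-- In a bounded complex of projectives which is exact above degree `c`, the coboundaries above
degree `c` are projective direct summands. -/
theorem projective_range_of_exactAt (hK : ∀ i, Module.Projective R (K i)) {N c : ℕ}
    (hN : ∀ i, N < i → Subsingleton (K i)) (hd : ∀ i x, d (i + 1) (d i x) = 0)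
    (hex : ∀ i, c < i → ExactAt d i) (i : ℕ) (hi : c ≤ i) :
    Module.Projective R (LinearMap.range (d i)) ∧
      ∃ q : K (i + 1) →ₗ[R] LinearMap.range (d i), ∀ x : LinearMap.range (d i), q x = x := by
  by_cases hiN : N ≤ i
  · have := hN (i + 1) (by omega)
    have : Subsingleton (LinearMap.range (d i)) := ⟨fun _ _ => Subtype.ext (Subsingleton.elim _ _)⟩
    exact ⟨inferInstance, 0, fun x => Subsingleton.elim _ _⟩
  · obtain ⟨h1, -⟩ := projective_range_of_exactAt hK hN hd hex (i + 1) (by omega)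
    obtain ⟨σ, hσ⟩ := Module.projective_lifting_property (d (i + 1)).rangeRestrict LinearMap.id
      (LinearMap.surjective_rangeRestrict _)
    have hσ' : ∀ x, d (i + 1) (σ x) = x := fun x => congrArg Subtype.val (LinearMap.congr_fun hσ x)
    -- With `σ` a splitting of `d (i + 1)` onto its projective range, `1 - σ d` projects onto the
    -- cocycles, which by exactness are the coboundaries.
    let q : K (i + 1) →ₗ[R] LinearMap.range (d i) :=
      (LinearMap.id - σ ∘ₗ (d (i + 1)).rangeRestrict).codRestrict _ fun x => by
        apply hex (i + 1) (by omega)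
        rw [LinearMap.mem_ker]
        simp [hσ']
    have hq : ∀ x : LinearMap.range (d i), q x = x := by
      rintro ⟨_, y, rfl⟩
      ext
      have : (d (i + 1)).rangeRestrict (d i y) = 0 := Subtype.ext (hd i y)
      change d i y - σ ((d (i + 1)).rangeRestrict (d i y)) = d i y
      rw [this, map_zero, sub_zero]
    exact ⟨Module.Projective.of_split (Submodule.subtype _) q (LinearMap.ext hq), q, hq⟩
termination_by N - i

/-- A scalar that annihilates the only cohomology of a bounded complex of projectives is
null-homotopic in degree `0`. -/
theorem exists_homotopy_of_exactAt (hK : ∀ i, Module.Projective R (K i)) {N c : ℕ}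
    (hN : ∀ i, N < i → Subsingleton (K i)) (hd : ∀ i x, d (i + 1) (d i x) = 0)
    (hex : ∀ i, i ≠ c → ExactAt d i) (t : R)
    (ht : ∀ x, d c x = 0 → t • x ∈ coboundaries d c) :
    ∃ r : K 1 →ₗ[R] K 0, ∀ x, r (d 0 x) = t • x := by
  -- The homotopy is built downward from degree `c`, controlling `r d - t` only modulo coboundaries.
  -- In degree `0` there are no nonzero coboundaries, so there the equation is exact.
  suffices H : ∀ i, i ≤ c → ∃ r : K (i + 1) →ₗ[R] K i,
      ∀ x, r (d i x) - t • x ∈ coboundaries d i by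
    obtain ⟨r, hr⟩ := H 0 (Nat.zero_le _)
    exact ⟨r, fun x => sub_eq_zero.mp (hr x)⟩
  intro i hi
  induction hi using Nat.decreasingInduction with
  | self =>
    obtain ⟨h1, q, hq⟩ := projective_range_of_exactAt hK hN hd (fun i hi => hex i hi.ne') c le_rfl
    obtain ⟨σ, hσ⟩ := Module.projective_lifting_property (d c).rangeRestrict LinearMap.id
      (LinearMap.surjective_rangeRestrict _)
    have hσ' : ∀ x, d c (σ x) = x := fun x => congrArg Subtype.val (LinearMap.congr_fun hσ x)
    refine ⟨t • (σ ∘ₗ q), fun x => ?_⟩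
    have := ht (σ ⟨d c x, x, rfl⟩ - x) (by simp [hσ'])
    rw [smul_sub] at this
    have e : q (d c x) = ⟨d c x, x, rfl⟩ := hq ⟨d c x, x, rfl⟩
    simpa [e] using this
  | @of_succ i hi ih =>
    obtain ⟨r, hr⟩ := ih
    -- Lifting `t - r d` through `d i` gives `d r' = t - r d`. Hence `r' d - t` takes values in
    -- cocycles, which are coboundaries in degrees below `c`.
    let φ : K (i + 1) →ₗ[R] LinearMap.range (d i) :=
      (t • LinearMap.id - r ∘ₗ d (i + 1)).codRestrict _ fun x => by
        have := neg_mem (hr x)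
        simpa [coboundaries] using this
    obtain ⟨r', hr'⟩ := Module.projective_lifting_property (d i).rangeRestrict φ
      (LinearMap.surjective_rangeRestrict _)
    have h' : ∀ x, d i (r' x) = t • x - r (d (i + 1) x) := fun x =>
      congrArg Subtype.val (LinearMap.congr_fun hr' x)
    refine ⟨r', fun x => hex i (by omega) ?_⟩
    simp [LinearMap.mem_ker, h', hd]

end Faithful

/-! ### The annihilator of the only `Ext` kills the module. -/

section

variable {R : Type u} [CommRing R] {M F : ℕ → Type u} [∀ i, AddCommGroup (M i)]
  [∀ i, Module R (M i)] [∀ i, AddCommGroup (F i)] [∀ i, Module R (F i)]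
  {ι : ∀ i, M (i + 1) →ₗ[R] F i} {π : ∀ i, F i →ₗ[R] M i}

/-- If the dual of a bounded resolution of `M 0` has a single cohomology module, then a scalar
that annihilates it annihilates `M 0`. -/
theorem IsSyzygyChain.smul_eq_zero_of_cohomology (h : IsSyzygyChain ι π)
    (hF : ∀ i, Module.Projective R (F i)) (hfin : ∀ i, Module.Finite R (F i)) {N c : ℕ}
    (hN : ∀ i, N < i → Subsingleton (F i))
    (hex : ∀ i, i ≠ c → ExactAt (homDifferential ι π R) i) (t : R)
    (ht : ∀ x : cohomology (homDifferential ι π R) c, t • x = 0) (m : M 0) : t • m = 0 := by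
  obtain ⟨r, hr⟩ := exists_homotopy_of_exactAt (d := homDifferential ι π R)
    (fun i => inferInstanceAs (Module.Projective R (Module.Dual R (F i)))) (N := N) (c := c)
    (fun i hi => by have := hN i hi; exact ⟨fun a b => by ext x; simp [Subsingleton.elim x 0]⟩)
    (h.homDifferential_comp R) hex t (fun x hx => by
      have := ht (Submodule.Quotient.mk ⟨x, hx⟩)
      rw [← Submodule.Quotient.mk_smul, Submodule.Quotient.mk_eq_zero] at this
      exact this)
  obtain ⟨f, rfl⟩ := h.surj 0 m
  -- Transposing the homotopy: by reflexivity of `F 1` this functional is evaluation at some `g`,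
  -- whose boundary in `F 0` is `t • f`. So `t • f` dies in `M 0`.
  let ev : Module.Dual R (Module.Dual R (F 1)) := (Module.Dual.eval R (F 0) f) ∘ₗ r
  obtain ⟨g, hg⟩ := (Module.bijective_dual_eval R (F 1)).2 ev
  have key : ι 0 (π 1 g) = t • f := by
    rw [← sub_eq_zero]
    apply (Module.bijective_dual_eval R (F 0)).1
    ext φ
    have h1 := LinearMap.congr_fun hg (homDifferential ι π R 0 φ)
    have h2 := LinearMap.congr_fun (hr φ) f
    simp only [ev, LinearMap.comp_apply, hr, Module.Dual.eval_apply] at h1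
    have h3 : φ (ι 0 (π 1 g)) = (t • φ) f := h1
    simp [h3]
  rw [← map_smul, ← key, (h.exact 0).apply_apply_eq_zero]

end

/-! ### Coextension of scalars and finite injective dimension. -/

section Coextension

variable (R B X : Type u) [CommRing R] [CommRing B] [Algebra R B] [AddCommGroup X] [Module R X]

/-- `Hom_R(B, X)` as a `B`-module. -/
def CoextMod : Type u := B →ₗ[R] X

namespace CoextMod

instance : AddCommGroup (CoextMod R B X) := inferInstanceAs (AddCommGroup (B →ₗ[R] X))
instance : Module R (CoextMod R B X) := inferInstanceAs (Module R (B →ₗ[R] X))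

variable {R B X}

/-- The linear map underlying an element of `CoextMod`. -/
def toHom : CoextMod R B X ≃ₗ[R] (B →ₗ[R] X) := LinearEquiv.refl R _

@[ext] theorem ext {f g : CoextMod R B X} (h : ∀ b, toHom f b = toHom g b) : f = g :=
  LinearMap.ext h

instance : SMul B (CoextMod R B X) := ⟨fun b f => toHom.symm (toHom f ∘ₗ LinearMap.mulLeft R b)⟩

theorem toHom_smul (b : B) (f : CoextMod R B X) (x : B) : toHom (b • f) x = toHom f (b * x) := rfl

instance : Module B (CoextMod R B X) where
  one_smul f := by ext; simp [toHom_smul]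
  mul_smul a b f := by ext; simp [toHom_smul, mul_assoc, mul_left_comm]
  smul_zero b := by ext; simp [toHom_smul]
  smul_add b f g := by ext; simp [toHom_smul]
  add_smul a b f := by ext; simp [toHom_smul, add_mul]
  zero_smul f := by ext; simp [toHom_smul]

instance : IsScalarTower R B (CoextMod R B X) where
  smul_assoc r b f := by
    ext x
    simp [toHom_smul]

variable {Y : Type u} [AddCommGroup Y] [Module R Y]

/-- Functoriality of `CoextMod`. -/
def map (g : X →ₗ[R] Y) : CoextMod R B X →ₗ[B] CoextMod R B Y where
  toFun f := toHom.symm (g ∘ₗ toHom f)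
  map_add' a b := by ext; simp
  map_smul' b f := by ext; simp [toHom_smul]

theorem toHom_map (g : X →ₗ[R] Y) (f : CoextMod R B X) (b : B) :
    toHom (map g f) b = g (toHom f b) := rfl

/-- Coextension is right adjoint to restriction of scalars, which is exact, so it preserves
injectives. Concretely, evaluation at `1` turns the extension problem in Baer's criterion into one
over `R`. -/
instance injective [Module.Injective R X] : Module.Injective B (CoextMod R B X) := by
  apply Module.Baer.injective
  intro I g
  let e : I →ₗ[R] X :=
    { toFun := fun x => toHom (g x) 1
      map_add' := by simp
      map_smul' := by
        intro r x
        have : r • x = (algebraMap R B r) • x := by ext; simp [Algebra.smul_def]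
        rw [this, map_smul, toHom_smul]
        simp [Algebra.algebraMap_eq_smul_one] }
  obtain ⟨h, hh⟩ := Module.Injective.out (R := R) (I.subtype.restrictScalars R)
    Subtype.val_injective e
  refine ⟨LinearMap.toSpanSingleton B _ (toHom.symm h), fun x hx => ?_⟩
  ext y
  have := hh ⟨x * y, I.mul_mem_right y hx⟩
  simp only [LinearMap.toSpanSingleton_apply, toHom_smul]
  change h (x * y) = _
  refine this.trans ?_
  have h2 : (⟨x * y, I.mul_mem_right y hx⟩ : I) = y • ⟨x, hx⟩ := by ext; simp [mul_comm]
  simp only [e, LinearMap.coe_mk, AddHom.coe_mk, h2, map_smul, toHom_smul, mul_one]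

variable {Z : Type u} [AddCommGroup Z] [Module R Z] {f : X →ₗ[R] Y} {g : Y →ₗ[R] Z}

theorem map_injective (hf : Function.Injective f) : Function.Injective (map (B := B) f) :=
  fun _ _ hab => ext fun b => hf (congrArg (fun φ => toHom φ b) hab)

theorem map_exact (hf : Function.Injective f) (hfg : Function.Exact f g) :
    Function.Exact (map (B := B) f) (map (B := B) g) := by
  intro φ
  constructor
  · intro h
    have h' : ∀ b, toHom φ b ∈ LinearMap.range f := fun b =>
      (hfg _).mp (congrArg (fun φ => toHom φ b) h)
    refine ⟨toHom.symm ((LinearEquiv.ofInjective f hf).symm.toLinearMap ∘ₗ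
      (toHom φ).codRestrict _ h'), ?_⟩
    ext b
    rw [toHom_map]
    exact congrArg Subtype.val ((LinearEquiv.ofInjective f hf).apply_symm_apply ⟨_, h' b⟩)
  · rintro ⟨ψ, rfl⟩
    ext b
    exact hfg.apply_apply_eq_zero _

theorem map_surjective (hY : Subsingleton (ExtMod R B Y 1)) (hX : Subsingleton (ExtMod R B X 1))
    (hf : Function.Injective f) (hfg : Function.Exact f g) (hg : Function.Surjective g) :
    Function.Surjective (map (B := B) g) := by
  obtain ⟨e⟩ := ExtMod.one_coequiv (N := B) hY hf hfg hg
  have := e.symm.subsingleton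
  rw [Submodule.Quotient.subsingleton_iff] at this
  intro φ
  obtain ⟨ψ, hψ⟩ := LinearMap.range_eq_top.mp this (toHom φ)
  exact ⟨toHom.symm ψ, hψ⟩

end CoextMod

variable {R B X}

theorem Module.exists_injective_embedding : ∃ (I : Type u) (_ : AddCommGroup I) (_ : Module R I)
    (f : X →ₗ[R] I), Function.Injective f ∧ Module.Injective R I := by
  have ei : EnoughInjectives (ModuleCat.{u} R) := inferInstance
  obtain ⟨I, inj, f, hf⟩ := ei.1 (ModuleCat.of R X)
  exact ⟨I, inferInstance, inferInstance, f.hom, (ModuleCat.mono_iff_injective f).mp hf,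
    Module.injective_module_of_injective_object R I⟩

theorem Module.Injective.hasInjectiveDimensionLT [Module.Injective R X] :
    HasInjectiveDimensionLT (ModuleCat.of R X) 1 :=
  injective_iff_hasInjectiveDimensionLT_one.mp ((injective_iff_injective_object R X).mp ‹_›)

theorem CategoryTheory.HasInjectiveDimensionLT.of_le {C : Type*} [Category C] [Abelian C] {Y : C}
    {m n : ℕ} (h : HasInjectiveDimensionLT Y m) (hmn : m ≤ n) : HasInjectiveDimensionLT Y n :=
  hasInjectiveDimensionLT_of_ge Y m n hmn

theorem ExtMod.subsingleton_of_hasInjectiveDimensionLT {N : Type u} [AddCommGroup N] [Module R N]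
    {n : ℕ} (h : HasInjectiveDimensionLT (ModuleCat.of R X) n) (i : ℕ) (hi : n ≤ i) :
    Subsingleton (ExtMod R N X i) :=
  HasInjectiveDimensionLT.subsingleton _ n i hi _

/-- When the higher `Ext_R(B, X)` vanish, `Hom_R(B, -)` keeps an injective resolution of `X` exact
and its terms injective. The induction embeds `X` in an injective and passes to the cokernel. -/
theorem CoextMod.hasInjectiveDimensionLE (r : ℕ) :
    ∀ (X : Type u) [AddCommGroup X] [Module R X],
      HasInjectiveDimensionLE (ModuleCat.of R X) r →
      (∀ i, Subsingleton (ExtMod R B X (i + 1))) →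
      HasInjectiveDimensionLE (ModuleCat.of B (CoextMod R B X)) r := by
  induction r with
  | zero =>
    intro X _ _ h _
    have : Module.Injective R X := (Module.injective_iff_injective_object R X).mpr
      (injective_iff_hasInjectiveDimensionLT_one.mpr h)
    exact Module.Injective.hasInjectiveDimensionLT
  | succ r ih =>
    intro X _ _ h hE
    obtain ⟨I, _, _, f, hf, hI⟩ := Module.exists_injective_embedding (R := R) (X := X)
    have hfg : Function.Exact f (LinearMap.range f).mkQ := LinearMap.exact_map_mkQ_range f
    have hg := (LinearMap.range f).mkQ_surjective
    have hS := ModuleCat.shortExact_of_exact hf hfg hg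
    have hI' (i : ℕ) : Subsingleton (ExtMod R B I (i + 1)) :=
      ExtMod.subsingleton_of_hasInjectiveDimensionLT
        Module.Injective.hasInjectiveDimensionLT _ (by omega)
    have h' := (hS.hasInjectiveDimensionLT_X₃_iff r
      ((Module.injective_iff_injective_object R I).mp hI)).mpr h
    have hX' := ih (I ⧸ LinearMap.range f) h' fun i => by
      obtain ⟨e⟩ := ExtMod.coshift_equiv (N := B) (hI' i) (hI' (i + 1)) hf hfg hg
      have := hE (i + 1)
      exact e.symm.subsingleton
    have hS' := ModuleCat.shortExact_of_exact (CoextMod.map_injective (B := B) hf)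
      (CoextMod.map_exact hf hfg) (CoextMod.map_surjective (hI' 0) (hE 0) hf hfg hg)
    exact (hS'.hasInjectiveDimensionLT_X₃_iff r
      ((Module.injective_iff_injective_object B _).mp inferInstance)).mp hX'

/-- The induction replaces `X` by its cosyzygy, which lowers `c`. In the application `Hom_R(B, X) =
0`, but this does not survive the replacement; injectivity of `Hom_R(B, X)` does, since a quotient
of an injective by an injective is injective. -/
theorem exists_finite_injectiveDimension_ext_succ {r : ℕ} (c : ℕ) :
    ∀ (X : Type u) [AddCommGroup X] [Module R X],
      HasInjectiveDimensionLE (ModuleCat.of R X) r →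
      Module.Injective B (CoextMod R B X) →
      (∀ i, i ≠ c → Subsingleton (ExtMod R B X (i + 1))) →
      ∃ (W : Type u) (_ : AddCommGroup W) (_ : Module B W) (_ : Module R W)
        (_ : IsScalarTower R B W), (∃ r', HasInjectiveDimensionLE (ModuleCat.of B W) r') ∧
        Nonempty (W ≃ₗ[R] ExtMod R B X (c + 1)) := by
  induction c with
  | zero =>
    intro X _ _ h hinj hE
    obtain ⟨I, _, _, f, hf, hI⟩ := Module.exists_injective_embedding (R := R) (X := X)
    have hfg : Function.Exact f (LinearMap.range f).mkQ := LinearMap.exact_map_mkQ_range f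
    have hg := (LinearMap.range f).mkQ_surjective
    have hS := ModuleCat.shortExact_of_exact hf hfg hg
    have hI' (i : ℕ) : Subsingleton (ExtMod R B I (i + 1)) :=
      ExtMod.subsingleton_of_hasInjectiveDimensionLT
        Module.Injective.hasInjectiveDimensionLT _ (by omega)
    have h' : HasInjectiveDimensionLE (ModuleCat.of R (I ⧸ LinearMap.range f)) r :=
      (hS.hasInjectiveDimensionLT_X₃_iff r
      ((Module.injective_iff_injective_object R I).mp hI)).mpr (h.of_le (by omega))
    have hX' := CoextMod.hasInjectiveDimensionLE (B := B) r (I ⧸ LinearMap.range f) h' fun i => by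
      obtain ⟨e⟩ := ExtMod.coshift_equiv (N := B) (hI' i) (hI' (i + 1)) hf hfg hg
      have := hE (i + 1) (by omega)
      exact e.symm.subsingleton
    -- The range of `g'` is `Hom(B, I)/Hom(B, X)`, hence injective. The cokernel of `g'` is `Ext¹(B,
    -- X)`, a quotient of a module of finite injective dimension by an injective one.
    let g' := CoextMod.map (B := B) (LinearMap.range f).mkQ
    have hL := (ModuleCat.shortExact_of_exact (CoextMod.map_injective (B := B) hf)
      (g := g'.rangeRestrict) (by
        intro x
        rw [← CoextMod.map_exact hf hfg x]
        exact Subtype.ext_iff) (LinearMap.surjective_rangeRestrict _)).hasInjectiveDimensionLT_X₃ 1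
      (Module.Injective.hasInjectiveDimensionLT) (Module.Injective.hasInjectiveDimensionLT.of_le (by omega))
    have hW := (ModuleCat.shortExact_of_exact (R := B) (f := (LinearMap.range g').subtype)
      (g := (LinearMap.range g').mkQ) Subtype.val_injective
      (LinearMap.exact_subtype_mkQ _) (Submodule.mkQ_surjective _)).hasInjectiveDimensionLT_X₃
      (r + 1) hX' (hL.of_le (by omega))
    obtain ⟨e⟩ := ExtMod.one_coequiv (N := B) (hI' 0) hf hfg hg
    refine ⟨CoextMod R B (I ⧸ LinearMap.range f) ⧸ LinearMap.range g', inferInstance,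
      inferInstance, inferInstance, inferInstance, ⟨r, hW⟩, ⟨?_⟩⟩
    let e₁ := Submodule.Quotient.restrictScalarsEquiv R (LinearMap.range g')
    let e₂ := Submodule.Quotient.equiv ((LinearMap.range g').restrictScalars R)
      (LinearMap.range ((LinearMap.range f).mkQ.compRight R (M := B))) CoextMod.toHom (by
        ext x
        simp only [Submodule.mem_map, Submodule.restrictScalars_mem, LinearMap.mem_range]
        constructor
        · rintro ⟨_, ⟨y, rfl⟩, rfl⟩; exact ⟨CoextMod.toHom y, rfl⟩
        · rintro ⟨y, rfl⟩; exact ⟨_, ⟨CoextMod.toHom.symm y, rfl⟩, rfl⟩)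
    exact (e₁.symm.trans e₂).trans e.symm
  | succ c ih =>
    intro X _ _ h hinj hE
    obtain ⟨I, _, _, f, hf, hI⟩ := Module.exists_injective_embedding (R := R) (X := X)
    have hfg : Function.Exact f (LinearMap.range f).mkQ := LinearMap.exact_map_mkQ_range f
    have hg := (LinearMap.range f).mkQ_surjective
    have hS := ModuleCat.shortExact_of_exact hf hfg hg
    have hI' (i : ℕ) : Subsingleton (ExtMod R B I (i + 1)) :=
      ExtMod.subsingleton_of_hasInjectiveDimensionLT
        Module.Injective.hasInjectiveDimensionLT _ (by omega)
    have h' : HasInjectiveDimensionLE (ModuleCat.of R (I ⧸ LinearMap.range f)) r :=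
      (hS.hasInjectiveDimensionLT_X₃_iff r
      ((Module.injective_iff_injective_object R I).mp hI)).mpr (h.of_le (by omega))
    have hS' := ModuleCat.shortExact_of_exact (CoextMod.map_injective (B := B) hf)
      (CoextMod.map_exact hf hfg) (CoextMod.map_surjective (hI' 0) (hE 0 (by omega)) hf hfg hg)
    have hinj' : Module.Injective B (CoextMod R B (I ⧸ LinearMap.range f)) :=
      (Module.injective_iff_injective_object B _).mpr
        (injective_iff_hasInjectiveDimensionLT_one.mpr (hS'.hasInjectiveDimensionLT_X₃ 1
        (Module.Injective.hasInjectiveDimensionLT) (Module.Injective.hasInjectiveDimensionLT.of_le (by omega))))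
    obtain ⟨e⟩ := ExtMod.coshift_equiv (N := B) (hI' c) (hI' (c + 1)) hf hfg hg
    obtain ⟨W, _, _, _, _, hr, ⟨e'⟩⟩ := ih (I ⧸ LinearMap.range f) h' hinj' fun i hi => by
      obtain ⟨e⟩ := ExtMod.coshift_equiv (N := B) (hI' i) (hI' (i + 1)) hf hfg hg
      have := hE (i + 1) (by omega)
      exact e.symm.subsingleton
    exact ⟨W, inferInstance, inferInstance, inferInstance, inferInstance, hr, ⟨e'.trans e.symm⟩⟩

/-- If `X` has finite injective dimension over `R` and `Ext_R(B, X)` is concentrated in degree `c`,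
then `Ext_R^c(B, X)` underlies a `B`-module of finite injective dimension. -/
theorem exists_finite_injectiveDimension_ext {r : ℕ} (c : ℕ)
    (h : HasInjectiveDimensionLE (ModuleCat.of R X) r)
    (hE : ∀ i, i ≠ c → Subsingleton (ExtMod R B X i)) :
    ∃ (W : Type u) (_ : AddCommGroup W) (_ : Module B W) (_ : Module R W)
      (_ : IsScalarTower R B W), (∃ r', HasInjectiveDimensionLE (ModuleCat.of B W) r') ∧
      Nonempty (W ≃ₗ[R] ExtMod R B X c) := by
  cases c with
  | zero =>
    exact ⟨CoextMod R B X, _, _, _, inferInstance,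
      ⟨r, CoextMod.hasInjectiveDimensionLE r X h fun i => hE _ (by omega)⟩,
      ⟨CoextMod.toHom.trans ExtMod.zeroEquiv.symm⟩⟩
  | succ c =>
    -- For positive `c` the module `Hom_R(B, X) = Ext⁰` vanishes, so it is trivially injective and
    -- starts the induction.
    have : Subsingleton (CoextMod R B X) := by
      have := hE 0 (by omega)
      exact (CoextMod.toHom.trans (ExtMod.zeroEquiv (R := R) (M := B) (N := X)).symm).subsingleton
    exact exists_finite_injectiveDimension_ext_succ c X h
      ⟨fun _ _ _ _ _ _ _ _ _ => ⟨0, fun _ => Subsingleton.elim _ _⟩⟩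
      fun i hi => hE _ (by omega)

/-- Surjectivity of `R → B` makes every `R`-linear map of `B`-modules `B`-linear, so an
`R`-isomorphism `Ext^c(B, X) ≃ B` transports the finite injective dimension over `B`. Used both for
quotients by a nonzerodivisor and for the local rings of fibers. -/
theorem exists_hasInjectiveDimensionLE_self_of_ext_equiv {r : ℕ} (c : ℕ)
    (hsurj : Function.Surjective (algebraMap R B))
    (h : HasInjectiveDimensionLE (ModuleCat.of R X) r)
    (hE : ∀ i, i ≠ c → Subsingleton (ExtMod R B X i))
    (e : Nonempty (ExtMod R B X c ≃ₗ[R] B)) :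
    ∃ r', HasInjectiveDimensionLE (ModuleCat.of B B) r' := by
  obtain ⟨W, _, _, _, _, ⟨r', hr'⟩, ⟨e'⟩⟩ := exists_finite_injectiveDimension_ext (B := B) c h hE
  obtain ⟨e⟩ := e
  exact ⟨r', hasInjectiveDimensionLT_of_iso
    ((e'.trans e).extendScalarsOfSurjective hsurj).toModuleIso _⟩

end Coextension

/-! ### The contravariant long exact sequence of `Ext`. -/

section LongExact

variable {R : Type u} [CommRing R]
variable {M' F M X : Type u} [AddCommGroup M'] [AddCommGroup F] [AddCommGroup M] [AddCommGroup X]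
  [Module R M'] [Module R F] [Module R M] [Module R X]

/-- Contravariant functoriality of `Ext`. -/
def ExtMod.map (X : Type u) [AddCommGroup X] [Module R X] (f : M →ₗ[R] F) (i : ℕ) :
    ExtMod R F X i →ₗ[R] ExtMod R M X i :=
  (Ext.mk₀ (ModuleCat.ofHom f)).precompOfLinear R (ModuleCat.of R X) (zero_add i)

theorem ExtMod.map_apply (f : M →ₗ[R] F) (i : ℕ) (x : ExtMod R F X i) :
    ExtMod.map X f i x = (Ext.mk₀ (ModuleCat.ofHom f)).comp x (zero_add i) := rfl

theorem ExtMod.map_id (i : ℕ) (x : ExtMod R M X i) : ExtMod.map X LinearMap.id i x = x :=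
  Ext.mk₀_id_comp x

theorem ExtMod.map_comp (f : M' →ₗ[R] F) (g : F →ₗ[R] M) (i : ℕ) (x : ExtMod R M X i) :
    ExtMod.map X (g ∘ₗ f) i x = ExtMod.map X f i (ExtMod.map X g i x) := by
  rw [map_apply, map_apply, map_apply, Ext.mk₀_comp_mk₀_assoc]
  rfl

theorem ExtMod.map_smul (r : R) (f : M →ₗ[R] F) (i : ℕ) (x : ExtMod R F X i) :
    ExtMod.map X (r • f) i x = r • ExtMod.map X f i x := by
  have : ModuleCat.ofHom (r • f) = r • ModuleCat.ofHom f := rfl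
  rw [map_apply, this, Ext.mk₀_smul, Ext.smul_comp]
  rfl

theorem ExtMod.map_add (f g : M →ₗ[R] F) (i : ℕ) (x : ExtMod R F X i) :
    ExtMod.map X (f + g) i x = ExtMod.map X f i x + ExtMod.map X g i x := by
  have : ModuleCat.ofHom (f + g) = ModuleCat.ofHom f + ModuleCat.ofHom g := rfl
  rw [map_apply, this, Ext.mk₀_add, Ext.add_comp]
  rfl

theorem ExtMod.map_sum {κ : Type*} (s : Finset κ) (f : κ → M →ₗ[R] F) (i : ℕ)
    (x : ExtMod R F X i) :
    ExtMod.map X (∑ k ∈ s, f k) i x = ∑ k ∈ s, ExtMod.map X (f k) i x := by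
  let Φ : (M →ₗ[R] F) →+ ExtMod R M X i := AddMonoidHom.mk' (fun f => ExtMod.map X f i x)
    fun f g => ExtMod.map_add f g i x
  exact _root_.map_sum Φ f s

variable {f : M' →ₗ[R] F} {g : F →ₗ[R] M}

theorem ExtMod.map_exact (hf : Function.Injective f) (hfg : Function.Exact f g)
    (hg : Function.Surjective g) (i : ℕ) :
    Function.Exact (ExtMod.map X g i) (ExtMod.map X f i) := by
  have hS := ModuleCat.shortExact_of_exact hf hfg hg
  intro x
  constructor
  · intro hx
    obtain ⟨y, hy⟩ := Ext.contravariant_sequence_exact₂ hS (ModuleCat.of R X) x hx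
    exact ⟨y, hy⟩
  · rintro ⟨y, rfl⟩
    rw [← ExtMod.map_comp, hfg.linearMap_comp_eq_zero]
    have : ModuleCat.ofHom (0 : M' →ₗ[R] M) = 0 := rfl
    rw [map_apply, this, Ext.mk₀_zero, Ext.zero_comp]

theorem ExtMod.exists_connecting (X : Type u) [AddCommGroup X] [Module R X]
    (hf : Function.Injective f) (hfg : Function.Exact f g)
    (hg : Function.Surjective g) (i : ℕ) :
    ∃ δ : ExtMod R M' X i →ₗ[R] ExtMod R M X (i + 1),
      Function.Exact (ExtMod.map X f i) δ ∧ Function.Exact δ (ExtMod.map X g (i + 1)) := by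
  have hS := ModuleCat.shortExact_of_exact hf hfg hg
  refine ⟨hS.extClass.precompOfLinear R (ModuleCat.of R X) (add_comm 1 i), ?_, ?_⟩
  · intro x
    constructor
    · intro hx
      obtain ⟨y, hy⟩ := Ext.contravariant_sequence_exact₁ hS (ModuleCat.of R X) x (add_comm 1 i) hx
      exact ⟨y, hy⟩
    · rintro ⟨y, rfl⟩
      exact hS.extClass_comp_assoc _ (h := add_comm 1 i)
  · intro x
    constructor
    · intro hx
      obtain ⟨y, hy⟩ := Ext.contravariant_sequence_exact₃ hS (ModuleCat.of R X) x hx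
        (add_comm 1 i)
      exact ⟨y, hy⟩
    · rintro ⟨y, rfl⟩
      exact hS.comp_extClass_assoc _ (add_comm 1 i)

theorem ExtMod.map_surjective (hf : Function.Injective f) (hfg : Function.Exact f g)
    (hg : Function.Surjective g) (i : ℕ) (h : Subsingleton (ExtMod R M X (i + 1))) :
    Function.Surjective (ExtMod.map X f i) := by
  obtain ⟨δ, h1, -⟩ := ExtMod.exists_connecting X hf hfg hg i
  exact fun x => (h1 x).mp (Subsingleton.elim _ _)

theorem ExtMod.subsingleton_middle (hf : Function.Injective f) (hfg : Function.Exact f g)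
    (hg : Function.Surjective g) (i : ℕ) (h : Subsingleton (ExtMod R M X i))
    (h' : Subsingleton (ExtMod R M' X i)) : Subsingleton (ExtMod R F X i) := by
  refine subsingleton_of_forall_eq 0 fun x => ?_
  obtain ⟨y, rfl⟩ := (ExtMod.map_exact hf hfg hg i x).mp (Subsingleton.elim _ _)
  rw [Subsingleton.elim y 0, _root_.map_zero]

end LongExact

/-! ### Cyclic modules and Nakayama's lemma. -/

section Cyclic

/-- A module generated by one element. -/
def IsCyclicModule (R M : Type*) [CommRing R] [AddCommGroup M] [Module R M] : Prop :=
  ∃ x : M, ∀ y : M, ∃ a : R, y = a • x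

variable {R M N : Type*} [CommRing R] [AddCommGroup M] [Module R M] [AddCommGroup N] [Module R N]

theorem IsCyclicModule.of_surjective (h : IsCyclicModule R M) (f : M →ₗ[R] N)
    (hf : Function.Surjective f) : IsCyclicModule R N := by
  obtain ⟨x, hx⟩ := h
  refine ⟨f x, fun y => ?_⟩
  obtain ⟨z, rfl⟩ := hf y
  obtain ⟨a, ha⟩ := hx z
  exact ⟨a, by rw [ha, map_smul]⟩

theorem IsCyclicModule.self : IsCyclicModule R R := ⟨1, fun y => ⟨y, by simp⟩⟩

/-- Nakayama: a finite module over a local ring is cyclic if it is cyclic modulo a submodule of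
`𝔪 • ⊤`. -/
theorem IsCyclicModule.of_ker_le [IsLocalRing R] [Module.Finite R M] (f : M →ₗ[R] N)
    (hf : Function.Surjective f) (h : IsCyclicModule R N)
    (hk : LinearMap.ker f ≤ IsLocalRing.maximalIdeal R • ⊤) : IsCyclicModule R M := by
  obtain ⟨x, hx⟩ := h
  obtain ⟨z, rfl⟩ := hf x
  have : (⊤ : Submodule R M) ≤ Submodule.span R {z} := by
    apply Submodule.le_of_le_smul_of_le_jacobson_bot Module.Finite.fg_top
      (IsLocalRing.maximalIdeal_le_jacobson ⊥)
    intro y _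
    obtain ⟨a, ha⟩ := hx (f y)
    have h1 : y - a • z ∈ LinearMap.ker f := by simp [ha]
    rw [← add_sub_cancel (a • z) y]
    exact add_mem (Submodule.mem_sup_left (Submodule.smul_mem _ _
      (Submodule.mem_span_singleton_self z))) (Submodule.mem_sup_right (hk h1))
  refine ⟨z, fun y => ?_⟩
  obtain ⟨a, ha⟩ := Submodule.mem_span_singleton.mp (this (Submodule.mem_top (x := y)))
  exact ⟨a, ha.symm⟩

theorem subsingleton_of_forall_smul [IsLocalRing R] [Module.Finite R M] {t : R}
    (ht : t ∈ IsLocalRing.maximalIdeal R) (h : ∀ x : M, ∃ y, x = t • y) : Subsingleton M := by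
  rw [← Submodule.subsingleton_iff R, ← subsingleton_iff_bot_eq_top, eq_comm]
  apply Submodule.eq_bot_of_le_smul_of_le_jacobson_bot _ _ Module.Finite.fg_top _
    (IsLocalRing.maximalIdeal_le_jacobson ⊥)
  intro x _
  obtain ⟨y, rfl⟩ := h x
  exact Submodule.smul_mem_smul ht trivial

end Cyclic

/-! ### `Ext` of the residue field along a regular sequence. -/

section RegularSequence

open RingTheory.Sequence Pointwise

variable {R : Type u} [CommRing R] {X : Type u} [AddCommGroup X] [Module R X]

theorem exact_lsmul_mkQ_quotSMulTop (N : Type u) [AddCommGroup N] [Module R N] (r : R) :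
    Function.Exact (LinearMap.lsmul R N r) (Submodule.mkQ (r • (⊤ : Submodule R N))) :=
  LinearMap.exact_lsmul_mkQ_smul_top N r

/-- Since `Ext^{l+1}(N, X) = 0`, the connecting map from `Ext^l(N, X)` onto `Ext^{l+1}(N/rN, X)` is
surjective. Only vanishing above degree `l` is needed to continue the process. -/
theorem isCyclicModule_ext_quotSMulTop {N : Type u} [AddCommGroup N] [Module R N] {l : ℕ} {r : R}
    (hr : IsSMulRegular N r) (h0 : ∀ i, l < i → Subsingleton (ExtMod R N X i))
    (hc : IsCyclicModule R (ExtMod R N X l)) :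
    (∀ i, l + 1 < i → Subsingleton (ExtMod R (QuotSMulTop r N) X i)) ∧
      IsCyclicModule R (ExtMod R (QuotSMulTop r N) X (l + 1)) := by
  have hex := exact_lsmul_mkQ_quotSMulTop N r
  have hs := Submodule.mkQ_surjective (r • (⊤ : Submodule R N))
  have hr' : Function.Injective (LinearMap.lsmul R N r) := hr
  constructor
  · intro i hi
    obtain ⟨j, rfl⟩ : ∃ j, i = j + 1 := ⟨i - 1, by omega⟩
    obtain ⟨e⟩ := ExtMod.shift_equiv (N := X) (h0 j (by omega)) (h0 (j + 1) (by omega)) hr' hex hs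
    have := h0 j (by omega)
    exact e.subsingleton
  · obtain ⟨δ, -, h2⟩ := ExtMod.exists_connecting X hr' hex hs l
    have := h0 (l + 1) (by omega)
    exact hc.of_surjective δ fun x => (h2 x).mp (Subsingleton.elim _ _)

theorem isCyclicModule_ext_quotient_ofList (rs : List R) :
    ∀ (l : ℕ) (N : Type u) [AddCommGroup N] [Module R N], IsWeaklyRegular N rs →
      (∀ i, l < i → Subsingleton (ExtMod R N X i)) → IsCyclicModule R (ExtMod R N X l) →
      IsCyclicModule R
        (ExtMod R (N ⧸ Ideal.ofList rs • (⊤ : Submodule R N)) X (l + rs.length)) := by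
  induction rs with
  | nil =>
    intro l N _ _ _ _ hc
    obtain ⟨e⟩ := ExtMod.congr_left (N := X)
      (Submodule.quotEquivOfEqBot (Ideal.ofList ([] : List R) • (⊤ : Submodule R N)) (by simp)) l
    exact hc.of_surjective e.toLinearMap e.surjective
  | cons r rs ih =>
    intro l N _ _ hw h0 hc
    rw [isWeaklyRegular_cons_iff] at hw
    obtain ⟨h1, h2⟩ := isCyclicModule_ext_quotSMulTop hw.1 h0 hc
    have := ih (l + 1) (QuotSMulTop r N) hw.2 h1 h2
    obtain ⟨e⟩ := ExtMod.congr_left (N := X)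
      (Submodule.quotOfListConsSMulTopEquivQuotSMulTopInner N r rs) (l + (r :: rs).length)
    refine IsCyclicModule.of_surjective ?_ e.toLinearMap e.surjective
    rw [List.length_cons, show l + (rs.length + 1) = l + 1 + rs.length by omega]
    exact this

/-- If the maximal ideal is generated by a regular sequence of length `n`, then `Ext^n(k, R)` is
cyclic. -/
theorem isCyclicModule_ext_residueField {I : Ideal R} {rs : List R} (hrs : IsRegular R rs)
    (hI : Ideal.ofList rs = I) : IsCyclicModule R (ExtMod R (R ⧸ I) R rs.length) := by
  have h := isCyclicModule_ext_quotient_ofList (X := R) rs 0 R hrs.toIsWeaklyRegular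
    (fun i hi => by
      obtain ⟨j, rfl⟩ : ∃ j, i = j + 1 := ⟨i - 1, by omega⟩
      exact ExtMod.subsingleton_of_projective j)
    (IsCyclicModule.self.of_surjective
      ((LinearMap.ringLmapEquivSelf R R R).symm.trans ExtMod.zeroEquiv.symm).toLinearMap
      (LinearEquiv.surjective _))
  rw [zero_add] at h
  obtain ⟨e⟩ := ExtMod.congr_left (N := R)
    (Submodule.quotEquivOfEq I (Ideal.ofList rs • (⊤ : Submodule R R)) (by simp [hI])) rs.length
  exact h.of_surjective e.toLinearMap e.surjective

end RegularSequence

/-! ### Noetherian local rings of finite self-injective dimension. -/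

section SelfInjective

variable {B : Type u} [CommRing B]

/-- Baer's criterion for injective dimension. -/
theorem hasInjectiveDimensionLE_of_ext_quotient (r : ℕ) :
    ∀ (X : Type u) [AddCommGroup X] [Module B X],
      (∀ I : Ideal B, Subsingleton (ExtMod B (B ⧸ I) X (r + 1))) →
      HasInjectiveDimensionLE (ModuleCat.of B X) r := by
  induction r with
  | zero =>
    intro X _ _ h
    suffices Module.Injective B X from Module.Injective.hasInjectiveDimensionLT
    apply Module.Baer.injective
    intro I g
    obtain ⟨e⟩ := ExtMod.one_equiv (N := X) (f := I.subtype) (g := I.mkQ) Subtype.val_injective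
      (LinearMap.exact_subtype_mkQ I) I.mkQ_surjective
    have := h I
    have := e.symm.subsingleton
    rw [Submodule.Quotient.subsingleton_iff] at this
    obtain ⟨φ, hφ⟩ := LinearMap.range_eq_top.mp this g
    exact ⟨φ, fun x hx => LinearMap.congr_fun hφ ⟨x, hx⟩⟩
  | succ r ih =>
    intro X _ _ h
    obtain ⟨I, _, _, f, hf, hI⟩ := Module.exists_injective_embedding (R := B) (X := X)
    have hfg : Function.Exact f (LinearMap.range f).mkQ := LinearMap.exact_map_mkQ_range f
    have hg := (LinearMap.range f).mkQ_surjective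
    have hS := ModuleCat.shortExact_of_exact hf hfg hg
    refine (hS.hasInjectiveDimensionLT_X₃_iff r
      ((Module.injective_iff_injective_object B I).mp hI)).mp (ih _ fun J => ?_)
    have hI' (N : Type u) [AddCommGroup N] [Module B N] (i : ℕ) :
        Subsingleton (ExtMod B N I (i + 1)) :=
      ExtMod.subsingleton_of_hasInjectiveDimensionLT
        Module.Injective.hasInjectiveDimensionLT _ (by omega)
    obtain ⟨e⟩ := ExtMod.coshift_equiv (N := B ⧸ J) (hI' _ r) (hI' _ (r + 1)) hf hfg hg
    have := h J
    exact e.symm.subsingleton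

variable [IsLocalRing B] [IsNoetherianRing B]

/-- Vanishing of one `Ext` into `B` can be tested on the residue field, if the next one vanishes. -/
theorem subsingleton_ext_of_residueField {r : ℕ} {X : Type u} [AddCommGroup X] [Module B X]
    [Module.Finite B X]
    (h : ∀ (N : Type u) [AddCommGroup N] [Module B N], Subsingleton (ExtMod B N X (r + 1)))
    (hk : Subsingleton (ExtMod B (B ⧸ IsLocalRing.maximalIdeal B) X r))
    (N : Type u) [AddCommGroup N] [Module B N] [Module.Finite B N] :
    Subsingleton (ExtMod B N X r) := by
  induction ‹Module.Finite B N› using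
    IsNoetherianRing.induction_on_isQuotientEquivQuotientPrime B with
  | subsingleton N =>
    have : Module.Projective B N := inferInstance
    cases r with
    | zero => exact (ExtMod.zeroEquiv (R := B) (M := N) (N := X)).subsingleton
    | succ r => exact ExtMod.subsingleton_of_projective r
  | quotient N p e =>
    obtain ⟨e'⟩ := ExtMod.congr_left (N := X) e r
    suffices Subsingleton (ExtMod B (B ⧸ p.asIdeal) X r) from e'.symm.subsingleton
    by_cases hp : p.asIdeal = IsLocalRing.maximalIdeal B
    · rw [hp]; exact hk
    -- Multiplication by `y` is injective on `B/p`, and the next `Ext` of its cokernel vanishes; so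
    -- `y` acts surjectively on the finite module `Ext^r(B/p, X)`, which is zero by Nakayama.
    obtain ⟨y, hy, hyp⟩ : ∃ y ∈ IsLocalRing.maximalIdeal B, y ∉ p.asIdeal := by
      by_contra! hcon
      exact hp (le_antisymm (IsLocalRing.le_maximalIdeal p.2.ne_top) hcon)
    have hinj : Function.Injective (y • LinearMap.id : (B ⧸ p.asIdeal) →ₗ[B] (B ⧸ p.asIdeal)) := by
      rw [injective_iff_map_eq_zero]
      intro x hx
      obtain ⟨x, rfl⟩ := Ideal.Quotient.mk_surjective x
      have h1 : Ideal.Quotient.mk p.asIdeal (y * x) = 0 := hx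
      rw [Ideal.Quotient.eq_zero_iff_mem] at h1 ⊢
      exact (p.2.mem_or_mem h1).resolve_left hyp
    have hs := ExtMod.map_surjective (X := X) hinj (LinearMap.exact_map_mkQ_range _)
      (Submodule.mkQ_surjective _) r (h _)
    refine subsingleton_of_forall_smul hy fun x => ?_
    obtain ⟨z, rfl⟩ := hs x
    exact ⟨z, by rw [ExtMod.map_smul, ExtMod.map_id]⟩
  | exact N₁ N₂ N₃ f g hf hg hfg h1 h3 =>
    exact ExtMod.subsingleton_middle hf hfg hg r h3 h1

/-- A local ring of finite self-injective dimension and depth zero is self-injective. -/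
theorem injective_self_of_depth_zero {x : B} (hx : x ≠ 0)
    (hmx : ∀ y ∈ IsLocalRing.maximalIdeal B, y * x = 0) (r : ℕ)
    (h : HasInjectiveDimensionLE (ModuleCat.of B B) r) : Module.Injective B B := by
  induction r with
  | zero =>
    exact (Module.injective_iff_injective_object B B).mpr
      (injective_iff_hasInjectiveDimensionLT_one.mpr h)
  | succ r ih =>
    apply ih
    have hE (N : Type u) [AddCommGroup N] [Module B N] :
        Subsingleton (ExtMod B N B (r + 2)) :=
      ExtMod.subsingleton_of_hasInjectiveDimensionLT h _ le_rfl
    refine hasInjectiveDimensionLE_of_ext_quotient r B fun I =>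
      subsingleton_ext_of_residueField hE ?_ _
    -- The socle element embeds the residue field in `B`. As `Ext^{r+2}` vanishes, `Ext^{r+1}(B, B)
    -- = 0` surjects onto `Ext^{r+1}` of the residue field, so the injective dimension can be
    -- lowered by one.
    let f : (B ⧸ IsLocalRing.maximalIdeal B) →ₗ[B] B :=
      Submodule.liftQ _ (LinearMap.toSpanSingleton B B x) fun y hy => by
        simpa using hmx y hy
    have hf : Function.Injective f := by
      rw [injective_iff_map_eq_zero]
      intro y hy
      obtain ⟨y, rfl⟩ := Submodule.mkQ_surjective _ y
      have hy' : y * x = 0 := hy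
      by_contra hne
      have : y ∉ IsLocalRing.maximalIdeal B := fun h =>
        hne ((Submodule.Quotient.mk_eq_zero _).mpr h)
      have hu : IsUnit y := by simpa using this
      exact hx ((hu.mul_right_eq_zero).mp hy')
    have := ExtMod.map_surjective (X := B) hf (LinearMap.exact_map_mkQ_range f)
      (Submodule.mkQ_surjective _) (r + 1) (hE _)
    have h0 : Subsingleton (ExtMod B B B (r + 1)) := ExtMod.subsingleton_of_projective r
    exact this.subsingleton

/-- The maximal ideal of a self-injective Noetherian local ring of depth zero is nil. -/
theorem isNilpotent_of_injective_self [Module.Injective B B] {x : B} (hx : x ≠ 0)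
    (hmx : ∀ y ∈ IsLocalRing.maximalIdeal B, y * x = 0) {y : B}
    (hy : y ∈ IsLocalRing.maximalIdeal B) : IsNilpotent y := by
  obtain ⟨N, hN⟩ := Filter.eventually_atTop.mp
    (Module.End.eventually_disjoint_ker_pow_range_pow (LinearMap.mulLeft B y))
  -- The exponent is `N + 1` so that `w` is divisible by `y`; this puts the socle element `x` in the
  -- kernel of `w`.
  have hd := hN (N + 1) (by omega)
  rw [LinearMap.pow_mulLeft] at hd
  set w := y ^ (N + 1) with hw
  set K := LinearMap.ker (LinearMap.mulLeft B w)
  let f : (K × LinearMap.range (LinearMap.mulLeft B w)) →ₗ[B] B :=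
    K.subtype.coprod (Submodule.subtype _)
  have hf : Function.Injective f := by
    rw [injective_iff_map_eq_zero]
    rintro ⟨a, b⟩ hab
    have hab' : (a : B) = -b := eq_neg_of_add_eq_zero_left hab
    have ha : (a : B) = 0 := by
      apply (Submodule.disjoint_def.mp hd) _ a.2
      rw [hab']; exact neg_mem b.2
    have hb : (b : B) = 0 := by rw [ha] at hab'; simpa using hab'.symm
    exact Prod.ext (Subtype.ext ha) (Subtype.ext hb)
  -- Self-injectivity extends the projection of `K ⊕ wB` onto `K` to multiplication by `h 1`. This
  -- element is an idempotent of `K` acting as the identity on `K`; in a local ring it is `1`,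
  -- giving `w = 0`, or `0`, which contradicts `x ∈ K`.
  obtain ⟨h, hh⟩ := Module.Injective.out (R := B) f hf (K.subtype ∘ₗ LinearMap.fst B _ _)
  have hmul (a : B) : h a = a * h 1 := by
    rw [← smul_eq_mul, ← map_smul, smul_eq_mul, mul_one]
  have h1 : ∀ a ∈ K, a * h 1 = a := fun a ha => by
    have := hh (⟨a, ha⟩, 0)
    rw [← hmul]; simpa [f] using this
  have h2 : w * h 1 = 0 := by
    have := hh (0, ⟨w, 1, by simp⟩)
    rw [← hmul]; simpa [f] using this
  have h3 : h 1 ∈ K := by simpa [K] using h2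
  have h4 := h1 _ h3
  have h5 : h 1 * (1 - h 1) = 0 := by rw [mul_sub, mul_one, h4, sub_self]
  have hxK : x ∈ K := by
    have : w * x = 0 := by rw [hw, pow_succ, mul_assoc, hmx y hy, mul_zero]
    simpa [K] using this
  rcases IsLocalRing.isUnit_or_isUnit_one_sub_self (h 1) with hu | hu
  · refine ⟨N + 1, ?_⟩
    exact (hu.mul_left_eq_zero).mp h2
  · have : h 1 = 0 := (hu.mul_left_eq_zero).mp h5
    exact absurd (h1 x hxK) (by rw [this, mul_zero]; exact hx.symm)

/-- The socle of a self-injective local ring is simple. -/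
theorem mem_span_of_injective_self {B : Type u} [CommRing B] [IsLocalRing B]
    [Module.Injective B B] {x z : B} (hx : x ≠ 0)
    (hmx : ∀ y ∈ IsLocalRing.maximalIdeal B, y * x = 0)
    (hz : ∀ y ∈ IsLocalRing.maximalIdeal B, y * z = 0) : ∃ a, z = a * x := by
  let F (b : B) (hb : ∀ y ∈ IsLocalRing.maximalIdeal B, y * b = 0) :
      (B ⧸ IsLocalRing.maximalIdeal B) →ₗ[B] B :=
    Submodule.liftQ _ (LinearMap.toSpanSingleton B B b) fun y hy => by simpa using hb y hy
  have hF (b hb) : F b hb (Submodule.mkQ _ 1) = b := one_smul B b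
  have hf : Function.Injective (F x hmx) := by
    rw [injective_iff_map_eq_zero]
    intro y hy
    obtain ⟨y, rfl⟩ := Submodule.mkQ_surjective _ y
    have hy' : y * x = 0 := hy
    by_contra hne
    have : y ∉ IsLocalRing.maximalIdeal B := fun h =>
      hne ((Submodule.Quotient.mk_eq_zero _).mpr h)
    have hu : IsUnit y := by simpa using this
    exact hx ((hu.mul_right_eq_zero).mp hy')
  obtain ⟨h, hh⟩ := Module.Injective.out (R := B) _ hf (F z hz)
  have := hh (Submodule.mkQ _ 1)
  rw [hF x hmx, hF z hz] at this
  exact ⟨h 1, by rw [← this, mul_comm, ← smul_eq_mul, ← map_smul, smul_eq_mul, mul_one]⟩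

/-- The quotient of a ring of finite self-injective dimension by a nonzerodivisor has finite
self-injective dimension. -/
theorem exists_hasInjectiveDimensionLE_quotient {B : Type u} [CommRing B] {θ : B}
    (hθ : θ ∈ nonZeroDivisors B) {r : ℕ} (h : HasInjectiveDimensionLE (ModuleCat.of B B) r) :
    ∃ r', HasInjectiveDimensionLE
      (ModuleCat.of (B ⧸ Ideal.span {θ}) (B ⧸ Ideal.span {θ})) r' := by
  let f : B →ₗ[B] B := LinearMap.mulLeft B θ
  let g : B →ₗ[B] (B ⧸ Ideal.span {θ}) := Submodule.mkQ (Ideal.span {θ})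
  have hf : Function.Injective f := by
    rw [injective_iff_map_eq_zero]
    intro x hx
    exact (mul_right_mem_nonZeroDivisors_eq_zero_iff hθ).mp ((mul_comm x θ).trans hx)
  have hfg : Function.Exact f g := by
    intro x
    simp only [g, Submodule.mkQ_apply, Submodule.Quotient.mk_eq_zero, Ideal.mem_span_singleton']
    exact ⟨fun ⟨a, ha⟩ => ⟨a, by simp [f, ← ha, mul_comm]⟩,
      fun ⟨a, ha⟩ => ⟨a, by simp [f, ← ha, mul_comm]⟩⟩
  have hg : Function.Surjective g := Submodule.mkQ_surjective _
  -- The two-term resolution by multiplication with `θ` shows that `Ext_B(B/θ, B)` lives in degree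
  -- `1`, where it is `B/θ` itself.
  refine exists_hasInjectiveDimensionLE_self_of_ext_equiv (R := B) (X := B) 1
    Ideal.Quotient.mk_surjective h ?_ ?_
  · intro i hi
    match i with
    | 0 =>
      refine (ExtMod.zeroEquiv (R := B)).subsingleton_congr.mpr
        (subsingleton_of_forall_eq 0 fun φ => ?_)
      ext
      refine (mul_right_mem_nonZeroDivisors_eq_zero_iff hθ).mp ?_
      rw [mul_comm, ← smul_eq_mul, ← map_smul]
      refine (congrArg φ ?_).trans (map_zero φ)
      exact (Submodule.Quotient.mk_eq_zero _).mpr (by simp)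
    | 1 => omega
    | i + 2 =>
      obtain ⟨e⟩ := ExtMod.shift_equiv (N := B) (i := i + 1)
        (ExtMod.subsingleton_of_projective _) (ExtMod.subsingleton_of_projective _) hf hfg hg
      have : Subsingleton (ExtMod B B B (i + 1)) := ExtMod.subsingleton_of_projective _
      exact e.subsingleton
  · obtain ⟨e⟩ := ExtMod.one_equiv (N := B) hf hfg hg
    refine ⟨e.trans (Submodule.Quotient.equiv _ _ (LinearMap.ringLmapEquivSelf B B B) ?_)⟩
    ext x
    simp only [Submodule.mem_map, LinearMap.mem_range, Ideal.mem_span_singleton']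
    constructor
    · rintro ⟨_, ⟨φ, rfl⟩, rfl⟩
      refine ⟨φ 1, ?_⟩
      have : φ (θ * 1) = φ 1 * θ := by rw [mul_comm (φ 1), ← smul_eq_mul, map_smul, smul_eq_mul]
      exact this.symm
    · rintro ⟨a, rfl⟩
      exact ⟨_, ⟨LinearMap.toSpanSingleton B B a, rfl⟩, by simp [f, mul_comm]⟩

end SelfInjective

/-! ### Self-injective quotients of a regular local ring. -/

section LocalGorenstein

variable {R B : Type u} [CommRing R] [CommRing B] [Algebra R B] [IsLocalRing R]
  [IsNoetherianRing R] [IsLocalRing B]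

theorem algebraMap_mem_maximalIdeal_iff {R B : Type*} [CommRing R] [CommRing B] [Algebra R B]
    [IsLocalRing R] [IsLocalRing B] (hsurj : Function.Surjective (algebraMap R B)) (t : R) :
    algebraMap R B t ∈ IsLocalRing.maximalIdeal B ↔ t ∈ IsLocalRing.maximalIdeal R := by
  have := IsLocalHom.of_surjective (algebraMap R B) hsurj
  rw [IsLocalRing.mem_maximalIdeal, IsLocalRing.mem_maximalIdeal, mem_nonunits_iff,
    mem_nonunits_iff, isUnit_map_iff]

/-- For an Artinian self-injective quotient `B` of a regular local ring `R` of dimension `n`,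
`Ext_R(B, R)` is cyclic and concentrated in degree `n`. -/
theorem ext_concentrated_of_injective_self {n : ℕ} [Module.Injective B B]
    (hsurj : Function.Surjective (algebraMap R B))
    (hR : HasInjectiveDimensionLE (ModuleCat.of R R) n) {rs : List R}
    (hrs : RingTheory.Sequence.IsRegular R rs) (hlen : rs.length = n)
    (hm : Ideal.ofList rs = IsLocalRing.maximalIdeal R) {x : B} (hx : x ≠ 0)
    (hmx : ∀ y ∈ IsLocalRing.maximalIdeal B, y * x = 0) :
    (∀ i, i ≠ n → Subsingleton (ExtMod R B R i)) ∧ IsCyclicModule R (ExtMod R B R n) := by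
  have : IsNoetherianRing B := isNoetherianRing_of_surjective R B (algebraMap R B) hsurj
  have hfin : Module.Finite R B :=
    Module.Finite.of_surjective (Algebra.linearMap R B) hsurj
  have hvan (N : Type u) [AddCommGroup N] [Module R N] (i : ℕ) (hi : n < i) :
      Subsingleton (ExtMod R N R i) :=
    ExtMod.subsingleton_of_hasInjectiveDimensionLT hR i hi
  constructor
  · intro i hi
    rcases Nat.lt_or_gt_of_ne hi with h | h
    -- Below degree `n` this is a depth argument: `B` is supported at the closed point because its
    -- maximal ideal is nil, and `R` has a regular sequence of length `n` in its maximal ideal.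
    · refine ModuleCat.subsingleton_ext_of_exists_isRegular (IsLocalRing.maximalIdeal R)
        (ModuleCat.of R B) ?_ (ModuleCat.of R R) ?_ rs ?_ hrs i (by omega)
      · change Module.support R B ⊆ _
        rw [Module.support_eq_zeroLocus]
        refine (PrimeSpectrum.zeroLocus_subset_zeroLocus_iff _ _).mpr fun t ht => ?_
        obtain ⟨k, hk⟩ := isNilpotent_of_injective_self hx hmx
          ((algebraMap_mem_maximalIdeal_iff hsurj t).mpr ht)
        refine ⟨k, Module.mem_annihilator.mpr fun b => ?_⟩
        rw [Algebra.smul_def, map_pow, hk, zero_mul]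
      · change IsLocalRing.maximalIdeal R • (⊤ : Submodule R R) < ⊤
        rw [smul_eq_mul, Ideal.mul_top, lt_top_iff_ne_top]
        exact (IsLocalRing.maximalIdeal.isMaximal R).ne_top
      · intro r hr
        rw [← hm]
        exact Ideal.subset_span hr
    · exact hvan B i h
  -- The inclusion of the socle induces a surjection from `Ext^n(B, R)` onto the cyclic module
  -- `Ext^n` of the residue field. By Nakayama it remains to put the kernel inside `𝔪 Ext^n(B, R)`.
  · let f : (R ⧸ IsLocalRing.maximalIdeal R) →ₗ[R] B :=
      Submodule.liftQ _ (LinearMap.toSpanSingleton R B x) fun y hy => by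
        have := hmx _ ((algebraMap_mem_maximalIdeal_iff hsurj y).mpr hy)
        simpa [Algebra.smul_def] using this
    have hfmk (y : R) : f (Submodule.mkQ _ y) = algebraMap R B y * x := Algebra.smul_def y x
    have hf : Function.Injective f := by
      rw [injective_iff_map_eq_zero]
      intro y hy
      obtain ⟨y, rfl⟩ := Submodule.mkQ_surjective _ y
      rw [hfmk] at hy
      by_contra hne
      have h1 : y ∉ IsLocalRing.maximalIdeal R := fun h =>
        hne ((Submodule.Quotient.mk_eq_zero _).mpr h)
      have hu : IsUnit y := by simpa using h1
      exact hx (((hu.map (algebraMap R B)).mul_right_eq_zero).mp hy)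
    have hcyc : IsCyclicModule R (ExtMod R (R ⧸ IsLocalRing.maximalIdeal R) R n) := by
      rw [← hlen]
      exact isCyclicModule_ext_residueField hrs hm
    have hfg := LinearMap.exact_map_mkQ_range f
    have hg := (LinearMap.range f).mkQ_surjective
    refine hcyc.of_ker_le (ExtMod.map R f n)
      (ExtMod.map_surjective hf hfg hg n (hvan _ _ (Nat.lt_succ_self n))) ?_
    intro e he
    obtain ⟨e, rfl⟩ := (ExtMod.map_exact (X := R) hf hfg hg n e).mp he
    obtain ⟨s, hs⟩ := (isNoetherianRing_iff_ideal_fg B).mp inferInstance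
      (IsLocalRing.maximalIdeal B)
    choose t ht using fun b => hsurj b
    classical
    -- Multiplication by generators of the maximal ideal has kernel exactly the simple socle, so
    -- `B/soc` embeds in a power of `B`, and `Ext^n` of that power surjects onto `Ext^n(B/soc, R)`.
    let v : B →ₗ[R] (s → B) := LinearMap.pi fun y => LinearMap.mulLeft R (y : B)
    have hv : LinearMap.range f ≤ LinearMap.ker v := by
      rintro _ ⟨y, rfl⟩
      obtain ⟨y, rfl⟩ := Submodule.mkQ_surjective _ y
      rw [LinearMap.mem_ker, hfmk]
      ext ⟨z, hz⟩
      have : z * x = 0 := hmx z (by rw [← hs]; exact Ideal.subset_span hz)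
      change z * (algebraMap R B y * x) = 0
      rw [mul_left_comm, this, mul_zero]
    have hker : LinearMap.ker v ≤ LinearMap.range f := by
      intro b hb
      have hb' : ∀ y ∈ IsLocalRing.maximalIdeal B, y * b = 0 := by
        intro y hy
        rw [← hs] at hy
        induction hy using Submodule.span_induction with
        | mem y hy => exact congrFun (LinearMap.mem_ker.mp hb) ⟨y, hy⟩
        | zero => simp
        | add y z _ _ h1 h2 => rw [add_mul, h1, h2, add_zero]
        | smul a y _ h1 => rw [smul_eq_mul, mul_assoc, h1, mul_zero]
      obtain ⟨a, rfl⟩ := mem_span_of_injective_self hx hmx hb'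
      exact ⟨Submodule.mkQ _ (t a), by rw [hfmk, ht]⟩
    let j := (LinearMap.range f).liftQ v hv
    have hj : Function.Injective j := by
      rw [← LinearMap.ker_eq_bot]
      exact Submodule.ker_liftQ_eq_bot _ _ hv hker
    obtain ⟨w, rfl⟩ := ExtMod.map_surjective (X := R) hj (LinearMap.exact_map_mkQ_range j)
      (Submodule.mkQ_surjective _) n (hvan _ _ (Nat.lt_succ_self n)) e
    -- The composite `B → B/soc → B^s` is a combination of coordinate inclusions with coefficients
    -- in `𝔪`, so every class coming from `B/soc` lies in `𝔪 Ext^n(B, R)`.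
    have hvsum : j ∘ₗ (LinearMap.range f).mkQ =
        ∑ y : s, (t y) • LinearMap.single R (fun _ : s => B) y := by
      ext b y
      simp [j, v, Pi.single_apply, Algebra.smul_def, ht]
    rw [← ExtMod.map_comp, hvsum, ExtMod.map_sum]
    refine sum_mem fun y _ => ?_
    rw [ExtMod.map_smul]
    refine Submodule.smul_mem_smul ?_ trivial
    rw [← algebraMap_mem_maximalIdeal_iff (B := B) (fun b => ⟨t b, ht b⟩), ht, ← hs]
    exact Ideal.subset_span y.2

end LocalGorenstein

/-! ### Reduction of the Gorenstein case to depth zero. -/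

section LocalGorenstein

variable {R : Type u} [CommRing R] [IsLocalRing R] [IsNoetherianRing R]

theorem exists_socle_of_disjoint_nonZeroDivisors {B : Type u} [CommRing B] [IsLocalRing B]
    [IsNoetherianRing B]
    (h : ∀ θ ∈ IsLocalRing.maximalIdeal B, θ ∉ nonZeroDivisors B) :
    ∃ x : B, x ≠ 0 ∧ ∀ y ∈ IsLocalRing.maximalIdeal B, y * x = 0 := by
  have := Ideal.bot_lt_annihilator_of_disjoint_nonZeroDivisors
    (I := IsLocalRing.maximalIdeal B) (Set.disjoint_left.mpr h)
  obtain ⟨x, hx, hx0⟩ := SetLike.exists_of_lt this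
  refine ⟨x, by simpa using hx0, fun y hy => ?_⟩
  rw [mul_comm]
  simpa using Submodule.mem_annihilator.mp hx y hy

theorem ringKrullDim_eq_zero_of_nilpotent {B : Type u} [CommRing B] [IsLocalRing B]
    (h : ∀ y ∈ IsLocalRing.maximalIdeal B, IsNilpotent y) : ringKrullDim B = 0 := by
  have : Ring.KrullDimLE 0 B := by
    refine Ring.KrullDimLE.mk₀ fun I hI => ?_
    have : I = IsLocalRing.maximalIdeal B := by
      refine le_antisymm (IsLocalRing.le_maximalIdeal hI.ne_top) fun y hy => ?_
      obtain ⟨k, hk⟩ := h y hy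
      exact hI.mem_of_pow_mem k (by rw [hk]; exact I.zero_mem)
    rw [this]
    infer_instance
  exact le_antisymm ((Ring.krullDimLE_iff (n := 0)).mp this) ringKrullDim_nonneg_of_nontrivial

/-- In the long exact sequence of multiplication by `θ`, vanishing of `Ext^{i+1}(B/θ)` makes `θ`
surjective on `Ext^i(B)`, which is then zero. In degree `c`, `Ext^c(B)/θ` is identified with
`Ext^{c+1}(B/θ)`, and Nakayama lifts its generator. -/
theorem ext_concentrated_of_quotient {B : Type u} [CommRing B] [Algebra R B] [IsLocalRing B]
    {c : ℕ} (hsurj : Function.Surjective (algebraMap R B)) {θ : B}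
    (hθ : θ ∈ IsLocalRing.maximalIdeal B) (hθ' : θ ∈ nonZeroDivisors B)
    (h0 : ∀ i, i ≠ c + 1 → Subsingleton (ExtMod R (B ⧸ Ideal.span {θ}) R i))
    (hc : IsCyclicModule R (ExtMod R (B ⧸ Ideal.span {θ}) R (c + 1))) :
    (∀ i, i ≠ c → Subsingleton (ExtMod R B R i)) ∧ IsCyclicModule R (ExtMod R B R c) := by
  have hfin : Module.Finite R B := Module.Finite.of_surjective (Algebra.linearMap R B) hsurj
  obtain ⟨t, ht⟩ := hsurj θ
  have htm : t ∈ IsLocalRing.maximalIdeal R := by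
    rw [← algebraMap_mem_maximalIdeal_iff hsurj, ht]; exact hθ
  let f : B →ₗ[R] B := t • LinearMap.id
  have hfb (b : B) : f b = θ * b := by simp [f, Algebra.smul_def, ht]
  let g : B →ₗ[R] (B ⧸ Ideal.span {θ}) := (Ideal.Quotient.mkₐ R (Ideal.span {θ})).toLinearMap
  have hf : Function.Injective f := by
    rw [injective_iff_map_eq_zero]
    intro b hb
    rw [hfb, mul_comm] at hb
    exact (mul_right_mem_nonZeroDivisors_eq_zero_iff hθ').mp hb
  have hfg : Function.Exact f g := by
    intro b
    simp only [g, AlgHom.toLinearMap_apply, Ideal.Quotient.mkₐ_eq_mk,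
      Ideal.Quotient.eq_zero_iff_mem, Ideal.mem_span_singleton', Set.mem_range, hfb]
    exact ⟨fun ⟨a, ha⟩ => ⟨a, by rw [mul_comm, ha]⟩, fun ⟨a, ha⟩ => ⟨a, by rw [mul_comm, ha]⟩⟩
  have hg : Function.Surjective g := Ideal.Quotient.mk_surjective
  have hmap (i : ℕ) (x : ExtMod R B R i) : ExtMod.map R f i x = t • x := by
    rw [ExtMod.map_smul, ExtMod.map_id]
  have hfinE (i : ℕ) : Module.Finite R (ExtMod R B R i) :=
    have : Module.Finite R (ModuleCat.of R B) := hfin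
    have : Module.Finite R (ModuleCat.of R R) := inferInstanceAs (Module.Finite R R)
    ModuleCat.finite_ext R _ _ i
  have hvan : ∀ i, i ≠ c → Subsingleton (ExtMod R B R i) := by
    intro i hi
    refine subsingleton_of_forall_smul htm fun x => ?_
    obtain ⟨y, rfl⟩ := ExtMod.map_surjective (X := R) hf hfg hg i (h0 _ (by omega)) x
    exact ⟨y, hmap i y⟩
  refine ⟨hvan, ?_⟩
  obtain ⟨δ, h1, h2⟩ := ExtMod.exists_connecting R hf hfg hg c
  have := hvan (c + 1) (by omega)
  refine hc.of_ker_le δ (fun x => (h2 x).mp (Subsingleton.elim _ _)) fun x hx => ?_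
  obtain ⟨y, rfl⟩ := (h1 x).mp hx
  rw [hmap]
  exact Submodule.smul_mem_smul htm trivial

/-- If `R` is a regular local ring of dimension `n` and the quotient `B` has finite self-injective
dimension, then `Ext_R(B, R)` is cyclic and concentrated in degree `n - dim B`. -/
theorem ext_concentrated_of_hasInjectiveDimensionLE {n : ℕ}
    (hR : HasInjectiveDimensionLE (ModuleCat.of R R) n) {rs : List R}
    (hrs : RingTheory.Sequence.IsRegular R rs) (hlen : rs.length = n)
    (hm : Ideal.ofList rs = IsLocalRing.maximalIdeal R) (hdim : ringKrullDim R ≤ n) (D : ℕ) :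
    ∀ (B : Type u) [CommRing B] [Algebra R B] [IsLocalRing B],
      Function.Surjective (algebraMap R B) → ringKrullDim B = D →
      (∃ r, HasInjectiveDimensionLE (ModuleCat.of B B) r) →
      ∃ c, c + D = n ∧ (∀ i, i ≠ c → Subsingleton (ExtMod R B R i)) ∧
        IsCyclicModule R (ExtMod R B R c) := by
  induction D with
  | zero =>
    rintro B _ _ _ hsurj hB ⟨r, hr⟩
    have : IsNoetherianRing B := isNoetherianRing_of_surjective R B (algebraMap R B) hsurj
    -- A nonzerodivisor in the maximal ideal would lower the dimension below zero.
    obtain ⟨x, hx, hmx⟩ := exists_socle_of_disjoint_nonZeroDivisors (B := B) (by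
      intro θ hθ hθ'
      have h1 := ringKrullDim_quotient_span_singleton_succ_eq_ringKrullDim_of_mem_nonZeroDivisors
        hθ' hθ
      have : Nontrivial (B ⧸ Ideal.span {θ}) :=
        Ideal.Quotient.nontrivial_iff.mpr (by simpa [Ideal.span_singleton_eq_top] using hθ)
      have h2 : 0 ≤ ringKrullDim (B ⧸ Ideal.span {θ}) := ringKrullDim_nonneg_of_nontrivial
      rw [hB] at h1
      have h3 : (1 : WithBot ℕ∞) ≤ 0 := by
        calc (1 : WithBot ℕ∞) = 0 + 1 := by simp
          _ ≤ _ := by gcongr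
          _ = 0 := h1
      exact absurd h3 (by decide))
    have := injective_self_of_depth_zero hx hmx r hr
    exact ⟨n, rfl, ext_concentrated_of_injective_self hsurj hR hrs hlen hm hx hmx⟩
  | succ D ih =>
    rintro B _ _ _ hsurj hB ⟨r, hr⟩
    have : IsNoetherianRing B := isNoetherianRing_of_surjective R B (algebraMap R B) hsurj
    by_cases hex : ∃ θ ∈ IsLocalRing.maximalIdeal B, θ ∈ nonZeroDivisors B
    · obtain ⟨θ, hθ, hθ'⟩ := hex
      have h1 := ringKrullDim_quotient_span_singleton_succ_eq_ringKrullDim_of_mem_nonZeroDivisors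
        hθ' hθ
      have : Nontrivial (B ⧸ Ideal.span {θ}) :=
        Ideal.Quotient.nontrivial_iff.mpr (by simpa [Ideal.span_singleton_eq_top] using hθ)
      have : IsLocalRing (B ⧸ Ideal.span {θ}) :=
        IsLocalRing.of_surjective' _ Ideal.Quotient.mk_surjective
      have h2 : ringKrullDim (B ⧸ Ideal.span {θ}) = D := by
        rw [hB] at h1
        push_cast at h1
        exact le_antisymm ((ENat.WithBot.add_le_add_one_right_iff).mp h1.le)
          ((ENat.WithBot.add_le_add_one_right_iff).mp h1.ge)
      have hsurj' : Function.Surjective (algebraMap R (B ⧸ Ideal.span {θ})) :=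
        Ideal.Quotient.mk_surjective.comp hsurj
      obtain ⟨c, hcD, h0, hc⟩ := ih _ hsurj' h2 (exists_hasInjectiveDimensionLE_quotient hθ' hr)
      have hle : ringKrullDim B ≤ n := (ringKrullDim_le_of_surjective _ hsurj).trans hdim
      rw [hB] at hle
      have hle' : D + 1 ≤ n := by exact_mod_cast hle
      -- The degree for the quotient is positive because `D + 1 = dim B ≤ n` and `c + D = n`.
      obtain ⟨c, rfl⟩ : ∃ c', c = c' + 1 := ⟨c - 1, by omega⟩
      exact ⟨c, by omega, ext_concentrated_of_quotient hsurj hθ hθ' h0 hc⟩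
    -- Depth zero would make `B` self-injective with nil maximal ideal, hence of dimension `0`. So
    -- in positive dimension a nonzerodivisor always exists, and no separate Cohen–Macaulay argument
    -- is needed.
    · push Not at hex
      obtain ⟨x, hx, hmx⟩ := exists_socle_of_disjoint_nonZeroDivisors hex
      have := injective_self_of_depth_zero hx hmx r hr
      have h0 := ringKrullDim_eq_zero_of_nilpotent fun y hy =>
        isNilpotent_of_injective_self hx hmx hy
      rw [hB] at h0
      exact absurd h0 (by exact_mod_cast Nat.succ_ne_zero D)

end LocalGorenstein

/-! ### The characteristic sequence of an `A[X]`-module. -/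

section PolynomialDimension

open Polynomial

variable {A : Type u} [CommRing A] (M : Type u) [AddCommGroup M] [Module A[X] M] [Module A M]
  [IsScalarTower A A[X] M]

/-- The evaluation `A[X] ⊗ M → M`. -/
def polynomialTensorEval : A[X] ⊗[A] M →ₗ[A[X]] M :=
  TensorProduct.AlgebraTensorModule.lift
    ((LinearMap.lsmul A[X] M).flip.restrictScalars A).flip

/-- Multiplication by the variable on an `A[X]`-module, as an `A`-linear map. -/
def polynomialMulX : M →ₗ[A] M := (LinearMap.lsmul A[X] M X).restrictScalars A

/-- The map `X ⊗ 1 - 1 ⊗ X` on `A[X] ⊗ M`. -/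
def polynomialTensorDiff : A[X] ⊗[A] M →ₗ[A[X]] A[X] ⊗[A] M :=
  LinearMap.lsmul A[X] _ X - (polynomialMulX M).baseChange A[X]

variable {M}

@[simp] theorem polynomialTensorEval_tmul (p : A[X]) (m : M) :
    polynomialTensorEval M (p ⊗ₜ m) = p • m := rfl

theorem polynomialTensorDiff_tmul (p : A[X]) (m : M) :
    polynomialTensorDiff M (p ⊗ₜ m) = (X * p) ⊗ₜ m - p ⊗ₜ ((X : A[X]) • m) := rfl

theorem polynomialTensorEval_surjective : Function.Surjective (polynomialTensorEval (A := A) M) :=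
  fun m => ⟨1 ⊗ₜ m, by simp⟩

/-- Modulo the image, `X^k ⊗ m` equals `1 ⊗ X^k m`, so every tensor is congruent to `1 ⊗` its
evaluation. -/
theorem polynomialTensorDiff_exact :
    Function.Exact (polynomialTensorDiff (A := A) M) (polynomialTensorEval M) := by
  have hpow (k : ℕ) (m : M) : ((X : A[X]) ^ k) ⊗ₜ[A] m - 1 ⊗ₜ[A] ((X : A[X]) ^ k • m) ∈
      LinearMap.range (polynomialTensorDiff (A := A) M) := by
    induction k generalizing m with
    | zero => simp
    | succ k ih =>
      have h := Submodule.add_mem _ (LinearMap.mem_range_self (polynomialTensorDiff M)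
        (((X : A[X]) ^ k) ⊗ₜ[A] m)) (ih ((X : A[X]) • m))
      rw [polynomialTensorDiff_tmul, sub_add_sub_cancel, smul_smul, ← pow_succ, ← pow_succ'] at h
      exact h
  have hall (t : A[X] ⊗[A] M) : t - 1 ⊗ₜ[A] (polynomialTensorEval M t) ∈
      LinearMap.range (polynomialTensorDiff (A := A) M) := by
    induction t with
    | zero => simp
    | add x y hx hy =>
      rw [map_add, tmul_add, add_sub_add_comm]
      exact Submodule.add_mem _ hx hy
    | tmul p m =>
      induction p using Polynomial.induction_on' with
      | add p q hp hq =>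
        rw [add_tmul, map_add, tmul_add, add_sub_add_comm]
        exact Submodule.add_mem _ hp hq
      | monomial k a =>
        have h := hpow k (a • m)
        rw [polynomialTensorEval_tmul, ← C_mul_X_pow_eq_monomial, C_mul', smul_tmul, smul_assoc,
          ← smul_comm]
        exact h
  intro t
  constructor
  · intro ht
    have := hall t
    rwa [ht, tmul_zero, sub_zero] at this
  · rintro ⟨s, rfl⟩
    induction s with
    | zero => simp
    | add x y hx hy => rw [map_add, map_add, hx, hy, add_zero]
    | tmul p m => simp [polynomialTensorDiff_tmul, mul_smul, ← mul_comm p X]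

/-- The coefficients of a tensor in the kernel satisfy `m_k = X m_{k+1}`, hence `m_k = X^j m_{k+j}`
for all `j`, and this is zero for large `j`. -/
theorem polynomialTensorDiff_injective :
    Function.Injective (polynomialTensorDiff (A := A) M) := by
  rw [injective_iff_map_eq_zero]
  intro t ht
  let e := PolynomialModule.polynomialTensorProductLEquivPolynomialModule A M
  have hc (p : A[X]) (m : M) (k : ℕ) : (e (p ⊗ₜ m)).coeff k = p.coeff k • m := by
    have : e (p ⊗ₜ m) = p • PolynomialModule.single A 0 m := rfl
    rw [this, PolynomialModule.smul_single_apply]; simp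
  have h0 (s : A[X] ⊗[A] M) (k : ℕ) : (e (polynomialTensorDiff M s)).coeff (k + 1) =
      (e s).coeff k - (X : A[X]) • (e s).coeff (k + 1) := by
    induction s with
    | zero => simp
    | add x y hx hy =>
      simp only [map_add, PolynomialModule.coeff_add, Finsupp.add_apply, hx, hy, smul_add]; abel
    | tmul p m =>
      rw [polynomialTensorDiff_tmul, sub_eq_add_neg, ← tmul_neg, map_add e,
        PolynomialModule.coeff_add, Finsupp.add_apply, hc, hc, hc, hc, coeff_X_mul, smul_neg,
        ← sub_eq_add_neg, smul_comm]
  have h1 (k : ℕ) : (e t).coeff k = (X : A[X]) • (e t).coeff (k + 1) := by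
    have := h0 t k
    rw [ht, map_zero, PolynomialModule.coeff_zero, Finsupp.coe_zero, Pi.zero_apply] at this
    exact (sub_eq_zero.mp this.symm)
  have h2 (j k : ℕ) : (e t).coeff k = (X : A[X]) ^ j • (e t).coeff (k + j) := by
    induction j with
    | zero => simp
    | succ j ih => rw [ih, h1 (k + j), smul_smul, pow_succ, add_assoc]
  rw [← e.map_eq_zero_iff, ← PolynomialModule.coeff_eq_zero]
  ext k
  obtain ⟨N, hN⟩ := ((e t).coeff).support.exists_nat_subset_range
  rw [h2 N k, Finsupp.notMem_support_iff.mp, smul_zero]; rfl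
  intro h
  have := Finset.mem_range.mp (hN h)
  omega

end PolynomialDimension

/-! ### Projective and injective dimension over polynomial rings. -/

section DimensionBound

theorem shortExact_baseChange {A B M' F M : Type u} [CommRing A] [CommRing B] [Algebra A B]
    [Module.Flat A B] [AddCommGroup M'] [AddCommGroup F] [AddCommGroup M] [Module A M']
    [Module A F] [Module A M] {f : M' →ₗ[A] F} {g : F →ₗ[A] M} (hf : Function.Injective f)
    (hfg : Function.Exact f g) (hg : Function.Surjective g) :
    Function.Injective (f.baseChange B) ∧ Function.Exact (f.baseChange B) (g.baseChange B) ∧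
      Function.Surjective (g.baseChange B) :=
  ⟨Module.Flat.lTensor_preserves_injective_linearMap (M := B) f hf, lTensor_exact B hfg hg,
    LinearMap.lTensor_surjective B hg⟩

theorem hasProjectiveDimensionLE_baseChange {A B : Type u} [CommRing A] [CommRing B] [Algebra A B]
    [Module.Flat A B] (r : ℕ) (M : Type u) [AddCommGroup M] [Module A M]
    (h : HasProjectiveDimensionLE (ModuleCat.of A M) r) :
    HasProjectiveDimensionLE (ModuleCat.of B (B ⊗[A] M)) r := by
  induction r generalizing M with
  | zero =>
    rw [← projective_iff_hasProjectiveDimensionLE_zero, ← IsProjective.iff_projective] at h ⊢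
    infer_instance
  | succ r ih =>
    let g : (M →₀ A) →ₗ[A] M := Finsupp.linearCombination A id
    have hg : Function.Surjective g := Finsupp.linearCombination_id_surjective A M
    have hfg : Function.Exact (LinearMap.ker g).subtype g := LinearMap.exact_subtype_ker_map g
    have hS := ModuleCat.shortExact_of_exact (Submodule.injective_subtype _) hfg hg
    have hP : Projective (ModuleCat.of A (M →₀ A)) :=
      (IsProjective.iff_projective _).mp inferInstance
    have h1 := (hS.hasProjectiveDimensionLT_X₃_iff r hP).mp h
    have h2 := ih _ h1
    obtain ⟨h3, h4, h5⟩ := shortExact_baseChange (B := B) (Submodule.injective_subtype _) hfg hg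
    have hS' := ModuleCat.shortExact_of_exact h3 h4 h5
    have hP' : Projective (ModuleCat.of B (B ⊗[A] (M →₀ A))) :=
      (IsProjective.iff_projective _).mp inferInstance
    exact (hS'.hasProjectiveDimensionLT_X₃_iff r hP').mpr h2

/-- A ring homomorphism `f : A → B` raises projective dimensions by at most `d`. -/
def RaisesProjectiveDimensionBy {A B : Type u} [CommRing A] [CommRing B] (f : A →+* B) (d : ℕ) :
    Prop :=
  ∀ (M : ModuleCat.{u} B) (r : ℕ), HasProjectiveDimensionLE ((ModuleCat.restrictScalars f).obj M) r →
    HasProjectiveDimensionLE M (r + d)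

theorem RaisesProjectiveDimensionBy.comp {A B C : Type u} [CommRing A] [CommRing B] [CommRing C]
    {f : A →+* B} {g : B →+* C} {d d' : ℕ} (hg : RaisesProjectiveDimensionBy g d')
    (hf : RaisesProjectiveDimensionBy f d) : RaisesProjectiveDimensionBy (g.comp f) (d + d') := by
  intro M r h
  rw [← add_assoc]
  exact hg _ _ (hf _ _ h)

theorem RaisesProjectiveDimensionBy.of_equiv {A B : Type u} [CommRing A] [CommRing B] (e : A ≃+* B) :
    RaisesProjectiveDimensionBy (e : A →+* B) 0 := by
  intro M r h
  let := RingHomInvPair.of_ringEquiv e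
  let := RingHomInvPair.of_ringEquiv e.symm
  exact ModuleCat.hasProjectiveDimensionLE_of_semiLinearEquiv e
    (M := (ModuleCat.restrictScalars (e : A →+* B)).obj M) (N := M)
    { AddEquiv.refl M with map_smul' := fun _ _ => rfl } r

/-- In the characteristic sequence `0 → A[X] ⊗ M → A[X] ⊗ M → M → 0` the first two terms have
projective dimension at most that of `M` over `A`, by flat base change. -/
theorem RaisesProjectiveDimensionBy.polynomial (A : Type u) [CommRing A] :
    RaisesProjectiveDimensionBy (Polynomial.C : A →+* Polynomial A) 1 := by
  intro M r h
  let N : Type u := (ModuleCat.restrictScalars (Polynomial.C : A →+* Polynomial A)).obj M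
  let : Module (Polynomial A) N := inferInstanceAs (Module (Polynomial A) M)
  have : IsScalarTower A (Polynomial A) N := ⟨fun a p m => by
    change (a • p) • m = (Polynomial.C a) • (p • m)
    rw [← mul_smul, Polynomial.C_mul']⟩
  have h1 := hasProjectiveDimensionLE_baseChange (B := Polynomial A) r N h
  have hS := ModuleCat.shortExact_of_exact (polynomialTensorDiff_injective (A := A) (M := N))
    polynomialTensorDiff_exact polynomialTensorEval_surjective
  exact hS.hasProjectiveDimensionLT_X₃ (r + 1) h1
    (@hasProjectiveDimensionLT_of_ge _ _ _ _ (r + 1) (r + 2) (by omega) h1)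

theorem RaisesProjectiveDimensionBy.mvPolynomial (A : Type u) [CommRing A] (n : ℕ) :
    RaisesProjectiveDimensionBy (MvPolynomial.C : A →+* MvPolynomial (Fin n) A) n := by
  induction n with
  | zero =>
    have h := RaisesProjectiveDimensionBy.of_equiv (MvPolynomial.isEmptyRingEquiv A (Fin 0)).symm
    convert h using 1
    ext a : 1
    exact ((MvPolynomial.isEmptyRingEquiv A (Fin 0)).symm_apply_eq.mpr
      (by rw [MvPolynomial.isEmptyRingEquiv_eq_coeff_zero]; simp)).symm
  | succ n ih =>
    have h := ((RaisesProjectiveDimensionBy.of_equiv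
      (MvPolynomial.finSuccEquiv A n).toRingEquiv.symm).comp
      ((RaisesProjectiveDimensionBy.polynomial (MvPolynomial (Fin n) A)).comp ih))
    convert h using 1
    ext a : 1
    exact (RingHom.congr_fun (MvPolynomial.finSuccEquiv_comp_C_eq_C n) a).symm

theorem hasProjectiveDimensionLE_mvPolynomial {A : Type u} [CommRing A] {n : ℕ} (M : Type u)
    [AddCommGroup M] [Module A M] [Module (MvPolynomial (Fin n) A) M]
    [IsScalarTower A (MvPolynomial (Fin n) A) M] [Module.Projective A M] :
    HasProjectiveDimensionLE (ModuleCat.of (MvPolynomial (Fin n) A) M) n := by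
  have h : HasProjectiveDimensionLE ((ModuleCat.restrictScalars MvPolynomial.C).obj
      (ModuleCat.of (MvPolynomial (Fin n) A) M)) 0 := by
    have h0 : HasProjectiveDimensionLE (ModuleCat.of A M) 0 := by
      rw [← projective_iff_hasProjectiveDimensionLE_zero, ← IsProjective.iff_projective]
      infer_instance
    refine ModuleCat.hasProjectiveDimensionLE_of_linearEquiv (M := ModuleCat.of A M)
      { AddEquiv.refl M with map_smul' := fun a m => ?_ } 0
    exact (algebraMap_smul (MvPolynomial (Fin n) A) a (m : M)).symm
  simpa using RaisesProjectiveDimensionBy.mvPolynomial A n _ 0 h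

/-- Hilbert's syzygy theorem: every module is projective over the field, so all projective
dimensions over the polynomial ring are at most `n` and `Ext^{n+1}` vanishes identically. -/
theorem hasInjectiveDimensionLE_mvPolynomial {k : Type u} [Field k] {n : ℕ} (N : Type u)
    [AddCommGroup N] [Module (MvPolynomial (Fin n) k) N] :
    HasInjectiveDimensionLE (ModuleCat.of (MvPolynomial (Fin n) k) N) n := by
  refine hasInjectiveDimensionLT_of_enoughProjectives _ _ fun Y => ?_
  let : Module k Y := Module.compHom Y (MvPolynomial.C : k →+* MvPolynomial (Fin n) k)
  have : IsScalarTower k (MvPolynomial (Fin n) k) Y := ⟨fun a p m => by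
    change (a • p) • m = (MvPolynomial.C a : MvPolynomial (Fin n) k) • (p • m)
    rw [← mul_smul, MvPolynomial.C_mul']⟩
  have := hasProjectiveDimensionLE_mvPolynomial (A := k) (n := n) Y
  exact HasProjectiveDimensionLT.subsingleton (ModuleCat.of (MvPolynomial (Fin n) k) Y) (n + 1) _
    le_rfl _

end DimensionBound

/-! ### Maximal ideals of polynomial rings are generated by regular sequences. -/

section MaximalIdealGenerators

open RingTheory.Sequence

/-- The Jacobson property makes `q = m ∩ U` maximal, so modulo `q` the ideal `m` is principal in the
principal ideal domain `(U/q)[X]`. Its generator is nonzero because a polynomial ring is not a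
field, hence it is a nonzerodivisor. -/
theorem exists_isWeaklyRegular_polynomial {U : Type u} [CommRing U] [IsJacobsonRing U]
    (m : Ideal (Polynomial U)) [m.IsMaximal] (rs : List U) (hrs : IsWeaklyRegular U rs)
    (hq : Ideal.ofList rs = m.comap Polynomial.C) :
    ∃ f, IsWeaklyRegular (Polynomial U) (rs.map Polynomial.C ++ [f]) ∧
      Ideal.ofList (rs.map Polynomial.C ++ [f]) = m := by
  set q := m.comap (Polynomial.C : U →+* Polynomial U) with hqdef
  have hqmax : q.IsMaximal := Polynomial.isMaximal_comap_C_of_isJacobsonRing m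
  let := Ideal.Quotient.field q
  let e := Ideal.polynomialQuotientEquivQuotientPolynomial q
  have hdom : IsDomain (Polynomial U ⧸ Ideal.map (Polynomial.C : U →+* Polynomial U) q) :=
    e.symm.toMulEquiv.isDomain _
  have hle : Ideal.map (Polynomial.C : U →+* Polynomial U) q ≤ m := Ideal.map_comap_le
  let J : Ideal (Polynomial U ⧸ Ideal.map (Polynomial.C : U →+* Polynomial U) q) :=
    m.map (Ideal.Quotient.mk _)
  have hJ : Submodule.IsPrincipal (J.map e.symm) := IsPrincipalIdealRing.principal _
  obtain ⟨g, hg⟩ := hJ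
  obtain ⟨f, hf⟩ := Ideal.Quotient.mk_surjective (e g)
  have hJf : J = Ideal.span {Ideal.Quotient.mk _ f} := by
    have h1 : (J.map e.symm).map e = J := Ideal.map_of_equiv e.symm
    rw [← h1, hg, hf]
    exact (Ideal.map_span _ _).trans (by rw [Set.image_singleton])
  have hm : Ideal.map (Polynomial.C : U →+* Polynomial U) q ⊔ Ideal.span {f} = m := by
    have h1 : J.comap (Ideal.Quotient.mk _) = m := by
      rw [Ideal.comap_map_of_surjective _ Ideal.Quotient.mk_surjective, ← RingHom.ker_eq_comap_bot,
        Ideal.mk_ker, sup_eq_left.mpr hle]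
    have h2 : Ideal.span {Ideal.Quotient.mk (Ideal.map (Polynomial.C : U →+* Polynomial U) q) f} =
      (Ideal.span {f}).map (Ideal.Quotient.mk _) := by rw [Ideal.map_span, Set.image_singleton]
    rw [hJf, h2, Ideal.comap_map_of_surjective _ Ideal.Quotient.mk_surjective,
      ← RingHom.ker_eq_comap_bot, Ideal.mk_ker, sup_comm] at h1
    exact h1
  have hmap : Ideal.ofList (rs.map (Polynomial.C : U →+* Polynomial U)) = q.map Polynomial.C := by
    rw [← Ideal.map_ofList, hq]
  refine ⟨f, ?_, by rw [Ideal.ofList_append, hmap, Ideal.ofList_singleton, hm]⟩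
  rw [isWeaklyRegular_append_iff]
  refine ⟨hrs.of_flat (S := Polynomial U), ?_⟩
  rw [isWeaklyRegular_singleton_iff, hmap, smul_eq_mul, Ideal.mul_top]
  have hf0 : Ideal.Quotient.mk (Ideal.map (Polynomial.C : U →+* Polynomial U) q) f ≠ 0 := by
    intro h0
    have h3 : m = Ideal.map (Polynomial.C : U →+* Polynomial U) q := by
      rw [← hm, sup_eq_left, Ideal.span_singleton_le_iff_mem]
      exact Ideal.Quotient.eq_zero_iff_mem.mp h0
    have h4 : IsField (Polynomial U ⧸ Ideal.map (Polynomial.C : U →+* Polynomial U) q) :=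
      (Ideal.Quotient.maximal_ideal_iff_isField_quotient _).mp (h3 ▸ inferInstance)
    exact Polynomial.not_isField (U ⧸ q) (e.toMulEquiv.isField h4)
  intro x y hxy
  have hxy' : (Ideal.Quotient.mk (Ideal.map (Polynomial.C : U →+* Polynomial U) q) f) * x =
    (Ideal.Quotient.mk (Ideal.map (Polynomial.C : U →+* Polynomial U) q) f) * y := hxy
  exact mul_left_cancel₀ hf0 hxy'

theorem exists_isWeaklyRegular_of_ringEquiv {B C : Type u} [CommRing B] [CommRing C] (e : B ≃+* C)
    (rs : List B) (hrs : IsWeaklyRegular B rs) : IsWeaklyRegular C (rs.map e) := by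
  refine (AddEquiv.isWeaklyRegular_congr (e := e.toAddEquiv) ?_).mp hrs
  rw [List.forall₂_map_right_iff]
  exact List.forall₂_same.mpr fun r _ x => map_mul e r x

theorem exists_isWeaklyRegular_mvPolynomial {k : Type u} [Field k] (n : ℕ)
    (m : Ideal (MvPolynomial (Fin n) k)) [m.IsMaximal] :
    ∃ rs : List (MvPolynomial (Fin n) k), rs.length = n ∧
      IsWeaklyRegular (MvPolynomial (Fin n) k) rs ∧ Ideal.ofList rs = m := by
  induction n with
  | zero =>
    refine ⟨[], rfl, IsWeaklyRegular.nil _ _, ?_⟩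
    have hF : IsField (MvPolynomial (Fin 0) k) :=
      (MvPolynomial.isEmptyRingEquiv k (Fin 0)).toMulEquiv.isField (Field.toIsField k)
    let := hF.toField
    rw [Ideal.ofList_nil]
    exact ((Ideal.eq_bot_or_top m).resolve_right (Ideal.IsMaximal.ne_top ‹_›)).symm
  | succ n ih =>
    let e := (MvPolynomial.finSuccEquiv k n).toRingEquiv.symm
    have hmax : (m.comap e).IsMaximal := Ideal.comap_isMaximal_of_equiv e
    have hmax' : ((m.comap e).comap Polynomial.C).IsMaximal :=
      Polynomial.isMaximal_comap_C_of_isJacobsonRing _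
    obtain ⟨rs, hlen, hrs, hq⟩ := ih ((m.comap e).comap Polynomial.C)
    obtain ⟨f, hf, hm⟩ := exists_isWeaklyRegular_polynomial (m.comap e) rs hrs hq
    refine ⟨(rs.map Polynomial.C ++ [f]).map e, by simp [hlen],
      exists_isWeaklyRegular_of_ringEquiv e _ hf, ?_⟩
    have h := Ideal.map_ofList (e : Polynomial (MvPolynomial (Fin n) k) →+* MvPolynomial (Fin (n + 1)) k)
      (rs.map Polynomial.C ++ [f])
    rw [hm] at h
    exact h.symm.trans (Ideal.map_comap_of_surjective _ e.surjective m)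

theorem hasInjectiveDimensionLE_localization {T : Type u} [CommRing T] [IsNoetherianRing T]
    (W : Submonoid T) {n : ℕ} (h : HasInjectiveDimensionLE (ModuleCat.of T T) n) :
    HasInjectiveDimensionLE (ModuleCat.of (Localization W) (Localization W)) n := by
  have h1 := ModuleCat.localizedModule_hasInjectiveDimensionLE n W (ModuleCat.of T T)
  have := ModuleCat.localizedModule_isLocalizedModule (ModuleCat.of T T) W
  let e := (IsLocalizedModule.linearEquiv W ((ModuleCat.of T T).localizedModuleMkLinearMap W)
    (Algebra.linearMap T (Localization W))).extendScalarsOfIsLocalization W (Localization W)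
  exact (ModuleCat.hasInjectiveDimensionLE_iff_of_linearEquiv
    (M := (ModuleCat.of T T).localizedModule W)
    (N := ModuleCat.of (Localization W) (Localization W)) e n).mp h1

end MaximalIdealGenerators

/-! ### Finite resolutions by finite projective modules. -/

section ChainExistence

variable {S : Type u} [CommRing S]

/-- A projective module is covered by itself. This convention makes the iterated resolution stop
once a syzygy is projective. -/
theorem exists_finite_projective_cover (M : Type u) [AddCommGroup M] [Module S M]
    [Module.Finite S M] : ∃ F : ModuleCat.{u} S, Module.Projective S F ∧ Module.Finite S F ∧
      ∃ π : F →ₗ[S] M, Function.Surjective π ∧ (Module.Projective S M → Function.Injective π) := by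
  by_cases h : Module.Projective S M
  · exact ⟨ModuleCat.of S M, h, ‹_›, LinearMap.id, Function.surjective_id,
      fun _ => Function.injective_id⟩
  · obtain ⟨k, π, hπ⟩ := Module.Finite.exists_fin' S M
    exact ⟨ModuleCat.of S (Fin k → S), inferInstanceAs (Module.Projective S (Fin k → S)),
      inferInstanceAs (Module.Finite S (Fin k → S)), π, hπ, fun h' => absurd h' h⟩

/-- A module of finite projective dimension over a Noetherian ring has a bounded resolution by
finitely generated projective modules. -/
theorem exists_isSyzygyChain [IsNoetherianRing S] (X : Type u) [AddCommGroup X] [Module S X]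
    [Module.Finite S X] {n : ℕ} (hX : HasProjectiveDimensionLE (ModuleCat.of S X) n) :
    ∃ (M F : ℕ → ModuleCat.{u} S) (ι : ∀ i, M (i + 1) →ₗ[S] F i) (π : ∀ i, F i →ₗ[S] M i),
      M 0 = ModuleCat.of S X ∧ IsSyzygyChain (M := fun i => M i) (F := fun i => F i) ι π ∧
      (∀ i, Module.Projective S (F i)) ∧ (∀ i, Module.Finite S (F i)) ∧
      ∀ i, n < i → Subsingleton (F i) := by
  choose cov hproj hfin π hsurj hinj using
    fun M : {M : ModuleCat.{u} S // Module.Finite S M} =>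
      have := M.2
      exists_finite_projective_cover (S := S) M.1
  let next (M : {M : ModuleCat.{u} S // Module.Finite S M}) :
      {M : ModuleCat.{u} S // Module.Finite S M} :=
    ⟨ModuleCat.of S (LinearMap.ker (π M)), by
      have := hfin M
      exact inferInstanceAs (Module.Finite S (LinearMap.ker (π M)))⟩
  let seq : ℕ → {M : ModuleCat.{u} S // Module.Finite S M} :=
    fun i => Nat.rec ⟨ModuleCat.of S X, ‹_›⟩ (fun _ M => next M) i
  have hchain : IsSyzygyChain (M := fun i => (seq i).1) (F := fun i => cov (seq i))
      (fun i => (LinearMap.ker (π (seq i))).subtype) (fun i => π (seq i)) :=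
    ⟨fun i => Submodule.injective_subtype _, fun i => LinearMap.exact_subtype_ker_map _,
      fun i => hsurj _⟩
  refine ⟨fun i => (seq i).1, fun i => cov (seq i), fun i => (LinearMap.ker (π (seq i))).subtype,
    fun i => π (seq i), rfl, hchain, fun i => hproj _, fun i => hfin _, ?_⟩
  -- Each syzygy lowers the bound by one, so the `n`-th is projective; it is then its own cover and
  -- all later syzygies and covers vanish.
  have hpd (i : ℕ) : ∀ j, i + j = n → HasProjectiveDimensionLE (seq i).1 j := by
    induction i with
    | zero => rintro j hj; obtain rfl : j = n := by omega
              exact hX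
    | succ i ih =>
      intro j hj
      have h1 := ih (j + 1) (by omega)
      have hS := ModuleCat.shortExact_of_exact (hchain.inj i) (hchain.exact i) (hchain.surj i)
      exact (hS.hasProjectiveDimensionLT_X₃_iff j
        ((IsProjective.iff_projective _).mp (hproj (seq i)))).mp h1
  have hpn : Module.Projective S (seq n).1 := by
    have := hpd n 0 rfl
    rw [← projective_iff_hasProjectiveDimensionLE_zero] at this
    exact (IsProjective.iff_projective _).mpr this
  have hsub (i : ℕ) (h : Module.Projective S (seq i).1) : Subsingleton (seq (i + 1)).1 := by
    change Subsingleton (LinearMap.ker (π (seq i)))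
    rw [LinearMap.ker_eq_bot.mpr (hinj _ h)]
    infer_instance
  have hall (i : ℕ) (hi : n < i) : Subsingleton (seq i).1 := by
    induction i, hi using Nat.le_induction with
    | base => exact hsub n hpn
    | succ i hi ih => exact hsub i inferInstance
  intro i hi
  have h1 := hall i hi
  exact (hinj (seq i) inferInstance).subsingleton

end ChainExistence

/-! ### Flatness in short exact sequences. -/

section FlatExact

variable {A M' F M : Type*} [CommRing A] [AddCommGroup M'] [AddCommGroup F] [AddCommGroup M]
  [Module A M'] [Module A F] [Module A M] {f : M' →ₗ[A] F} {g : F →ₗ[A] M}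

theorem LinearMap.rTensor_lTensor_comm {X' X Y' Y : Type*} [AddCommGroup X'] [AddCommGroup X]
    [AddCommGroup Y'] [AddCommGroup Y] [Module A X'] [Module A X] [Module A Y'] [Module A Y]
    (u : X' →ₗ[A] X) (v : Y' →ₗ[A] Y) (t : X' ⊗[A] Y') :
    u.rTensor Y (v.lTensor X' t) = v.lTensor X (u.rTensor Y' t) := by
  have h := LinearMap.rTensor_comp_lTensor X' u v
  rw [← LinearMap.lTensor_comp_rTensor] at h
  exact LinearMap.congr_fun h t

/-- The kernel of a surjection between flat modules is flat. -/
theorem Module.Flat.of_exact_left (hf : Function.Injective f) (hfg : Function.Exact f g)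
    (hg : Function.Surjective g) (_ : Module.Flat A F) (_ : Module.Flat A M) :
    Module.Flat A M' := by
  rw [Module.Flat.iff_rTensor_injective']
  intro I
  have h1 := LinearMap.lTensor_injective_of_exact_of_flat g hg f hf hfg I
  have h2 := Module.Flat.rTensor_preserves_injective_linearMap (M := F) I.subtype
    (Submodule.injective_subtype I)
  intro x y hxy
  apply h1
  apply h2
  rw [LinearMap.rTensor_lTensor_comm, LinearMap.rTensor_lTensor_comm, hxy]

/-- An extension of flat modules is flat. -/
theorem Module.Flat.of_exact_middle (hf : Function.Injective f) (hfg : Function.Exact f g)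
    (hg : Function.Surjective g) (_ : Module.Flat A M') (_ : Module.Flat A M) :
    Module.Flat A F := by
  rw [Module.Flat.iff_rTensor_injective']
  intro I
  have h1 := LinearMap.lTensor_injective_of_exact_of_flat g hg f hf hfg A
  have h2 := Module.Flat.rTensor_preserves_injective_linearMap (M := M) I.subtype
    (Submodule.injective_subtype I)
  have h3 := Module.Flat.rTensor_preserves_injective_linearMap (M := M') I.subtype
    (Submodule.injective_subtype I)
  rw [injective_iff_map_eq_zero]
  intro x hx
  have h4 : g.lTensor I x = 0 := h2 (by
    rw [LinearMap.rTensor_lTensor_comm, hx, map_zero, map_zero])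
  obtain ⟨y, rfl⟩ := (_root_.lTensor_exact I hfg hg x).mp h4
  rw [LinearMap.rTensor_lTensor_comm] at hx
  rw [h3 (h1 (hx.trans (map_zero _).symm) |>.trans (map_zero _).symm), map_zero]

/-- The cokernel of a universally injective map into a flat module is flat. -/
theorem Module.Flat.of_exact_right {f : M' →ₗ[A] F} {g : F →ₗ[A] M}
    (hf : ∀ I : Ideal A, Function.Injective (f.lTensor (A ⧸ I))) (hfg : Function.Exact f g)
    (hg : Function.Surjective g) (_ : Module.Flat A F) : Module.Flat A M := by
  rw [Module.Flat.iff_rTensor_injective']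
  intro I
  have hF := Module.Flat.rTensor_preserves_injective_linearMap (M := F) I.subtype
    (Submodule.injective_subtype I)
  have hI : Function.Exact I.subtype I.mkQ := LinearMap.exact_subtype_mkQ I
  rw [injective_iff_map_eq_zero]
  intro y hy
  obtain ⟨y', rfl⟩ := LinearMap.lTensor_surjective I hg y
  rw [LinearMap.rTensor_lTensor_comm] at hy
  obtain ⟨c, hc⟩ := (_root_.lTensor_exact A hfg hg _).mp hy
  -- The image of `c` comes from `I ⊗ F`, so it vanishes in `(A/I) ⊗ F`; universal injectivity
  -- forces `c` itself to come from `I ⊗ M'`.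
  have h1 : I.mkQ.rTensor M' c = 0 := hf I (by
    rw [map_zero, ← LinearMap.rTensor_lTensor_comm, hc,
      (_root_.rTensor_exact F hI (Submodule.mkQ_surjective I)).apply_apply_eq_zero])
  obtain ⟨c', rfl⟩ := (_root_.rTensor_exact M' hI (Submodule.mkQ_surjective I) c).mp h1
  rw [← LinearMap.rTensor_lTensor_comm] at hc
  rw [← hF hc, (_root_.lTensor_exact I hfg hg).apply_apply_eq_zero]

end FlatExact

/-! ### `S`-modules flat over `A`, and base changes exact on them. -/

section FlatOver

variable (A S : Type u) [CommRing A] [CommRing S] [Algebra A S]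

/-- An `S`-module that is flat over the base ring `A` of `S`. -/
def FlatOver (X : Type u) [AddCommGroup X] [Module S X] : Prop :=
  Module.Flat A (RestrictScalars A S X)

variable {A S} {X Y Z : Type u} [AddCommGroup X] [AddCommGroup Y] [AddCommGroup Z] [Module S X]
  [Module S Y] [Module S Z] {f : X →ₗ[S] Y} {g : Y →ₗ[S] Z}

theorem flatOver_iff [Module A X] [IsScalarTower A S X] : FlatOver A S X ↔ Module.Flat A X :=
  Module.Flat.equiv_iff
    { RestrictScalars.addEquiv A S X with
      map_smul' := fun a x => (algebraMap_smul S a (RestrictScalars.addEquiv A S X x)) }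

theorem FlatOver.congr (e : X ≃ₗ[S] Y) (h : FlatOver A S X) : FlatOver A S Y := by
  let : Module A X := Module.compHom X (algebraMap A S)
  have : IsScalarTower A S X := .of_algebraMap_smul fun _ _ => rfl
  let : Module A Y := Module.compHom Y (algebraMap A S)
  have : IsScalarTower A S Y := .of_algebraMap_smul fun _ _ => rfl
  rw [flatOver_iff] at h ⊢
  exact Module.Flat.of_linearEquiv (e.symm.restrictScalars A)

theorem FlatOver.of_subsingleton [Subsingleton X] : FlatOver A S X := by
  let : Module A X := Module.compHom X (algebraMap A S)
  have : IsScalarTower A S X := .of_algebraMap_smul fun _ _ => rfl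
  rw [flatOver_iff]
  infer_instance

theorem FlatOver.of_projective [Module.Flat A S] [Module.Projective S X] : FlatOver A S X := by
  let : Module A X := Module.compHom X (algebraMap A S)
  have : IsScalarTower A S X := .of_algebraMap_smul fun _ _ => rfl
  rw [flatOver_iff]
  exact Module.Flat.trans A S X

theorem FlatOver.of_exact_left (hf : Function.Injective f) (hfg : Function.Exact f g)
    (hg : Function.Surjective g) (hY : FlatOver A S Y) (hZ : FlatOver A S Z) :
    FlatOver A S X := by
  let : Module A X := Module.compHom X (algebraMap A S)
  have : IsScalarTower A S X := .of_algebraMap_smul fun _ _ => rfl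
  let : Module A Y := Module.compHom Y (algebraMap A S)
  have : IsScalarTower A S Y := .of_algebraMap_smul fun _ _ => rfl
  let : Module A Z := Module.compHom Z (algebraMap A S)
  have : IsScalarTower A S Z := .of_algebraMap_smul fun _ _ => rfl
  rw [flatOver_iff] at hY hZ ⊢
  exact Module.Flat.of_exact_left (f := f.restrictScalars A) (g := g.restrictScalars A) hf hfg hg
    hY hZ

theorem FlatOver.of_exact_middle (hf : Function.Injective f) (hfg : Function.Exact f g)
    (hg : Function.Surjective g) (hX : FlatOver A S X) (hZ : FlatOver A S Z) :
    FlatOver A S Y := by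
  let : Module A X := Module.compHom X (algebraMap A S)
  have : IsScalarTower A S X := .of_algebraMap_smul fun _ _ => rfl
  let : Module A Y := Module.compHom Y (algebraMap A S)
  have : IsScalarTower A S Y := .of_algebraMap_smul fun _ _ => rfl
  let : Module A Z := Module.compHom Z (algebraMap A S)
  have : IsScalarTower A S Z := .of_algebraMap_smul fun _ _ => rfl
  rw [flatOver_iff] at hX hZ ⊢
  exact Module.Flat.of_exact_middle (f := f.restrictScalars A) (g := g.restrictScalars A) hf hfg hg
    hX hZ

variable (A) in
/-- Base change from `S` to `S'` preserves injections with `A`-flat cokernel. -/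
def IsFlatExactBaseChange (S S' : Type u) [CommRing S] [Algebra A S] [CommRing S'] [Algebra S S'] :
    Prop :=
  ∀ ⦃X Y Z : Type u⦄ [AddCommGroup X] [AddCommGroup Y] [AddCommGroup Z] [Module S X] [Module S Y]
    [Module S Z] (f : X →ₗ[S] Y) (g : Y →ₗ[S] Z), Function.Injective f → Function.Exact f g →
    Function.Surjective g → FlatOver A S Z → Function.Injective (f.baseChange S')

theorem cancelBaseChange_symm_lTensor {κ S' : Type u} [CommRing κ] [CommRing S'] [Algebra A κ]
    [Algebra A S'] [Algebra S S'] [Algebra κ S'] [IsScalarTower A S S'] [IsScalarTower A κ S']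
    [Algebra.IsPushout A κ S S'] [Module A X] [IsScalarTower A S X] [Module A Y]
    [IsScalarTower A S Y] (f : X →ₗ[S] Y) (t : κ ⊗[A] X) :
    (Algebra.IsPushout.cancelBaseChange A κ S S' Y).symm ((f.restrictScalars A).lTensor κ t) =
      f.baseChange S' ((Algebra.IsPushout.cancelBaseChange A κ S S' X).symm t) := by
  induction t with
  | zero => simp
  | add x y hx hy => simp only [map_add, hx, hy]
  | tmul k x => simp

theorem injective_baseChange_iff {κ S' : Type u} [CommRing κ] [CommRing S'] [Algebra A κ]
    [Algebra A S'] [Algebra S S'] [Algebra κ S'] [IsScalarTower A S S'] [IsScalarTower A κ S']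
    [Algebra.IsPushout A κ S S'] [Module A X] [IsScalarTower A S X] [Module A Y]
    [IsScalarTower A S Y] (f : X →ₗ[S] Y) :
    Function.Injective (f.baseChange S') ↔ Function.Injective ((f.restrictScalars A).lTensor κ) := by
  have h : (Algebra.IsPushout.cancelBaseChange A κ S S' Y).symm ∘ (f.restrictScalars A).lTensor κ =
      f.baseChange S' ∘ (Algebra.IsPushout.cancelBaseChange A κ S S' X).symm :=
    funext fun t => cancelBaseChange_symm_lTensor f t
  rw [← (Algebra.IsPushout.cancelBaseChange A κ S S' Y).symm.injective.of_comp_iff, h,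
    Function.Injective.of_comp_iff' _ (Algebra.IsPushout.cancelBaseChange A κ S S' X).symm.bijective]

variable (A S) in
-- For `S' = κ ⊗_A S` one has `S' ⊗_S X = κ ⊗_A X`, so the only obstruction is `Tor₁^A(κ, Z)`, which
-- vanishes for `A`-flat `Z`.
theorem IsFlatExactBaseChange.of_isPushout (κ S' : Type u) [CommRing κ] [CommRing S'] [Algebra A κ]
    [Algebra A S'] [Algebra S S'] [Algebra κ S'] [IsScalarTower A S S'] [IsScalarTower A κ S']
    [Algebra.IsPushout A κ S S'] : IsFlatExactBaseChange A S S' := by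
  intro X Y Z _ _ _ _ _ _ f g hf hfg hg hZ
  let : Module A X := Module.compHom X (algebraMap A S)
  have : IsScalarTower A S X := .of_algebraMap_smul fun _ _ => rfl
  let : Module A Y := Module.compHom Y (algebraMap A S)
  have : IsScalarTower A S Y := .of_algebraMap_smul fun _ _ => rfl
  let : Module A Z := Module.compHom Z (algebraMap A S)
  have : IsScalarTower A S Z := .of_algebraMap_smul fun _ _ => rfl
  have := flatOver_iff.mp hZ
  rw [injective_baseChange_iff (A := A) (κ := κ)]
  exact LinearMap.lTensor_injective_of_exact_of_flat (g.restrictScalars A) hg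
    (f.restrictScalars A) hf hfg κ

theorem cancelBaseChange_baseChange {T T' : Type u} [CommRing T] [CommRing T'] [Algebra S T]
    [Algebra S T'] [Algebra T T'] [IsScalarTower S T T'] (f : X →ₗ[S] Y)
    (t : T' ⊗[T] (T ⊗[S] X)) :
    TensorProduct.AlgebraTensorModule.cancelBaseChange S T T' T' Y
        ((f.baseChange T).baseChange T' t) =
      f.baseChange T' (TensorProduct.AlgebraTensorModule.cancelBaseChange S T T' T' X t) := by
  induction t with
  | zero => simp
  | add x y hx hy => simp only [map_add, hx, hy]
  | tmul a x =>
    induction x with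
    | zero => simp
    | add x y hx hy => simp only [tmul_add, map_add, hx, hy]
    | tmul b x => simp

/-- Used to pass from a fiber ring to its localizations. -/
theorem IsFlatExactBaseChange.trans_flat {T T' : Type u} [CommRing T] [CommRing T'] [Algebra S T]
    [Algebra S T'] [Algebra T T'] [IsScalarTower S T T'] [Module.Flat T T']
    (h : IsFlatExactBaseChange A S T) : IsFlatExactBaseChange A S T' := by
  intro X Y Z _ _ _ _ _ _ f g hf hfg hg hZ
  have h1 := Module.Flat.lTensor_preserves_injective_linearMap (M := T') (f.baseChange T)
    (h f g hf hfg hg hZ)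
  have h2 : f.baseChange T' ∘ (TensorProduct.AlgebraTensorModule.cancelBaseChange S T T' T' X) =
      (TensorProduct.AlgebraTensorModule.cancelBaseChange S T T' T' Y) ∘
        ((f.baseChange T).baseChange T') :=
    funext fun t => (cancelBaseChange_baseChange f t).symm
  rw [← Function.Injective.of_comp_iff' _
    (TensorProduct.AlgebraTensorModule.cancelBaseChange S T T' T' X).bijective, h2]
  exact (LinearEquiv.injective _).comp h1

end FlatOver

/-! ### Invariance of cohomology under isomorphism. -/

section CohomologyIso

variable {R : Type*} [CommRing R] {K K' : ℕ → Type*} [∀ i, AddCommGroup (K i)]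
  [∀ i, Module R (K i)] [∀ i, AddCommGroup (K' i)] [∀ i, Module R (K' i)]
  {d : ∀ i, K i →ₗ[R] K (i + 1)} {d' : ∀ i, K' i →ₗ[R] K' (i + 1)}

/-- Isomorphic sequences have isomorphic cohomology. -/
theorem cohomology_equiv (e : ∀ i, K i ≃ₗ[R] K' i) (he : ∀ i x, e (i + 1) (d i x) = d' i (e i x))
    (i : ℕ) : Nonempty (cohomology d i ≃ₗ[R] cohomology d' i) := by
  have h1 : ∀ x, x ∈ LinearMap.ker (d i) ↔ e i x ∈ LinearMap.ker (d' i) := fun x => by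
    rw [LinearMap.mem_ker, LinearMap.mem_ker, ← he, LinearEquiv.map_eq_zero_iff]
  have h2 : (coboundaries d i).map (e i).toLinearMap = coboundaries d' i := by
    cases i with
    | zero => exact Submodule.map_bot _
    | succ i =>
      ext y
      constructor
      · rintro ⟨_, ⟨x, rfl⟩, rfl⟩
        exact ⟨e i x, (he i x).symm⟩
      · rintro ⟨y, rfl⟩
        obtain ⟨x, rfl⟩ := (e i).surjective y
        exact ⟨_, ⟨x, rfl⟩, he i x⟩
  let φ := (e i).ofSubmodules (LinearMap.ker (d i)) (LinearMap.ker (d' i)) (by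
    ext y
    obtain ⟨x, rfl⟩ := (e i).surjective y
    rw [← h1]
    exact ⟨fun ⟨z, hz, hz'⟩ => (e i).injective hz' ▸ hz, fun h => ⟨x, h, rfl⟩⟩)
  refine ⟨Submodule.Quotient.equiv _ _ φ ?_⟩
  ext y
  simp only [Submodule.mem_map, Submodule.submoduleOf, Submodule.mem_comap, ← h2]
  constructor
  · rintro ⟨x, hx, rfl⟩
    exact ⟨_, hx, rfl⟩
  · rintro ⟨x, hx, hxy⟩
    refine ⟨φ.symm y, ?_, by simp⟩
    have : (φ.symm y : K i) = x := (e i).injective (by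
      rw [show e i (φ.symm y : K i) = φ (φ.symm y) from rfl, LinearEquiv.apply_symm_apply]
      exact hxy.symm)
    change (φ.symm y : K i) ∈ _
    rwa [this]

end CohomologyIso

/-! ### Duals of finite projective modules commute with base change. -/

section DualBaseChange

variable {S : Type u} [CommRing S] (S' : Type u) [CommRing S'] [Algebra S S'] {F G : Type u}
  [AddCommGroup F] [AddCommGroup G] [Module S F] [Module S G]

/-- The comparison map between the base change of the dual and the dual of the base change. -/
def dualBaseChangeHom (F : Type u) [AddCommGroup F] [Module S F] :
    S' ⊗[S] Module.Dual S F →ₗ[S'] Module.Dual S' (S' ⊗[S] F) :=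
  (Module.Dual.baseChange (R := S) (V := F) S').liftBaseChange S'

@[simp] theorem dualBaseChangeHom_tmul (a b : S') (φ : Module.Dual S F) (x : F) :
    dualBaseChangeHom S' F (a ⊗ₜ φ) (b ⊗ₜ x) = a * (φ x • b) := rfl

theorem dualBaseChangeHom_lcomp (f : F →ₗ[S] G) (t : S' ⊗[S] Module.Dual S G) :
    dualBaseChangeHom S' F ((f.lcomp S S).baseChange S' t) =
      (f.baseChange S').lcomp S' S' (dualBaseChangeHom S' G t) := by
  induction t with
  | zero => simp
  | add x y hx hy => simp only [map_add, hx, hy]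
  | tmul a φ =>
    ext x
    simp

theorem dualBaseChangeHom_bijective_of_free (F : Type u) [AddCommGroup F] [Module S F]
    [Module.Free S F] [Module.Finite S F] :
    Function.Bijective (dualBaseChangeHom (S := S) S' F) := by
  have ibc := TensorProduct.isBaseChange S F S'
  have h : dualBaseChangeHom (S := S) S' F = ibc.dual.equiv.toLinearMap := by
    ext φ x
    simp only [AlgebraTensorModule.curry_apply, TensorProduct.curry_apply,
      LinearMap.coe_restrictScalars, dualBaseChangeHom_tmul, LinearEquiv.coe_coe,
      IsBaseChange.equiv_tmul, one_smul, one_mul]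
    exact ((ibc.toDual_comp_apply φ x).trans (Algebra.algebraMap_eq_smul_one _)).symm
  rw [h]
  exact ibc.dual.equiv.bijective

/-- The comparison map is natural and `F` is a retract of a finite free module, so bijectivity is
inherited from the free case. -/
theorem dualBaseChangeHom_bijective (F : Type u) [AddCommGroup F] [Module S F]
    [Module.Projective S F] [Module.Finite S F] :
    Function.Bijective (dualBaseChangeHom (S := S) S' F) := by
  obtain ⟨k, r, hr⟩ := Module.Finite.exists_fin' S F
  obtain ⟨i, hi⟩ := Module.projective_lifting_property r LinearMap.id hr
  have h := dualBaseChangeHom_bijective_of_free (S := S) S' (Fin k → S)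
  have hi1 (t : S' ⊗[S] Module.Dual S F) :
      (i.lcomp S S).baseChange S' ((r.lcomp S S).baseChange S' t) = t := by
    induction t with
    | zero => simp
    | add x y hx hy => simp only [map_add, hx, hy]
    | tmul a φ =>
      have : φ ∘ₗ r ∘ₗ i = φ := by rw [hi]; rfl
      exact congrArg (fun ψ => a ⊗ₜ[S] ψ) this
  have hi2 (ψ : Module.Dual S' (S' ⊗[S] F)) :
      (i.baseChange S').lcomp S' S' ((r.baseChange S').lcomp S' S' ψ) = ψ := by
    have : r.baseChange S' ∘ₗ i.baseChange S' = LinearMap.id := by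
      rw [← LinearMap.baseChange_comp, hi, LinearMap.baseChange_id]
    exact (congrArg (fun q => ψ ∘ₗ q) this)
  constructor
  · rw [injective_iff_map_eq_zero]
    intro t ht
    rw [← hi1 t]
    have : (r.lcomp S S).baseChange S' t = 0 := h.1 (by
      rw [dualBaseChangeHom_lcomp, ht, map_zero, map_zero])
    rw [this, map_zero]
  · intro ψ
    obtain ⟨t, ht⟩ := h.2 ((r.baseChange S').lcomp S' S' ψ)
    exact ⟨(i.lcomp S S).baseChange S' t, by rw [dualBaseChangeHom_lcomp, ht, hi2]⟩

end DualBaseChange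

/-! ### Base change of resolutions with `A`-flat syzygies. -/

section ChainBaseChange

variable {A S : Type u} [CommRing A] [CommRing S] [Algebra A S]
  {M F : ℕ → Type u} [∀ i, AddCommGroup (M i)]
  [∀ i, Module S (M i)] [∀ i, AddCommGroup (F i)] [∀ i, Module S (F i)]
  {ι : ∀ i, M (i + 1) →ₗ[S] F i} {π : ∀ i, F i →ₗ[S] M i}

theorem IsSyzygyChain.flatOver [Module.Flat A S] (h : IsSyzygyChain ι π)
    (hF : ∀ i, Module.Projective S (F i)) (h0 : FlatOver A S (M 0)) (i : ℕ) :
    FlatOver A S (M i) := by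
  induction i with
  | zero => exact h0
  | succ i ih =>
    exact FlatOver.of_exact_left (h.inj i) (h.exact i) (h.surj i)
      (have := hF i; FlatOver.of_projective) ih

theorem IsSyzygyChain.baseChange (h : IsSyzygyChain ι π) (hM : ∀ i, FlatOver A S (M i))
    {S' : Type u} [CommRing S'] [Algebra S S'] (hS' : IsFlatExactBaseChange A S S') :
    IsSyzygyChain (M := fun i => S' ⊗[S] M i) (F := fun i => S' ⊗[S] F i)
      (fun i => (ι i).baseChange S') (fun i => (π i).baseChange S') where
  inj i := hS' _ _ (h.inj i) (h.exact i) (h.surj i) (hM i)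
  exact i := lTensor_exact S' (h.exact i) (h.surj i)
  surj i := LinearMap.lTensor_surjective S' (h.surj i)

theorem IsSyzygyChain.cohomology_baseChange_equiv (hF : ∀ i, Module.Projective S (F i))
    (hfin : ∀ i, Module.Finite S (F i)) (S' : Type u) [CommRing S'] [Algebra S S'] (i : ℕ) :
    Nonempty (cohomology (fun i => (homDifferential ι π S i).baseChange S') i ≃ₗ[S']
      cohomology (homDifferential (M := fun i => S' ⊗[S] M i) (F := fun i => S' ⊗[S] F i)
        (fun i => (ι i).baseChange S') (fun i => (π i).baseChange S') S') i) := by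
  refine cohomology_equiv (fun i => LinearEquiv.ofBijective (dualBaseChangeHom S' (F i))
    (dualBaseChangeHom_bijective S' (F i))) (fun i x => ?_) i
  have h := dualBaseChangeHom_lcomp S' (ι i ∘ₗ π (i + 1)) x
  rw [LinearMap.baseChange_comp] at h
  exact h

/-- `Ext` of a base change is the cohomology of the base change of the dual complex. -/
theorem IsSyzygyChain.ext_baseChange_equiv (h : IsSyzygyChain ι π)
    (hM : ∀ i, FlatOver A S (M i)) (hF : ∀ i, Module.Projective S (F i))
    (hfin : ∀ i, Module.Finite S (F i)) {S' : Type u} [CommRing S'] [Algebra S S']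
    (hS' : IsFlatExactBaseChange A S S') (i : ℕ) :
    Nonempty (ExtMod S' (S' ⊗[S] M 0) S' i ≃ₗ[S']
      cohomology (fun i => (homDifferential ι π S i).baseChange S') i) := by
  obtain ⟨e⟩ := IsSyzygyChain.cohomology_baseChange_equiv (ι := ι) (π := π) hF hfin S' i
  obtain ⟨e'⟩ := (h.baseChange hM hS').ext_equiv S' (fun i => inferInstance) i
  exact ⟨e'.trans e.symm⟩

/-- If the dual of the base changed resolution is exact except in degree `c`, an element killing
the remaining `Ext` kills the base changed module. -/
theorem IsSyzygyChain.smul_eq_zero_of_ext_baseChange (h : IsSyzygyChain ι π)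
    (hM : ∀ i, FlatOver A S (M i)) (hF : ∀ i, Module.Projective S (F i))
    (hfin : ∀ i, Module.Finite S (F i)) {N c : ℕ} (hN : ∀ i, N < i → Subsingleton (F i))
    {S' : Type u} [CommRing S'] [Algebra S S']
    (hS' : IsFlatExactBaseChange A S S')
    (hex : ∀ i, i ≠ c → Subsingleton (ExtMod S' (S' ⊗[S] M 0) S' i)) (t : S')
    (ht : ∀ x : ExtMod S' (S' ⊗[S] M 0) S' c, t • x = 0) (m : S' ⊗[S] M 0) : t • m = 0 := by
  have hc := h.baseChange hM hS'
  have he := hc.ext_equiv S' (fun i => inferInstance)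
  refine hc.smul_eq_zero_of_cohomology (fun i => inferInstance) (fun i => inferInstance) (N := N)
    (c := c) (fun i hi => ?_) (fun i hi => ?_) t (fun x => ?_) m
  · have := hN i hi
    infer_instance
  · rw [← subsingleton_cohomology_iff]
    obtain ⟨e⟩ := he i
    have := hex i hi
    exact e.symm.injective.subsingleton
  · obtain ⟨e⟩ := he c
    rw [← e.apply_symm_apply x, ← map_smul, ht, map_zero]

end ChainBaseChange

/-! ### Base change of cohomology under flatness. -/

section CohomologyBaseChange

variable {A S : Type u} [CommRing A] [CommRing S] [Algebra A S]
  {K : ℕ → Type u} [∀ i, AddCommGroup (K i)] [∀ i, Module S (K i)]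
  {d : ∀ i, K i →ₗ[S] K (i + 1)}

/-- Descending induction from the top: the range of `d i` is the kernel of the surjection from
cocycles to cohomology in degree `i + 1`, and the cocycles in degree `i` are the kernel of `K i`
onto that range. Kernels of surjections between flat modules are flat. -/
theorem flatOver_ker_and_range (hd : ∀ i x, d (i + 1) (d i x) = 0) (hK : ∀ i, FlatOver A S (K i))
    {N : ℕ} (hN : ∀ i, N < i → Subsingleton (K i)) (i : ℕ)
    (hH : ∀ j, i < j → FlatOver A S (cohomology d j)) :
    FlatOver A S (LinearMap.ker (d i)) ∧ FlatOver A S (LinearMap.range (d i)) := by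
  obtain h | h := le_or_gt i N
  · induction h using Nat.decreasingInduction with
    | self =>
      have := hN (N + 1) (by omega)
      have h2 : FlatOver A S (LinearMap.range (d N)) := FlatOver.of_subsingleton
      exact ⟨FlatOver.of_exact_left (Submodule.injective_subtype _)
        (g := (d N).rangeRestrict) (by
          rw [LinearMap.exact_iff, LinearMap.ker_rangeRestrict, Submodule.range_subtype])
        (LinearMap.surjective_rangeRestrict _) (hK _) h2, h2⟩
    | of_succ i hi ih =>
      obtain ⟨h1, -⟩ := ih (fun j hj => hH j (by omega))
      have h2 : FlatOver A S (LinearMap.range (d i)) := by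
        refine FlatOver.congr (Submodule.submoduleOfEquivOfLe
          (coboundaries_le_ker hd (i + 1))) (X := (coboundaries d (i + 1)).submoduleOf
            (LinearMap.ker (d (i + 1)))) ?_
        exact FlatOver.of_exact_left (Submodule.injective_subtype _)
          (LinearMap.exact_subtype_mkQ _) (Submodule.mkQ_surjective _) h1 (hH (i + 1) (by omega))
      exact ⟨FlatOver.of_exact_left (Submodule.injective_subtype _)
        (g := (d i).rangeRestrict) (by
          rw [LinearMap.exact_iff, LinearMap.ker_rangeRestrict, Submodule.range_subtype])
        (LinearMap.surjective_rangeRestrict _) (hK _) h2, h2⟩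
  · have := hN i h
    have := hN (i + 1) (by omega)
    exact ⟨FlatOver.of_subsingleton, FlatOver.of_subsingleton⟩

/-- The quotient by the coboundaries is flat as soon as the higher cohomology is. -/
theorem flatOver_quotient_range (hd : ∀ i x, d (i + 1) (d i x) = 0)
    (hK : ∀ i, FlatOver A S (K i)) {N : ℕ} (hN : ∀ i, N < i → Subsingleton (K i)) (i : ℕ)
    (hH : ∀ j, i < j → FlatOver A S (cohomology d j)) :
    FlatOver A S (K (i + 1) ⧸ LinearMap.range (d i)) := by
  have h1 := (flatOver_ker_and_range hd hK hN (i + 1) (fun j hj => hH j (by omega))).2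
  let B := LinearMap.range (d i)
  let Z := LinearMap.ker (d (i + 1))
  have hBZ : B ≤ Z := coboundaries_le_ker hd (i + 1)
  let f : (Z ⧸ B.submoduleOf Z) →ₗ[S] (K (i + 1) ⧸ B) :=
    Submodule.mapQ (B.submoduleOf Z) B Z.subtype (fun x hx => hx)
  let g : (K (i + 1) ⧸ B) →ₗ[S] LinearMap.range (d (i + 1)) :=
    B.liftQ (d (i + 1)).rangeRestrict (fun x hx => by
      rw [LinearMap.ker_rangeRestrict]; exact hBZ hx)
  refine FlatOver.of_exact_middle (f := f) (g := g) ?_ ?_ ?_ (hH (i + 1) (by omega)) h1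
  · rw [injective_iff_map_eq_zero]
    intro x hx
    obtain ⟨x, rfl⟩ := Submodule.Quotient.mk_surjective _ x
    rw [Submodule.Quotient.mk_eq_zero]
    exact (Submodule.Quotient.mk_eq_zero B).mp hx
  · intro x
    obtain ⟨x, rfl⟩ := Submodule.Quotient.mk_surjective _ x
    constructor
    · intro hx
      exact ⟨Submodule.Quotient.mk ⟨x, congrArg Subtype.val hx⟩, rfl⟩
    · rintro ⟨y, hy⟩
      rw [← hy]
      obtain ⟨y, rfl⟩ := Submodule.Quotient.mk_surjective _ y
      exact Subtype.ext y.2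
  · rintro ⟨_, x, rfl⟩
    exact ⟨Submodule.Quotient.mk x, rfl⟩

variable {S' : Type u} [CommRing S'] [Algebra S S']

/-- Factor `d i` through its range. The inclusion of the range stays injective after base change
because its cokernel is flat, so forming cocycles commutes with base change. -/
theorem ker_baseChange_eq_range (hd : ∀ i x, d (i + 1) (d i x) = 0)
    (hK : ∀ i, FlatOver A S (K i)) {N : ℕ} (hN : ∀ i, N < i → Subsingleton (K i))
    (hS' : IsFlatExactBaseChange A S S') (i : ℕ)
    (hH : ∀ j, i < j → FlatOver A S (cohomology d j)) :
    Function.Injective ((LinearMap.ker (d i)).subtype.baseChange S') ∧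
      LinearMap.ker ((d i).baseChange S') =
        LinearMap.range ((LinearMap.ker (d i)).subtype.baseChange S') := by
  have h1 := (flatOver_ker_and_range hd hK hN i hH).2
  have h2 := flatOver_quotient_range hd hK hN i hH
  have hex : Function.Exact (LinearMap.ker (d i)).subtype (d i).rangeRestrict := by
    rw [LinearMap.exact_iff, LinearMap.ker_rangeRestrict, Submodule.range_subtype]
  refine ⟨hS' _ _ (Submodule.injective_subtype _) hex (LinearMap.surjective_rangeRestrict _) h1, ?_⟩
  have h3 := hS' _ _ (Submodule.injective_subtype (LinearMap.range (d i)))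
    (LinearMap.exact_subtype_mkQ _) (Submodule.mkQ_surjective _) h2
  have h4 : (d i).baseChange S' = (LinearMap.range (d i)).subtype.baseChange S' ∘ₗ
      (d i).rangeRestrict.baseChange S' := by
    rw [← LinearMap.baseChange_comp]; rfl
  have h5 : Function.Exact ((LinearMap.ker (d i)).subtype.baseChange S')
      ((d i).rangeRestrict.baseChange S') :=
    lTensor_exact S' hex (LinearMap.surjective_rangeRestrict _)
  rw [h4, LinearMap.ker_comp_of_ker_eq_bot _ (LinearMap.ker_eq_bot.mpr h3)]
  exact LinearMap.exact_iff.mp h5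

/-- Cohomology commutes with base change if the higher cohomology is flat. -/
theorem cohomology_baseChange_equiv (hd : ∀ i x, d (i + 1) (d i x) = 0)
    (hK : ∀ i, FlatOver A S (K i)) {N : ℕ} (hN : ∀ i, N < i → Subsingleton (K i))
    (hS' : IsFlatExactBaseChange A S S') (i : ℕ)
    (hH : ∀ j, i < j → FlatOver A S (cohomology d j)) :
    Nonempty ((S' ⊗[S] cohomology d i) ≃ₗ[S'] cohomology (fun i => (d i).baseChange S') i) := by
  obtain ⟨hinj, hker⟩ := ker_baseChange_eq_range hd hK hN hS' i hH
  let Z := LinearMap.ker (d i)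
  let B := (coboundaries d i).submoduleOf Z
  let z : S' ⊗[S] Z →ₗ[S'] LinearMap.ker ((d i).baseChange S') :=
    (Z.subtype.baseChange S').codRestrict _ (fun x => hker ▸ LinearMap.mem_range_self _ x)
  let φ : S' ⊗[S] Z →ₗ[S'] cohomology (fun i => (d i).baseChange S') i :=
    Submodule.mkQ _ ∘ₗ z
  have hz : Function.Surjective z := by
    rintro ⟨y, hy⟩
    rw [hker] at hy
    obtain ⟨x, rfl⟩ := hy
    exact ⟨x, rfl⟩
  have hφ : Function.Surjective φ := (Submodule.mkQ_surjective _).comp hz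
  let ψ : S' ⊗[S] Z →ₗ[S'] S' ⊗[S] cohomology d i := B.mkQ.baseChange S'
  have hψ : Function.Surjective ψ := LinearMap.lTensor_surjective S' (Submodule.mkQ_surjective _)
  have hψk (x) : x ∈ LinearMap.ker ψ ↔ x ∈ LinearMap.range (B.subtype.baseChange S') := by
    have h5 : Function.Exact (B.subtype.baseChange S') ψ :=
      lTensor_exact S' (LinearMap.exact_subtype_mkQ B) (Submodule.mkQ_surjective _)
    rw [LinearMap.exact_iff.mp h5]
  have hφk (x) : x ∈ LinearMap.ker φ ↔
      Z.subtype.baseChange S' x ∈ coboundaries (fun i => (d i).baseChange S') i :=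
    Submodule.Quotient.mk_eq_zero _
  have hk : LinearMap.ker φ = LinearMap.ker ψ := by
    ext x
    rw [hφk, hψk]
    cases i with
    | zero =>
      change _ = 0 ↔ _
      rw [map_eq_zero_iff _ hinj]
      have hB : B.subtype = 0 := by
        ext y
        exact y.2
      rw [hB, LinearMap.baseChange_zero, LinearMap.range_zero, Submodule.mem_bot]
    | succ i =>
      let δ : K i →ₗ[S] B := ((d i).codRestrict Z (hd i)).codRestrict B (fun x => ⟨x, rfl⟩)
      have hδ : Function.Surjective δ := by
        rintro ⟨⟨y, hy⟩, hx⟩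
        obtain ⟨x, hx⟩ := hx
        exact ⟨x, Subtype.ext (Subtype.ext hx)⟩
      have h6 : (d i).baseChange S' = Z.subtype.baseChange S' ∘ₗ
          (B.subtype.baseChange S') ∘ₗ δ.baseChange S' := by
        rw [← LinearMap.baseChange_comp, ← LinearMap.baseChange_comp]; rfl
      constructor
      · rintro ⟨w, hw⟩
        refine ⟨δ.baseChange S' w, hinj ?_⟩
        rw [← hw]
        exact (LinearMap.congr_fun h6 w).symm
      · rintro ⟨w, rfl⟩
        obtain ⟨w, rfl⟩ := LinearMap.lTensor_surjective S' hδ w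
        exact ⟨w, LinearMap.congr_fun h6 w⟩
  exact ⟨(ψ.quotKerEquivOfSurjective hψ).symm.trans
    ((Submodule.quotEquivOfEq _ _ hk.symm).trans (φ.quotKerEquivOfSurjective hφ))⟩

end CohomologyBaseChange

/-! ### Maps of flat modules that are injective on all fibers. -/

section FiberwiseInjective

variable {A : Type u} [CommRing A] {C N : Type u} [AddCommGroup C]
  [AddCommGroup N] [Module A C] [Module A N]

/-- `A/p` embeds in `κ(p)`, and flatness of `C` turns this into an embedding of `(A/p) ⊗ C` in the
fiber of `C`. -/
theorem injective_lTensor_quotient_prime (u : C →ₗ[A] N) [Module.Flat A C] (p : Ideal A)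
    [p.IsPrime] (h : Function.Injective (u.lTensor p.ResidueField)) :
    Function.Injective (u.lTensor (A ⧸ p)) := by
  let j : (A ⧸ p) →ₗ[A] p.ResidueField := (IsScalarTower.toAlgHom A (A ⧸ p) p.ResidueField).toLinearMap
  have hj : Function.Injective j := Ideal.injective_algebraMap_quotient_residueField p
  have h1 := Module.Flat.rTensor_preserves_injective_linearMap (M := C) j hj
  intro x y hxy
  apply h1
  apply h
  rw [← LinearMap.rTensor_lTensor_comm, hxy, LinearMap.rTensor_lTensor_comm]

/-- A map between flat modules that is injective on all fibers is universally injective. -/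
theorem injective_lTensor_of_fiberwise [IsNoetherianRing A] (u : C →ₗ[A] N) [Module.Flat A C] [Module.Flat A N]
    (h : ∀ (p : Ideal A) [p.IsPrime], Function.Injective (u.lTensor p.ResidueField))
    (X : Type u) [AddCommGroup X] [Module A X] (hX : Module.Finite A X) :
    Function.Injective (u.lTensor X) := by
  -- Dévissage to the modules `A/p`: flatness of `N` carries injectivity across short exact
  -- sequences, so neither `C` nor `N` has to be finitely generated.
  induction hX using IsNoetherianRing.induction_on_isQuotientEquivQuotientPrime A with
  | subsingleton X => exact Function.injective_of_subsingleton _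
  | quotient X p e =>
    have h1 := injective_lTensor_quotient_prime u p.asIdeal (h p.asIdeal)
    have h2 : (e.toLinearMap.rTensor N) ∘ (u.lTensor X) =
        (u.lTensor (A ⧸ p.asIdeal)) ∘ (e.toLinearMap.rTensor C) :=
      funext fun x => LinearMap.rTensor_lTensor_comm _ _ x
    refine Function.Injective.of_comp (f := e.toLinearMap.rTensor N) ?_
    rw [h2]
    exact h1.comp (e.rTensor C).injective
  | exact X₁ X₂ X₃ f g hf hg hfg h1 h3 =>
    rw [injective_iff_map_eq_zero]
    intro x hx
    have h4 : g.rTensor C x = 0 := h3 (by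
      rw [← LinearMap.rTensor_lTensor_comm, hx, map_zero, map_zero])
    obtain ⟨y, rfl⟩ := (rTensor_exact C hfg hg x).mp h4
    rw [← LinearMap.rTensor_lTensor_comm] at hx
    have h5 := Module.Flat.rTensor_preserves_injective_linearMap (M := N) f hf
    rw [h1 (h5 (hx.trans (map_zero _).symm) |>.trans (map_zero _).symm), map_zero]

theorem injective_of_injective_lTensor_self (u : C →ₗ[A] N) (h : Function.Injective (u.lTensor A)) :
    Function.Injective u := by
  intro x y hxy
  have h7 := @h (1 ⊗ₜ x) (1 ⊗ₜ y) (by rw [LinearMap.lTensor_tmul, LinearMap.lTensor_tmul, hxy])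
  simpa using congrArg (TensorProduct.lid A C) h7

end FiberwiseInjective

/-! ### Fiberwise criterion for cohomology in a single degree. -/

section FiberwiseExact

attribute [local instance] Algebra.TensorProduct.rightAlgebra

variable {A S : Type u} [CommRing A] [CommRing S] [Algebra A S]

theorem IsFlatExactBaseChange.fiber (p : Ideal A) [p.IsPrime] :
    IsFlatExactBaseChange A S (p.Fiber S) :=
  IsFlatExactBaseChange.of_isPushout A S p.ResidueField (p.Fiber S)

/-- A finitely generated module all of whose fibers vanish is zero. -/
theorem subsingleton_of_subsingleton_fiber (G : Type u) [AddCommGroup G] [Module S G]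
    [Module.Finite S G]
    (h : ∀ (p : Ideal A) [p.IsPrime], Subsingleton (p.Fiber S ⊗[S] G)) : Subsingleton G := by
  rw [← Module.support_eq_empty_iff (R := S), Set.eq_empty_iff_forall_notMem]
  intro q hq
  rw [Module.mem_support_iff_nontrivial_residueField_tensorProduct] at hq
  let p := q.asIdeal.comap (algebraMap A S)
  -- The residue field of `q` is an algebra over the fiber at `p = q ∩ A`, so `κ(q) ⊗ G` vanishes
  -- with the fiber of `G`, and `q` is not in the support.
  let φ : p.Fiber S →ₐ[A] q.asIdeal.ResidueField :=
    Algebra.TensorProduct.lift (Ideal.ResidueField.mapₐ p q.asIdeal (Algebra.ofId A S) rfl)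
      (IsScalarTower.toAlgHom A S q.asIdeal.ResidueField) (fun _ _ => Commute.all _ _)
  let φ' : p.Fiber S →ₗ[S] q.asIdeal.ResidueField :=
    { φ with
      map_smul' := fun s x => by
        rw [Algebra.smul_def, Algebra.smul_def]
        change φ (_ * _) = _ * φ x
        rw [map_mul]
        congr 1
        exact (Algebra.TensorProduct.lift_tmul _ _ _ _ _).trans (by rw [map_one, one_mul]; rfl) }
  have h0 (x : q.asIdeal.ResidueField ⊗[S] G) : x = 0 := by
    induction x with
    | zero => rfl
    | add x y hx hy => rw [hx, hy, add_zero]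
    | tmul l g =>
      have h1 : φ'.rTensor G ((1 : p.Fiber S) ⊗ₜ g) = 0 := by
        rw [(h p).elim ((1 : p.Fiber S) ⊗ₜ g) 0, map_zero]
      have h2 : (1 : q.asIdeal.ResidueField) ⊗ₜ[S] g = 0 := by
        rw [← h1, LinearMap.rTensor_tmul]
        exact congrArg (fun a => a ⊗ₜ[S] g) (map_one φ).symm
      rw [show l ⊗ₜ[S] g = l • ((1 : q.asIdeal.ResidueField) ⊗ₜ[S] g) by
        rw [TensorProduct.smul_tmul', smul_eq_mul, mul_one], h2, smul_zero]
  exact not_subsingleton_iff_nontrivial.mpr hq ⟨fun x y => (h0 x).trans (h0 y).symm⟩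

theorem injective_and_flatOver_of_fiberwise [IsNoetherianRing A] {C N Z : Type u} [AddCommGroup C]
    [AddCommGroup N] [AddCommGroup Z] [Module S C] [Module S N] [Module S Z] (u : C →ₗ[S] N)
    (g : N →ₗ[S] Z) (hug : Function.Exact u g) (hg : Function.Surjective g) (hC : FlatOver A S C)
    (hN : FlatOver A S N)
    (h : ∀ (p : Ideal A) [p.IsPrime], Function.Injective (u.baseChange (p.Fiber S))) :
    Function.Injective u ∧ FlatOver A S Z := by
  let : Module A C := Module.compHom _ (algebraMap A S)
  have : IsScalarTower A S C := .of_algebraMap_smul fun _ _ => rfl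
  let : Module A N := Module.compHom _ (algebraMap A S)
  have : IsScalarTower A S N := .of_algebraMap_smul fun _ _ => rfl
  let : Module A Z := Module.compHom _ (algebraMap A S)
  have : IsScalarTower A S Z := .of_algebraMap_smul fun _ _ => rfl
  rw [flatOver_iff] at hC hN ⊢
  have h4 := injective_lTensor_of_fiberwise (u.restrictScalars A) fun p _ =>
    (injective_baseChange_iff (A := A) (κ := p.ResidueField) (S' := p.Fiber S) u).mp (h p)
  constructor
  · exact injective_of_injective_lTensor_self (u.restrictScalars A) (h4 A inferInstance)
  · exact Module.Flat.of_exact_right (f := u.restrictScalars A)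
      (g := g.restrictScalars A) (fun I => h4 _ inferInstance) hug hg hN

variable {K : ℕ → Type u} [∀ i, AddCommGroup (K i)] [∀ i, Module S (K i)]
  {d : ∀ i, K i →ₗ[S] K (i + 1)}

/-- Descending induction: once the cohomology above degree `i` vanishes, cohomology in degree `i`
commutes with base change; its fibers are zero, and a finitely generated module with zero fibers is
zero. -/
theorem subsingleton_cohomology_of_fiberwise [IsNoetherianRing S]
    (hd : ∀ i x, d (i + 1) (d i x) = 0) (hK : ∀ i, FlatOver A S (K i))
    (hfin : ∀ i, Module.Finite S (K i)) {N : ℕ} (hN : ∀ i, N < i → Subsingleton (K i)) {c : ℕ}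
    (hex : ∀ (p : Ideal A) [p.IsPrime], ∀ i, c < i →
      ExactAt (fun i => (d i).baseChange (p.Fiber S)) i) (i : ℕ) (hi : c < i) :
    Subsingleton (cohomology d i) := by
  suffices h : ∀ k i, c < i → N < i + k → Subsingleton (cohomology d i) from
    h (N + 1) i hi (by omega)
  intro k
  induction k with
  | zero =>
    intro i _ h
    have := hN i h
    infer_instance
  | succ k ih =>
    intro i hi hk
    refine subsingleton_of_subsingleton_fiber (A := A) (S := S) _ fun p hp => ?_
    obtain ⟨e⟩ := cohomology_baseChange_equiv hd hK hN (IsFlatExactBaseChange.fiber p) i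
      (fun j hj => by have := ih j (by omega) (by omega); exact FlatOver.of_subsingleton)
    have := (subsingleton_cohomology_iff _ _).mpr (hex p i hi)
    exact e.injective.subsingleton

/-- The map induced by `d i` on the quotient by the coboundaries. -/
def quotientCoboundariesHom (hd : ∀ i x, d (i + 1) (d i x) = 0) (i : ℕ) :
    (K i ⧸ coboundaries d i) →ₗ[S] K (i + 1) :=
  (coboundaries d i).liftQ (d i) (coboundaries_le_ker hd i)

theorem injective_quotientCoboundariesHom_baseChange (hd : ∀ i x, d (i + 1) (d i x) = 0) (i : ℕ)
    (S' : Type u) [CommRing S'] [Algebra S S']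
    (hex : ExactAt (fun i => (d i).baseChange S') i) :
    Function.Injective ((quotientCoboundariesHom hd i).baseChange S') := by
  rw [injective_iff_map_eq_zero]
  intro t ht
  obtain ⟨x, rfl⟩ := LinearMap.lTensor_surjective S' (coboundaries d i).mkQ_surjective t
  have h1 : (quotientCoboundariesHom hd i).baseChange S' ∘ₗ (coboundaries d i).mkQ.baseChange S' =
      (d i).baseChange S' := by
    rw [← LinearMap.baseChange_comp]; rfl
  have h2 : x ∈ coboundaries (fun i => (d i).baseChange S') i :=
    hex ((LinearMap.congr_fun h1 x).symm.trans ht)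
  cases i with
  | zero =>
    have h3 : x = 0 := h2
    rw [h3, map_zero]
  | succ i =>
    obtain ⟨w, rfl⟩ := h2
    have h4 : (coboundaries d (i + 1)).mkQ.baseChange S' ∘ₗ (d i).baseChange S' = 0 := by
      have h5 : (coboundaries d (i + 1)).mkQ ∘ₗ d i = 0 := LinearMap.range_mkQ_comp (d i)
      rw [← LinearMap.baseChange_comp, h5, LinearMap.baseChange_zero]
    exact LinearMap.congr_fun h4 w

/-- Ascending induction: if `K i / B i` is flat, the induced map to `K (i + 1)` is injective on
fibers, hence injective with flat cokernel `K (i + 1) / B (i + 1)`. -/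
theorem flatOver_quotient_coboundaries_of_fiberwise [IsNoetherianRing A]
    (hd : ∀ i x, d (i + 1) (d i x) = 0) (hK : ∀ i, FlatOver A S (K i)) {c : ℕ}
    (hex : ∀ (p : Ideal A) [p.IsPrime], ∀ i, i < c →
      ExactAt (fun i => (d i).baseChange (p.Fiber S)) i) :
    (∀ i, i < c → ExactAt d i) ∧
      ∀ i, i ≤ c → FlatOver A S (K i ⧸ coboundaries d i) := by
  have key (i : ℕ) (hi : i < c) (hC : FlatOver A S (K i ⧸ coboundaries d i)) :
      ExactAt d i ∧ FlatOver A S (K (i + 1) ⧸ coboundaries d (i + 1)) := by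
    obtain ⟨h1, h2⟩ := injective_and_flatOver_of_fiberwise (quotientCoboundariesHom hd i)
      _ (LinearMap.exact_map_mkQ_range _) (Submodule.mkQ_surjective _) hC
      (hK (i + 1))
      (fun p _ => injective_quotientCoboundariesHom_baseChange hd i _ (hex p i hi))
    refine ⟨fun x hx => (Submodule.Quotient.mk_eq_zero _).mp (h1 ?_), ?_⟩
    · rw [map_zero]; exact hx
    · have h3 : LinearMap.range (quotientCoboundariesHom hd i) = coboundaries d (i + 1) :=
        Submodule.range_liftQ _ _ _
      exact FlatOver.congr (Submodule.quotEquivOfEq _ _ h3) h2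
  have hC (i : ℕ) (hi : i ≤ c) : FlatOver A S (K i ⧸ coboundaries d i) := by
    induction i with
    | zero => exact FlatOver.congr (Submodule.quotEquivOfEqBot _ rfl).symm (hK 0)
    | succ i ih => exact (key i (by omega) (ih (by omega))).2
  exact ⟨fun i hi => (key i hi (hC i hi.le)).1, hC⟩

/-- A bounded complex of flat modules whose fibers have cohomology only in degree `c` has cohomology
only in degree `c`, and this cohomology is flat. -/
theorem exactAt_and_flatOver_of_fiberwise [IsNoetherianRing A] [IsNoetherianRing S]
    (hd : ∀ i x, d (i + 1) (d i x) = 0) (hK : ∀ i, FlatOver A S (K i))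
    (hfin : ∀ i, Module.Finite S (K i)) {N : ℕ} (hN : ∀ i, N < i → Subsingleton (K i)) {c : ℕ}
    (hex : ∀ (p : Ideal A) [p.IsPrime], ∀ i, i ≠ c →
      ExactAt (fun i => (d i).baseChange (p.Fiber S)) i) :
    (∀ i, i ≠ c → ExactAt d i) ∧ FlatOver A S (cohomology d c) := by
  have h1 := subsingleton_cohomology_of_fiberwise hd hK hfin hN (c := c)
    (fun p _ i hi => hex p i (by omega))
  obtain ⟨h2, h3⟩ := flatOver_quotient_coboundaries_of_fiberwise hd hK (c := c)
    (fun p _ i hi => hex p i (by omega))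
  refine ⟨fun i hi => ?_, ?_⟩
  · rcases Nat.lt_or_gt_of_ne hi with h | h
    · exact h2 i h
    · rw [← subsingleton_cohomology_iff]; exact h1 i h
  -- The cohomology in degree `c` is the kernel of `K c / B c` onto the range of `d c`. The source
  -- is flat by the ascending induction, the target by the descending one.
  · have h4 := (flatOver_ker_and_range hd hK hN c
      (fun j hj => by have := h1 j hj; exact FlatOver.of_subsingleton)).2
    let B := coboundaries d c
    let Z := LinearMap.ker (d c)
    let f : cohomology d c →ₗ[S] (K c ⧸ B) :=
      Submodule.mapQ (B.submoduleOf Z) B Z.subtype (fun x hx => hx)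
    let g : (K c ⧸ B) →ₗ[S] LinearMap.range (d c) :=
      B.liftQ (d c).rangeRestrict (fun x hx => by
        rw [LinearMap.ker_rangeRestrict]; exact coboundaries_le_ker hd c hx)
    refine FlatOver.of_exact_left (f := f) (g := g) ?_ ?_ ?_ (h3 c le_rfl) h4
    · rw [injective_iff_map_eq_zero]
      intro x hx
      obtain ⟨x, rfl⟩ := Submodule.Quotient.mk_surjective _ x
      rw [Submodule.Quotient.mk_eq_zero]
      exact (Submodule.Quotient.mk_eq_zero B).mp hx
    · intro x
      obtain ⟨x, rfl⟩ := Submodule.Quotient.mk_surjective _ x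
      constructor
      · intro hx
        exact ⟨Submodule.Quotient.mk ⟨x, congrArg Subtype.val hx⟩, rfl⟩
      · rintro ⟨y, hy⟩
        rw [← hy]
        obtain ⟨y, rfl⟩ := Submodule.Quotient.mk_surjective _ y
        exact Subtype.ext y.2
    · rintro ⟨_, x, rfl⟩
      exact ⟨Submodule.Quotient.mk x, rfl⟩

end FiberwiseExact

/-! ### Properties of polynomial rings over a field, up to isomorphism. -/

section PolynomialLike

open RingTheory.Sequence

/-- The properties of polynomial rings in `n` variables over a field that are used below. -/
structure IsPolynomialLike (T : Type u) [CommRing T] (n : ℕ) : Prop where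
  noeth : IsNoetherianRing T
  injDim : HasInjectiveDimensionLE (ModuleCat.of T T) n
  krullDim : ringKrullDim T ≤ n
  regular : ∀ (m : Ideal T) [m.IsMaximal], ∃ rs : List T, rs.length = n ∧ IsWeaklyRegular T rs ∧
    Ideal.ofList rs = m

theorem hasInjectiveDimensionLE_self_of_ringEquiv {T T' : Type u} [CommRing T] [CommRing T']
    (e : T ≃+* T') (d : ℕ) (h : HasInjectiveDimensionLE (ModuleCat.of T T) d) :
    HasInjectiveDimensionLE (ModuleCat.of T' T') d := by
  let := RingHomInvPair.of_ringEquiv e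
  let := RingHomInvPair.of_ringEquiv e.symm
  exact (ModuleCat.hasInjectiveDimensionLE_iff_of_semiLinearEquiv e (M := ModuleCat.of T T)
    (N := ModuleCat.of T' T') { e with map_smul' := fun a b => map_mul e a b } d).mp h

theorem IsPolynomialLike.of_ringEquiv {k T : Type u} [Field k] [CommRing T] {n : ℕ}
    (e : MvPolynomial (Fin n) k ≃+* T) : IsPolynomialLike T n where
  noeth := isNoetherianRing_of_ringEquiv _ e
  injDim := hasInjectiveDimensionLE_self_of_ringEquiv e n (hasInjectiveDimensionLE_mvPolynomial _)
  krullDim := by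
    rw [← ringKrullDim_eq_of_ringEquiv e, MvPolynomial.ringKrullDim_of_isNoetherianRing,
      ringKrullDim_eq_zero_of_field]
    simp
  regular m hm := by
    have hmax : (m.comap e).IsMaximal := Ideal.comap_isMaximal_of_equiv e
    obtain ⟨rs, hlen, hrs, hq⟩ := exists_isWeaklyRegular_mvPolynomial n (m.comap e)
    refine ⟨rs.map e, by simp [hlen], exists_isWeaklyRegular_of_ringEquiv e _ hrs, ?_⟩
    have h := Ideal.map_ofList (e : MvPolynomial (Fin n) k →+* T) rs
    rw [hq] at h
    exact h.symm.trans (Ideal.map_comap_of_surjective _ e.surjective m)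

variable {T : Type u} [CommRing T] {n : ℕ} (hT : IsPolynomialLike T n)

theorem IsPolynomialLike.exists_isRegular (hT : IsPolynomialLike T n) (m : Ideal T)
    [m.IsMaximal] : ∃ rs : List (Localization.AtPrime m), rs.length = n ∧
      IsRegular (Localization.AtPrime m) rs ∧
      Ideal.ofList rs = IsLocalRing.maximalIdeal (Localization.AtPrime m) := by
  obtain ⟨rs, hlen, hrs, hm⟩ := hT.regular m
  refine ⟨rs.map (algebraMap _ _), by simp [hlen],
    hrs.isRegular_of_isLocalization_of_mem (Localization.AtPrime m) m fun r hr => ?_, ?_⟩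
  · rw [← hm]; exact Ideal.subset_span hr
  · rw [← Ideal.map_ofList, hm]; exact Localization.AtPrime.map_eq_maximalIdeal

theorem IsPolynomialLike.ringKrullDim_localization_le (hT : IsPolynomialLike T n) (m : Ideal T)
    [m.IsPrime] : ringKrullDim (Localization.AtPrime m) ≤ n := by
  rw [IsLocalization.AtPrime.ringKrullDim_eq_height m]
  exact (Ideal.height_le_ringKrullDim_of_ne_top (Ideal.IsPrime.ne_top ‹_›)).trans hT.krullDim

end PolynomialLike

/-! ### Local rings of a quotient as base changes. -/

section LocalizedQuotient

theorem ringEquiv_of_ker_eq {R₀ B₁ B₂ : Type*} [CommRing R₀] [CommRing B₁] [CommRing B₂]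
    (f : R₀ →+* B₁) (g : R₀ →+* B₂) (hf : Function.Surjective f) (hg : Function.Surjective g)
    (h : RingHom.ker f = RingHom.ker g) : Nonempty (B₁ ≃+* B₂) :=
  ⟨(RingHom.quotientKerEquivOfSurjective hf).symm.trans
    ((Ideal.quotEquivOfEq h).trans (RingHom.quotientKerEquivOfSurjective hg))⟩

variable {S R T B : Type u} [CommRing S] [CommRing R] [CommRing T] [CommRing B] [Algebra S R]
  [Algebra S T]

theorem surjective_algebraMap_tensor (hR : Function.Surjective (algebraMap S R)) :
    Function.Surjective (algebraMap T (T ⊗[S] R)) := by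
  intro x
  induction x with
  | zero => exact ⟨0, map_zero _⟩
  | add x y hx hy =>
    obtain ⟨a, rfl⟩ := hx
    obtain ⟨b, rfl⟩ := hy
    exact ⟨a + b, map_add _ _ _⟩
  | tmul t r =>
    obtain ⟨s, rfl⟩ := hR r
    refine ⟨s • t, ?_⟩
    rw [Algebra.TensorProduct.algebraMap_apply, Algebra.algebraMap_self_apply, smul_tmul,
      Algebra.algebraMap_eq_smul_one]

theorem ker_algebraMap_tensor (hR : Function.Surjective (algebraMap S R)) :
    RingHom.ker (algebraMap T (T ⊗[S] R)) =
      (RingHom.ker (algebraMap S R)).map (algebraMap S T) := by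
  have h := Algebra.TensorProduct.lTensor_ker (A := T) (Algebra.ofId S R) hR
  apply le_antisymm
  · intro (t : T) ht
    have h1 : (t ⊗ₜ[S] (1 : S)) ∈ RingHom.ker (Algebra.TensorProduct.map (AlgHom.id S T)
        (Algebra.ofId S R)) := by
      rw [RingHom.mem_ker, Algebra.TensorProduct.map_tmul, map_one]
      exact ht
    rw [h] at h1
    have h2 := Ideal.mem_map_of_mem (Algebra.TensorProduct.rid S T T) h1
    rw [Algebra.TensorProduct.rid_tmul, one_smul] at h2
    refine (Ideal.map_le_iff_le_comap.mpr (Ideal.map_le_iff_le_comap.mpr ?_)) h2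
    intro s hs
    change (Algebra.TensorProduct.rid S T T) (1 ⊗ₜ s) ∈
      (RingHom.ker (algebraMap S R)).map (algebraMap S T)
    rw [Algebra.TensorProduct.rid_tmul, ← Algebra.algebraMap_eq_smul_one]
    exact Ideal.mem_map_of_mem _ hs
  · rw [Ideal.map_le_iff_le_comap]
    intro s hs
    rw [Ideal.mem_comap, RingHom.mem_ker, ← IsScalarTower.algebraMap_apply,
      Algebra.TensorProduct.algebraMap_apply', RingHom.mem_ker.mp hs, tmul_zero]

/-- Both rings are quotients of the localization of `T` by the ideal generated by the kernel of `S →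
R`. -/
theorem localization_ringEquiv_tensor (hR : Function.Surjective (algebraMap S R)) (φ : T →+* B)
    (hφ : Function.Surjective φ)
    (hker : RingHom.ker φ = (RingHom.ker (algebraMap S R)).map (algebraMap S T)) (P : Ideal B)
    [P.IsPrime] :
    Nonempty (Localization.AtPrime P ≃+* Localization.AtPrime (P.comap φ) ⊗[S] R) := by
  refine ringEquiv_of_ker_eq (Localization.localRingHom (P.comap φ) P φ rfl)
    (algebraMap (Localization.AtPrime (P.comap φ)) _) ?_ (surjective_algebraMap_tensor hR) ?_
  · intro x
    obtain ⟨b, s, rfl⟩ := IsLocalization.exists_mk'_eq P.primeCompl x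
    obtain ⟨t, rfl⟩ := hφ b
    obtain ⟨s, hs⟩ := s
    obtain ⟨s, rfl⟩ := hφ s
    refine ⟨IsLocalization.mk' _ t (⟨s, hs⟩ : (P.comap φ).primeCompl), ?_⟩
    rw [Localization.localRingHom_mk']
  · rw [ker_algebraMap_tensor hR, IsScalarTower.algebraMap_eq S T, ← Ideal.map_map, ← hker]
    apply le_antisymm
    · intro x hx
      obtain ⟨t, s, rfl⟩ := IsLocalization.exists_mk'_eq (P.comap φ).primeCompl x
      rw [RingHom.mem_ker, Localization.localRingHom_mk', IsLocalization.mk'_eq_zero_iff] at hx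
      obtain ⟨⟨m, hm⟩, hx⟩ := hx
      obtain ⟨m, rfl⟩ := hφ m
      rw [IsLocalization.mk'_mem_map_algebraMap_iff]
      exact ⟨m, hm, by rw [RingHom.mem_ker, map_mul]; exact hx⟩
    · rw [Ideal.map_le_iff_le_comap]
      intro t ht
      rw [Ideal.mem_comap, RingHom.mem_ker, Localization.localRingHom_to_map, RingHom.mem_ker.mp ht,
        map_zero]

end LocalizedQuotient

/-! ### Localization of the cohomology of a fiber. -/

section FiberCohomology

variable {S k T : Type u} [CommRing S] [Field k] [CommRing T] [Algebra S T]
  {K : ℕ → Type u} [∀ i, AddCommGroup (K i)] [∀ i, Module S (K i)]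
  {d : ∀ i, K i →ₗ[S] K (i + 1)}

/-- With a field as base ring all flatness hypotheses are automatic, so the general base change
theorem also covers localization of a fiber. -/
theorem flatOver_of_field [Algebra k T] (X : Type u) [AddCommGroup X] [Module T X] : FlatOver k T X := by
  let : Module k X := Module.compHom X (algebraMap k T)
  have : IsScalarTower k T X := .of_algebraMap_smul fun _ _ => rfl
  rw [flatOver_iff]
  infer_instance

theorem isFlatExactBaseChange_of_flat {A : Type u} [CommRing A] [Algebra A S] [Module.Flat S T] :
    IsFlatExactBaseChange A S T :=
  fun _ _ _ _ _ _ _ _ _ f _ hf _ _ _ => Module.Flat.lTensor_preserves_injective_linearMap f hf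

variable (k) in
/-- The cohomology of the localized fiber complex is the localization of the cohomology. -/
theorem fiberCohomology_localization_equiv [Algebra k T] (hd : ∀ i x, d (i + 1) (d i x) = 0) {N : ℕ}
    (hN : ∀ i, N < i → Subsingleton (K i)) (Q : Ideal T) [Q.IsPrime] (i : ℕ) :
    Nonempty ((Localization.AtPrime Q ⊗[T] cohomology (fun i => (d i).baseChange T) i)
      ≃ₗ[Localization.AtPrime Q]
        cohomology (fun i => (d i).baseChange (Localization.AtPrime Q)) i) := by
  have h1 := cohomology_baseChange_equiv (A := k) (S := T) (S' := Localization.AtPrime Q)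
    (K := fun i => T ⊗[S] K i) (d := fun i => (d i).baseChange T) (fun i x => ?_)
    (fun i => flatOver_of_field _) (N := N)
    (fun i hi => by have := hN i hi; infer_instance) isFlatExactBaseChange_of_flat i
    (fun j _ => flatOver_of_field _)
  · obtain ⟨e1⟩ := h1
    obtain ⟨e2⟩ := cohomology_equiv
      (d := fun i => ((d i).baseChange T).baseChange (Localization.AtPrime Q))
      (d' := fun i => (d i).baseChange (Localization.AtPrime Q))
      (fun i => TensorProduct.AlgebraTensorModule.cancelBaseChange S T (Localization.AtPrime Q)
        (Localization.AtPrime Q) (K i)) (fun i x => cancelBaseChange_baseChange (d i) x) i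
    exact ⟨e1.trans e2⟩
  · rw [← LinearMap.comp_apply, ← LinearMap.baseChange_comp,
      show d (i + 1) ∘ₗ d i = 0 from LinearMap.ext (hd i), LinearMap.baseChange_zero]; rfl

theorem subsingleton_of_localization_tensor (G : Type u) [AddCommGroup G] [Module T G]
    (h : ∀ (Q : Ideal T) [Q.IsMaximal], Subsingleton (Localization.AtPrime Q ⊗[T] G)) :
    Subsingleton G := by
  refine Module.subsingleton_of_localization_maximal (R := T) (fun P _ => LocalizedModule P.primeCompl G)
    (fun P _ => LocalizedModule.mkLinearMap P.primeCompl G) fun P hP => ?_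
  have := h P
  exact (LocalizedModule.equivTensorProduct P.primeCompl G).toEquiv.injective.subsingleton

end FiberCohomology

/-! ### Local analysis on one fiber. -/

section FlatResolution

/-- A bounded resolution `F` of an `A`-flat module by finitely generated projective `S`-modules. -/
structure IsFlatResolution (A : Type u) {S : Type u} [CommRing A] [CommRing S] [Algebra A S]
    {M F : ℕ → Type u} [∀ i, AddCommGroup (M i)] [∀ i, Module S (M i)]
    [∀ i, AddCommGroup (F i)] [∀ i, Module S (F i)]
    (ι : ∀ i, M (i + 1) →ₗ[S] F i) (π : ∀ i, F i →ₗ[S] M i) (N : ℕ) : Prop where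
  chain : IsSyzygyChain ι π
  flat : ∀ i, FlatOver A S (M i)
  proj : ∀ i, Module.Projective S (F i)
  finite : ∀ i, Module.Finite S (F i)
  bounded : ∀ i, N < i → Subsingleton (F i)

variable {A S R T B k : Type u} [CommRing A] [CommRing S] [Algebra A S] [CommRing R] [CommRing T]
  [CommRing B] [Algebra S R] [Algebra S T] [Field k] {M F : ℕ → Type u}
  [∀ i, AddCommGroup (M i)] [∀ i, Module S (M i)] [∀ i, AddCommGroup (F i)]
  [∀ i, Module S (F i)] {ι : ∀ i, M (i + 1) →ₗ[S] F i} {π : ∀ i, F i →ₗ[S] M i} {N : ℕ}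

theorem IsFlatResolution.dual_bounded (h : IsFlatResolution A ι π N) (i : ℕ) (hi : N < i) :
    Subsingleton (F i →ₗ[S] S) := by
  have := h.bounded i hi
  exact ⟨fun a b => by ext x; simp [Subsingleton.elim x 0]⟩

variable (k) in
theorem IsFlatResolution.ext_localization_equiv [Algebra k T] (h : IsFlatResolution A ι π N) (e : M 0 ≃ₗ[S] R)
    (hT : IsFlatExactBaseChange A S T) (Q : Ideal T) [Q.IsPrime] (i : ℕ) :
    Nonempty (ExtMod (Localization.AtPrime Q) (Localization.AtPrime Q ⊗[S] R)
        (Localization.AtPrime Q) i ≃ₗ[Localization.AtPrime Q]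
      (Localization.AtPrime Q ⊗[T]
        cohomology (fun i => (homDifferential ι π S i).baseChange T) i)) := by
  obtain ⟨e1⟩ := h.chain.ext_baseChange_equiv h.flat h.proj h.finite
    (hT.trans_flat (T' := Localization.AtPrime Q)) i
  obtain ⟨e2⟩ := fiberCohomology_localization_equiv k (T := T)
    (h.chain.homDifferential_comp S) h.dual_bounded Q i
  obtain ⟨e3⟩ := ExtMod.congr_left (N := Localization.AtPrime Q)
    (e.baseChange S (Localization.AtPrime Q)) i
  exact ⟨e3.trans (e1.trans e2.symm)⟩

/-- A prime of a quotient `B` of the fiber ring `T` is regular local for `B` as soon as the localized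
cohomology is concentrated in one degree and cyclic. -/
theorem IsFlatResolution.exists_hasInjectiveDimensionLE_localization [Algebra k T]
    (h : IsFlatResolution A ι π N)
    (e : M 0 ≃ₗ[S] R) (hT : IsFlatExactBaseChange A S T) {n : ℕ} (hTn : IsPolynomialLike T n)
    (hR : Function.Surjective (algebraMap S R)) (φ : T →+* B) (hφ : Function.Surjective φ)
    (hker : RingHom.ker φ = (RingHom.ker (algebraMap S R)).map (algebraMap S T)) (P : Ideal B)
    [P.IsPrime] {c : ℕ}
    (hc : ∀ i, i ≠ c → Subsingleton (Localization.AtPrime (P.comap φ) ⊗[T]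
        cohomology (fun i => (homDifferential ι π S i).baseChange T) i))
    (hcyc : IsCyclicModule (Localization.AtPrime (P.comap φ))
      (Localization.AtPrime (P.comap φ) ⊗[T]
        cohomology (fun i => (homDifferential ι π S i).baseChange T) c)) :
    ∃ r, HasInjectiveDimensionLE
      (ModuleCat.of (Localization.AtPrime P) (Localization.AtPrime P)) r := by
  have := hTn.noeth
  let Q := P.comap φ
  let R₀ := Localization.AtPrime Q
  have hS' : IsFlatExactBaseChange A S R₀ := hT.trans_flat (T' := R₀)
  obtain ⟨eB⟩ := localization_ringEquiv_tensor hR φ hφ hker P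
  have hext := h.ext_localization_equiv k e hT Q
  have hE (i : ℕ) (hi : i ≠ c) : Subsingleton (ExtMod R₀ (R₀ ⊗[S] R) R₀ i) := by
    obtain ⟨e'⟩ := hext i
    have := hc i hi
    exact e'.injective.subsingleton
  have hEc : IsCyclicModule R₀ (ExtMod R₀ (R₀ ⊗[S] R) R₀ c) := by
    obtain ⟨e'⟩ := hext c
    exact hcyc.of_surjective e'.symm.toLinearMap e'.symm.surjective
  obtain ⟨x, hx⟩ := hEc
  -- The generator of `Ext^c` has the same annihilator as `1` in the local ring: a scalar killing
  -- the only `Ext` kills the module by the homotopy argument, and the converse is functoriality.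
  -- Hence `Ext^c` is free of rank one over that ring.
  have hann (t : R₀) : t • x = 0 ↔ algebraMap R₀ (R₀ ⊗[S] R) t = 0 := by
    constructor
    · intro ht
      have h1 (i) := ExtMod.congr_left (N := R₀) (e.baseChange S R₀) i
      have h2 := h.chain.smul_eq_zero_of_ext_baseChange h.flat h.proj h.finite h.bounded hS'
        (c := c) (fun i hi => by
          obtain ⟨e'⟩ := h1 i
          have := hE i hi
          exact e'.symm.injective.subsingleton) t (fun y => by
          obtain ⟨e'⟩ := h1 c
          obtain ⟨y, rfl⟩ := e'.surjective y
          obtain ⟨a, rfl⟩ := hx y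
          rw [← map_smul, smul_smul, mul_comm, mul_smul, ht, smul_zero, map_zero])
        ((e.baseChange S R₀).symm 1)
      rw [← map_smul, LinearEquiv.map_eq_zero_iff] at h2
      rw [Algebra.algebraMap_eq_smul_one]
      exact h2
    · intro ht
      exact ExtMod.smul_eq_zero_of_left (fun m => (Algebra.smul_def t m).trans (by rw [ht, zero_mul])) x
  let f : R₀ →ₗ[R₀] ExtMod R₀ (R₀ ⊗[S] R) R₀ c := LinearMap.toSpanSingleton _ _ x
  let g : R₀ →ₗ[R₀] R₀ ⊗[S] R := Algebra.linearMap _ _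
  have hf : Function.Surjective f := fun y => by
    obtain ⟨a, rfl⟩ := hx y
    exact ⟨a, rfl⟩
  have hg : Function.Surjective g := surjective_algebraMap_tensor hR
  have hfg : LinearMap.ker f = LinearMap.ker g := by
    ext t
    exact hann t
  have hee := (f.quotKerEquivOfSurjective hf).symm.trans
    ((Submodule.quotEquivOfEq _ _ hfg).trans (g.quotKerEquivOfSurjective hg))
  obtain ⟨r, hr⟩ := exists_hasInjectiveDimensionLE_self_of_ext_equiv (B := R₀ ⊗[S] R) c
    (surjective_algebraMap_tensor hR) (hasInjectiveDimensionLE_localization Q.primeCompl hTn.injDim)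
    hE ⟨hee⟩
  exact ⟨r, hasInjectiveDimensionLE_self_of_ringEquiv eB.symm r hr⟩

/-- If all the `Ext` vanished, the scalar `1` would kill them and hence the nonzero local ring of
`B` at `P`. -/
theorem IsFlatResolution.not_forall_subsingleton [Algebra k T] (h : IsFlatResolution A ι π N)
    (e : M 0 ≃ₗ[S] R) (hT : IsFlatExactBaseChange A S T)
    (hR : Function.Surjective (algebraMap S R)) (φ : T →+* B) (hφ : Function.Surjective φ)
    (hker : RingHom.ker φ = (RingHom.ker (algebraMap S R)).map (algebraMap S T)) (P : Ideal B)
    [P.IsPrime] :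
    ¬ ∀ i, Subsingleton (Localization.AtPrime (P.comap φ) ⊗[T]
        cohomology (fun i => (homDifferential ι π S i).baseChange T) i) := by
  intro hc
  let Q := P.comap φ
  let R₀ := Localization.AtPrime Q
  obtain ⟨eB⟩ := localization_ringEquiv_tensor hR φ hφ hker P
  have hE (i : ℕ) : Subsingleton (ExtMod R₀ (R₀ ⊗[S] M 0) R₀ i) := by
    obtain ⟨e'⟩ := h.ext_localization_equiv k e hT Q i
    obtain ⟨e''⟩ := ExtMod.congr_left (N := R₀) (e.baseChange S R₀) i
    have := hc i
    exact (e''.symm.trans e').injective.subsingleton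
  have h2 := h.chain.smul_eq_zero_of_ext_baseChange h.flat h.proj h.finite h.bounded
    (hT.trans_flat (T' := R₀)) (c := 0) (fun i _ => hE i) 1
    (fun y => (hE 0).elim _ _) ((e.baseChange S R₀).symm 1)
  rw [one_smul, LinearEquiv.map_eq_zero_iff] at h2
  exact one_ne_zero (eB.injective (by rw [map_one, map_zero]; exact h2))

/-- The local theorem applies because `P.comap φ` is maximal: the localization there has its maximal
ideal generated by a regular sequence of length `n`. The bound `n` also makes the dimension of the
local ring of `B` a natural number. -/
theorem IsFlatResolution.exists_concentrated [Algebra k T] (h : IsFlatResolution A ι π N)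
    (e : M 0 ≃ₗ[S] R) (hT : IsFlatExactBaseChange A S T) {n : ℕ} (hTn : IsPolynomialLike T n)
    (hR : Function.Surjective (algebraMap S R)) (φ : T →+* B) (hφ : Function.Surjective φ)
    (hker : RingHom.ker φ = (RingHom.ker (algebraMap S R)).map (algebraMap S T)) (P : Ideal B)
    [P.IsMaximal]
    (hP : ∃ r, HasInjectiveDimensionLE
      (ModuleCat.of (Localization.AtPrime P) (Localization.AtPrime P)) r) :
    ∃ c D : ℕ, ringKrullDim (Localization.AtPrime P) = D ∧ c + D = n ∧
      (∀ i, i ≠ c → Subsingleton (Localization.AtPrime (P.comap φ) ⊗[T]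
        cohomology (fun i => (homDifferential ι π S i).baseChange T) i)) ∧
      IsCyclicModule (Localization.AtPrime (P.comap φ))
        (Localization.AtPrime (P.comap φ) ⊗[T]
          cohomology (fun i => (homDifferential ι π S i).baseChange T) c) := by
  have := hTn.noeth
  have hQ : (P.comap φ).IsMaximal := Ideal.comap_isMaximal_of_surjective φ hφ
  let Q := P.comap φ
  let R₀ := Localization.AtPrime Q
  obtain ⟨eB⟩ := localization_ringEquiv_tensor hR φ hφ hker P
  have hloc : IsLocalRing (R₀ ⊗[S] R) := eB.isLocalRing
  obtain ⟨r, hr⟩ := hP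
  obtain ⟨rs, hlen, hrs, hm⟩ := hTn.exists_isRegular Q
  have hsurj : Function.Surjective (algebraMap R₀ (R₀ ⊗[S] R)) := surjective_algebraMap_tensor hR
  have hdim0 := hTn.ringKrullDim_localization_le Q
  have hle : ringKrullDim (Localization.AtPrime P) ≤ n := by
    rw [ringKrullDim_eq_of_ringEquiv eB]
    exact (ringKrullDim_le_of_surjective _ hsurj).trans hdim0
  obtain ⟨D, hD⟩ : ∃ D : ℕ, ringKrullDim (Localization.AtPrime P) = D := by
    obtain ⟨a, ha⟩ := WithBot.ne_bot_iff_exists.mp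
      (fun h' => not_le.mpr (WithBot.bot_lt_coe (0 : ℕ∞))
        (h' ▸ ringKrullDim_nonneg_of_nontrivial (R := Localization.AtPrime P)))
    rw [← ha] at hle ⊢
    have han : a ≤ n := WithBot.coe_le_coe.mp hle
    obtain ⟨D, rfl⟩ := ENat.ne_top_iff_exists.mp (ne_top_of_le_ne_top (ENat.natCast_ne_top n) han)
    exact ⟨D, rfl⟩
  obtain ⟨c, hcD, hc, hcyc⟩ := ext_concentrated_of_hasInjectiveDimensionLE
    (hasInjectiveDimensionLE_localization Q.primeCompl hTn.injDim) hrs hlen hm hdim0 D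
    (R₀ ⊗[S] R) hsurj (by rw [← ringKrullDim_eq_of_ringEquiv eB, hD])
    ⟨r, hasInjectiveDimensionLE_self_of_ringEquiv eB r hr⟩
  have hext := h.ext_localization_equiv k e hT Q
  refine ⟨c, D, hD, hcD, fun i hi => ?_, ?_⟩
  · obtain ⟨e'⟩ := hext i
    have := hc i hi
    exact e'.symm.injective.subsingleton
  · obtain ⟨e'⟩ := hext c
    exact hcyc.of_surjective e'.toLinearMap e'.surjective

end FlatResolution

/-! ### Graded algebras over a field: connectedness and growth. -/

section GradedAlgebra

open DirectSum

variable {k B : Type*} [Field k] [CommRing B] [Algebra k B] (𝓑 : ℕ → Submodule k B)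

/-- Sum of homogeneous elements of degrees at most `N`. -/
def gradedSum (N : ℕ) : (∀ d : Fin (N + 1), 𝓑 d) →ₗ[k] B :=
  ∑ d : Fin (N + 1), (𝓑 d).subtype ∘ₗ LinearMap.proj d

theorem gradedSum_apply (N : ℕ) (x : ∀ d : Fin (N + 1), 𝓑 d) :
    gradedSum 𝓑 N x = ∑ d, (x d : B) := by
  simp [gradedSum]

variable [GradedAlgebra 𝓑]

/-- The elements of a graded algebra with components in degrees at least `N` only. -/
def gradedFrom (N : ℕ) : Submodule k B where
  carrier := {x | ∀ j < N, (decompose 𝓑 x j : B) = 0}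
  add_mem' hx hy j hj := by simp [hx j hj, hy j hj]
  zero_mem' j _ := by simp
  smul_mem' c x hx j hj := by
    rw [decompose_smul, DirectSum.smul_apply, Submodule.coe_smul, hx j hj, smul_zero]

/-- The elements of a graded algebra with components in degrees at most `N` only. -/
def gradedUpTo (N : ℕ) : Submodule k B where
  carrier := {x | ∀ j, N < j → (decompose 𝓑 x j : B) = 0}
  add_mem' hx hy j hj := by simp [hx j hj, hy j hj]
  zero_mem' j _ := by simp
  smul_mem' c x hx j hj := by
    rw [decompose_smul, DirectSum.smul_apply, Submodule.coe_smul, hx j hj, smul_zero]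

variable {𝓑}

theorem mul_mem_gradedFrom {a b : ℕ} {x y : B} (hx : x ∈ gradedFrom 𝓑 a)
    (hy : y ∈ gradedFrom 𝓑 b) : x * y ∈ gradedFrom 𝓑 (a + b) := by
  intro j hj
  rw [decompose_mul, coe_mul_apply_eq_sum_antidiagonal]
  refine Finset.sum_eq_zero fun ij hij => ?_
  rw [Finset.HasAntidiagonal.mem_antidiagonal] at hij
  rcases lt_or_ge ij.1 a with h | h
  · rw [hx _ h, zero_mul]
  · rw [hy _ (by omega), mul_zero]

theorem mul_mem_gradedUpTo {a b : ℕ} {x y : B} (hx : x ∈ gradedUpTo 𝓑 a)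
    (hy : y ∈ gradedUpTo 𝓑 b) : x * y ∈ gradedUpTo 𝓑 (a + b) := by
  intro j hj
  rw [decompose_mul, coe_mul_apply_eq_sum_antidiagonal]
  refine Finset.sum_eq_zero fun ij hij => ?_
  rw [Finset.HasAntidiagonal.mem_antidiagonal] at hij
  rcases lt_or_ge a ij.1 with h | h
  · rw [hx _ h, zero_mul]
  · rw [hy _ (by omega), mul_zero]

theorem one_mem_gradedUpTo (N : ℕ) : (1 : B) ∈ gradedUpTo 𝓑 N := fun j hj =>
  decompose_of_mem_ne 𝓑 SetLike.GradedOne.one_mem (by omega)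

theorem gradedUpTo_mono {a b : ℕ} (h : a ≤ b) : gradedUpTo 𝓑 a ≤ gradedUpTo 𝓑 b :=
  fun _ hx j hj => hx j (h.trans_lt hj)

theorem exists_mem_gradedUpTo (x : B) : ∃ N, x ∈ gradedUpTo 𝓑 N := by
  classical
  refine ⟨(decompose 𝓑 x).support.sup id, fun j hj => ?_⟩
  by_contra h
  have h1 : j ∈ (decompose 𝓑 x).support := by
    rw [DFinsupp.mem_support_iff]
    exact fun h' => h (by rw [h']; rfl)
  exact absurd (Finset.le_sup (f := id) h1) (by simpa using hj)

theorem pow_mem_gradedUpTo {a : ℕ} {x : B} (hx : x ∈ gradedUpTo 𝓑 a) (m : ℕ) :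
    x ^ m ∈ gradedUpTo 𝓑 (m * a) := by
  induction m with
  | zero => simpa using one_mem_gradedUpTo 0
  | succ m ih => rw [pow_succ, Nat.succ_mul]; exact mul_mem_gradedUpTo ih hx

theorem prod_mem_gradedUpTo {σ : Type*} (s : Finset σ) (f : σ → B) (a : σ → ℕ)
    (h : ∀ i, f i ∈ gradedUpTo 𝓑 (a i)) : ∏ i ∈ s, f i ∈ gradedUpTo 𝓑 (∑ i ∈ s, a i) := by
  classical
  induction s using Finset.induction_on with
  | empty => simpa using one_mem_gradedUpTo 0
  | insert i s hi ih =>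
    rw [Finset.prod_insert hi, Finset.sum_insert hi]
    exact mul_mem_gradedUpTo (h i) ih

/-- Since `f` equals all its positive powers, its components live in degrees at least `N` for every
`N`. -/
theorem eq_zero_of_isIdempotentElem_of_mem_gradedFrom {f : B} (hf : IsIdempotentElem f)
    (h : f ∈ gradedFrom 𝓑 1) : f = 0 := by
  have hN (N : ℕ) : f ∈ gradedFrom 𝓑 N := by
    induction N with
    | zero => exact fun j hj => absurd hj (by omega)
    | succ N ih =>
      rw [← hf.eq]
      exact mul_mem_gradedFrom ih h
  refine (decompose 𝓑).injective ?_
  rw [decompose_zero]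
  ext j
  exact hN (j + 1) j (by omega)

/-- The degree zero component of `f` is an idempotent of the field, so `f` or `1 - f` has only
components of positive degree. -/
theorem eq_zero_or_one_of_isIdempotentElem_of_graded
    (h0 : ∀ x ∈ 𝓑 0, x ∈ (algebraMap k B).range) {f : B} (hf : IsIdempotentElem f) :
    f = 0 ∨ f = 1 := by
  nontriviality B
  obtain ⟨c, hc⟩ := h0 _ (decompose 𝓑 f 0).2
  have hidem : IsIdempotentElem c := by
    refine (algebraMap k B).injective ?_
    rw [map_mul, hc]
    have := congrArg (GradedRing.projZeroRingHom 𝓑) hf.eq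
    rw [map_mul] at this
    simpa using this
  rcases IsIdempotentElem.iff_eq_zero_or_one.mp hidem with rfl | rfl
  · left
    refine eq_zero_of_isIdempotentElem_of_mem_gradedFrom (𝓑 := 𝓑) hf fun j hj => ?_
    obtain rfl : j = 0 := by omega
    rw [← hc, map_zero]
  · right
    have := eq_zero_of_isIdempotentElem_of_mem_gradedFrom (𝓑 := 𝓑) hf.one_sub fun j hj => by
      obtain rfl : j = 0 := by omega
      rw [decompose_sub, DirectSum.sub_apply, Submodule.coe_sub, ← hc, (algebraMap k B).map_one,
        decompose_of_mem_same 𝓑 SetLike.GradedOne.one_mem, sub_self]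
    exact (sub_eq_zero.mp this).symm

/-- The spectrum of a positively graded algebra over a field is connected. -/
theorem preconnectedSpace_of_graded (h0 : ∀ x ∈ 𝓑 0, x ∈ (algebraMap k B).range) :
    PreconnectedSpace (PrimeSpectrum B) := by
  rw [preconnectedSpace_iff_clopen]
  intro s hs
  obtain ⟨f, hf, rfl⟩ := PrimeSpectrum.exists_idempotent_basicOpen_eq_of_isClopen hs
  rcases eq_zero_or_one_of_isIdempotentElem_of_graded h0 hf with rfl | rfl
  · left; simp
  · right; simp

theorem decompose_gradedSum (N : ℕ) (x : ∀ d : Fin (N + 1), 𝓑 d) (j : Fin (N + 1)) :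
    (decompose 𝓑 (gradedSum 𝓑 N x) j : B) = x j := by
  rw [gradedSum_apply, decompose_sum, DFinsupp.finsetSum_apply, AddSubmonoidClass.coe_finsetSum,
    Finset.sum_eq_single j]
  · rw [decompose_of_mem_same 𝓑 (x j).2]
  · intro i _ hij
    exact decompose_of_mem_ne 𝓑 (x i).2 (fun h => hij (Fin.ext h))
  · simp

theorem gradedSum_injective (N : ℕ) : Function.Injective (gradedSum 𝓑 N) := by
  intro x y h
  ext j
  rw [← decompose_gradedSum, h, decompose_gradedSum]

theorem range_gradedSum (N : ℕ) : LinearMap.range (gradedSum 𝓑 N) = gradedUpTo 𝓑 N := by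
  classical
  refine le_antisymm ?_ fun x hx => ⟨fun d => decompose 𝓑 x d, ?_⟩
  · rintro _ ⟨x, rfl⟩
    rw [gradedSum_apply]
    refine Submodule.sum_mem _ fun d _ j hj => decompose_of_mem_ne 𝓑 (x d).2 ?_
    have := d.2
    omega
  · rw [gradedSum_apply, Fin.sum_univ_eq_sum_range (fun d => (decompose 𝓑 x d : B))]
    conv_rhs => rw [← sum_support_decompose 𝓑 x]
    symm
    refine Finset.sum_subset (fun j hj => ?_) fun j _ hj => ?_
    · rw [Finset.mem_range]
      by_contra h
      rw [DFinsupp.mem_support_iff] at hj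
      exact hj (Subtype.ext (hx j (by omega)))
    · rw [DFinsupp.notMem_support_iff.mp hj]
      rfl

instance [∀ d, Module.Finite k (𝓑 d)] (N : ℕ) : Module.Finite k (gradedUpTo 𝓑 N) := by
  rw [← range_gradedSum]
  infer_instance

theorem finrank_gradedUpTo [∀ d, Module.Finite k (𝓑 d)] (N : ℕ) :
    Module.finrank k (gradedUpTo 𝓑 N) = ∑ d : Fin (N + 1), Module.finrank k (𝓑 d) := by
  rw [← range_gradedSum, LinearMap.finrank_range_of_inj (gradedSum_injective N),
    Module.finrank_pi_fintype]

/-- If `a` is the sum of degree bounds for the images of the variables, the `(N + 1)^e` monomials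
with exponents at most `N` give independent elements of degree at most `a N`. -/
theorem exists_pow_le_finrank_gradedUpTo [∀ d, Module.Finite k (𝓑 d)] {e : ℕ}
    (g : MvPolynomial (Fin e) k →ₐ[k] B) (hg : Function.Injective g) :
    ∃ a : ℕ, ∀ N : ℕ, (N + 1) ^ e ≤ Module.finrank k (gradedUpTo 𝓑 (a * N)) := by
  choose b hb using fun j => exists_mem_gradedUpTo (𝓑 := 𝓑) (g (MvPolynomial.X j))
  refine ⟨∑ j, b j, fun N => ?_⟩
  have hmem (α : Fin e → Fin (N + 1)) : g (MvPolynomial.monomial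
      (Finsupp.equivFunOnFinite.symm fun j => (α j : ℕ)) 1) ∈ gradedUpTo 𝓑 ((∑ j, b j) * N) := by
    rw [MvPolynomial.monomial_eq, map_one, one_mul, Finsupp.prod_fintype _ _ (by simp), map_prod]
    refine gradedUpTo_mono ?_ (prod_mem_gradedUpTo Finset.univ _ (fun j => (α j : ℕ) * b j)
      fun j => ?_)
    · rw [Finset.sum_mul]
      refine Finset.sum_le_sum fun j _ => ?_
      rw [mul_comm]
      exact Nat.mul_le_mul_left _ (by have := (α j).2; omega)
    · rw [map_pow]
      exact pow_mem_gradedUpTo (hb j) _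
  have hli : LinearIndependent k (fun α : Fin e → Fin (N + 1) =>
      (⟨_, hmem α⟩ : gradedUpTo 𝓑 ((∑ j, b j) * N))) := by
    refine LinearIndependent.of_comp (gradedUpTo 𝓑 ((∑ j, b j) * N)).subtype ?_
    have h1 := (MvPolynomial.basisMonomials (Fin e) k).linearIndependent.map' g.toLinearMap
      (LinearMap.ker_eq_bot.mpr hg)
    have h2 := h1.comp (fun α : Fin e → Fin (N + 1) =>
      Finsupp.equivFunOnFinite.symm fun j => (α j : ℕ)) (fun α β h => by
        have := Finsupp.equivFunOnFinite.symm.injective h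
        funext j
        exact Fin.ext (congrFun this j))
    have h3 : (g.toLinearMap ∘ MvPolynomial.basisMonomials (Fin e) k) ∘
        (fun α : Fin e → Fin (N + 1) => Finsupp.equivFunOnFinite.symm fun j => (α j : ℕ)) =
        (gradedUpTo 𝓑 ((∑ j, b j) * N)).subtype ∘ fun α => ⟨_, hmem α⟩ := by
      funext α
      simp
    rw [h3] at h2
    exact h2
  have := hli.fintype_card_le_finrank
  simpa using this

end GradedAlgebra

/-! ### Krull dimension of integral extensions. -/

section IntegralDimension

variable {P B : Type*} [CommRing P] [CommRing B] [Algebra P B] [Algebra.IsIntegral P B]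

theorem exists_le_height_over_of_isIntegral (hinj : Function.Injective (algebraMap P B)) (m : ℕ) :
    ∀ p : PrimeSpectrum P, (m : ℕ∞) ≤ Order.height p →
      ∃ q : PrimeSpectrum B, PrimeSpectrum.comap (algebraMap P B) q = p ∧
        (m : ℕ∞) ≤ Order.height q := by
  induction m with
  | zero =>
    intro p _
    obtain ⟨Q, -, hQ, hQp⟩ := Ideal.exists_ideal_over_prime_of_isIntegral (S := B) p.asIdeal ⊥ (by
      rw [← RingHom.ker_eq_comap_bot, (RingHom.injective_iff_ker_eq_bot _).mp hinj]
      exact bot_le)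
    exact ⟨⟨Q, hQ⟩, PrimeSpectrum.ext hQp, by simp⟩
  | succ m ih =>
    intro p hp
    obtain ⟨l, hl, hlen⟩ := Order.exists_series_of_le_height p hp
    have hlt : l ⟨m, by omega⟩ < p := by
      rw [← hl]
      exact l.rel_of_lt (by rw [Fin.lt_def]; simp [hlen])
    have hm : (m : ℕ∞) ≤ Order.height (l ⟨m, by omega⟩) := by
      simpa using Order.index_le_height l ⟨m, by omega⟩
    obtain ⟨q, hq, hqm⟩ := ih _ hm
    obtain ⟨Q, hqQ, hQ, hQp⟩ := Ideal.exists_ideal_over_prime_of_isIntegral p.asIdeal q.asIdeal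
      (by rw [← PrimeSpectrum.comap_asIdeal, hq]; exact hlt.le)
    refine ⟨⟨Q, hQ⟩, PrimeSpectrum.ext hQp, ?_⟩
    have hqQ' : q < ⟨Q, hQ⟩ := by
      refine lt_of_le_of_ne hqQ fun h => ?_
      have : PrimeSpectrum.comap (algebraMap P B) q = p := by
        rw [h]
        exact PrimeSpectrum.ext hQp
      exact hlt.ne (hq.symm.trans this)
    rw [Nat.cast_succ]
    exact (add_le_add_left hqm 1).trans (Order.height_add_one_le hqQ')

/-- Incomparability bounds the dimension of `B` from above; lying over and going up lift chains of
primes and bound it from below. Infinite height is handled through its finite lower bounds. -/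
theorem ringKrullDim_eq_of_isIntegral (hinj : Function.Injective (algebraMap P B)) :
    ringKrullDim B = ringKrullDim P := by
  refine le_antisymm (Order.krullDim_le_of_strictMono (PrimeSpectrum.comap (algebraMap P B))
    fun a b hab => Ideal.IsIntegral.comap_lt_comap hab) ?_
  unfold ringKrullDim
  rw [Order.krullDim_eq_iSup_height, Order.krullDim_eq_iSup_height]
  refine iSup_le fun p => ?_
  by_cases htop : Order.height p = ⊤
  · have h1 (m : ℕ) : (m : WithBot ℕ∞) ≤ ⨆ a : PrimeSpectrum B, (Order.height a : WithBot ℕ∞) := by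
      obtain ⟨q, -, hq⟩ := exists_le_height_over_of_isIntegral hinj m p (by simp [htop])
      exact le_iSup_of_le q (WithBot.coe_le_coe.mpr hq)
    rw [htop]
    generalize (⨆ a : PrimeSpectrum B, (Order.height a : WithBot ℕ∞)) = s at h1
    cases s with
    | bot => exact absurd (h1 0) (by simp)
    | coe s =>
      rw [WithBot.coe_le_coe, top_le_iff]
      exact ENat.eq_top_iff_forall_ge.mpr fun m => WithBot.coe_le_coe.mp (h1 m)
  · obtain ⟨m, hm⟩ := ENat.ne_top_iff_exists.mp htop
    obtain ⟨q, -, hq⟩ := exists_le_height_over_of_isIntegral hinj m p hm.le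
    rw [← hm]
    exact le_iSup_of_le q (WithBot.coe_le_coe.mpr hq)

end IntegralDimension

/-! ### Upper growth bound from Noether normalization. -/

section Growth

variable {k B : Type*} [Field k] [CommRing B] [Algebra k B] {e r : ℕ}
  [Algebra (MvPolynomial (Fin e) k) B] [IsScalarTower k (MvPolynomial (Fin e) k) B]

/-- Combinations of the family `b` with polynomial coefficients of degree at most `D` in each
variable. -/
def boundedCombination (b : Fin r → B) (D : ℕ) :
    (Fin r → MvPolynomial.restrictDegree (Fin e) k D) →ₗ[k] B :=
  ((Fintype.linearCombination (MvPolynomial (Fin e) k) b).restrictScalars k) ∘ₗ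
    (MvPolynomial.restrictDegree (Fin e) k D).subtype.compLeft (Fin r)

theorem boundedCombination_apply (b : Fin r → B) (D : ℕ)
    (p : Fin r → MvPolynomial.restrictDegree (Fin e) k D) :
    boundedCombination b D p = ∑ l, (p l : MvPolynomial (Fin e) k) • b l := rfl

theorem MvPolynomial.finite_finrank_restrictDegree_le (k : Type*) [Field k] (e D : ℕ) :
    Module.Finite k (MvPolynomial.restrictDegree (Fin e) k D) ∧
      Module.finrank k (MvPolynomial.restrictDegree (Fin e) k D) ≤ (D + 1) ^ e := by
  let s : Set (Fin e →₀ ℕ) := {n | ∀ i, n i ≤ D}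
  let f : s → (Fin e → Fin (D + 1)) := fun x i => ⟨x.1 i, Nat.lt_succ_of_le (x.2 i)⟩
  have hf : Function.Injective f := fun x y h => by
    refine Subtype.ext (Finsupp.ext fun i => ?_)
    exact congrArg Fin.val (congrFun h i)
  have := Finite.of_injective f hf
  have := Fintype.ofFinite s
  let β : Module.Basis s k (MvPolynomial.restrictDegree (Fin e) k D) :=
    MvPolynomial.basisRestrictSupport k s
  refine ⟨Module.Finite.of_basis β, ?_⟩
  rw [Module.finrank_eq_card_basis β]
  exact (Fintype.card_le_of_injective f hf).trans (by simp)

theorem MvPolynomial.mul_mem_restrictDegree {k : Type*} [Field k] {e a b : ℕ}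
    {p q : MvPolynomial (Fin e) k} (hp : p ∈ MvPolynomial.restrictDegree (Fin e) k a)
    (hq : q ∈ MvPolynomial.restrictDegree (Fin e) k b) :
    p * q ∈ MvPolynomial.restrictDegree (Fin e) k (a + b) := by
  classical
  rw [MvPolynomial.mem_restrictDegree] at *
  intro s hs i
  obtain ⟨x, hx, y, hy, rfl⟩ := Finset.mem_add.mp (MvPolynomial.support_mul p q hs)
  exact add_le_add (hp x hx i) (hq y hy i)

theorem MvPolynomial.restrictDegree_mono {k : Type*} [Field k] {e a b : ℕ} (h : a ≤ b) :
    MvPolynomial.restrictDegree (Fin e) k a ≤ MvPolynomial.restrictDegree (Fin e) k b :=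
  MvPolynomial.restrictSupport_mono k fun _ hx i => (hx i).trans h

theorem range_boundedCombination_mono (b : Fin r → B) {D D' : ℕ} (h : D ≤ D') :
    LinearMap.range (boundedCombination (k := k) (e := e) b D) ≤
      LinearMap.range (boundedCombination (k := k) (e := e) b D') := by
  rintro _ ⟨p, rfl⟩
  exact ⟨fun l => ⟨p l, MvPolynomial.restrictDegree_mono h (p l).2⟩, rfl⟩

theorem smul_mem_range_boundedCombination {b : Fin r → B} {D D' : ℕ} {x : B}
    {q : MvPolynomial (Fin e) k} (hq : q ∈ MvPolynomial.restrictDegree (Fin e) k D)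
    (hx : x ∈ LinearMap.range (boundedCombination (k := k) (e := e) b D')) :
    q • x ∈ LinearMap.range (boundedCombination (k := k) (e := e) b (D + D')) := by
  obtain ⟨p, rfl⟩ := hx
  refine ⟨fun l => ⟨q * p l, MvPolynomial.mul_mem_restrictDegree hq (p l).2⟩, ?_⟩
  rw [boundedCombination_apply, boundedCombination_apply, Finset.smul_sum]
  exact Finset.sum_congr rfl fun l _ => mul_smul _ _ _

theorem exists_mem_range_boundedCombination {b : Fin r → B}
    (hb : Submodule.span (MvPolynomial (Fin e) k) (Set.range b) = ⊤) (x : B) :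
    ∃ D, x ∈ LinearMap.range (boundedCombination (k := k) (e := e) b D) := by
  have hx : x ∈ Submodule.span (MvPolynomial (Fin e) k) (Set.range b) := hb ▸ Submodule.mem_top
  obtain ⟨p, rfl⟩ := (Submodule.mem_span_range_iff_exists_fun _).mp hx
  refine ⟨∑ l, (p l).totalDegree, fun l => ⟨p l,
    MvPolynomial.restrictTotalDegree_le_restrictDegree _ k _
      ((MvPolynomial.mem_restrictTotalDegree _ _ _).mpr ?_)⟩, rfl⟩
  exact Finset.single_le_sum (f := fun l => (p l).totalDegree) (fun _ _ => Nat.zero_le _)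
    (Finset.mem_univ l)

theorem exists_forall_le_range_boundedCombination {b : Fin r → B}
    (hb : Submodule.span (MvPolynomial (Fin e) k) (Set.range b) = ⊤) {W : Submodule k B}
    (hW : W.FG) :
    ∃ D, W ≤ LinearMap.range (boundedCombination (k := k) (e := e) b D) := by
  obtain ⟨s, rfl⟩ := hW
  choose D hD using exists_mem_range_boundedCombination (k := k) hb
  refine ⟨s.sup D, Submodule.span_le.mpr fun x hx => ?_⟩
  exact range_boundedCombination_mono b (Finset.le_sup hx) (hD x)

theorem exists_finrank_pow_le (hfin : Module.Finite (MvPolynomial (Fin e) k) B)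
    {W : Submodule k B} (hW : W.FG) :
    ∃ r C : ℕ, ∀ N, Module.finrank k ↥(W ^ N) ≤ r * (C * (N + 1) + 1) ^ e := by
  obtain ⟨r, b, hb⟩ := Module.Finite.exists_fin (R := MvPolynomial (Fin e) k) (M := B)
  let V : Submodule k B := Submodule.span k (Set.range b)
  have hV : V.FG := Submodule.fg_span (Set.finite_range b)
  obtain ⟨D1, hD1⟩ := exists_forall_le_range_boundedCombination (k := k) hb (hW.mul hV)
  obtain ⟨D2, hD2⟩ := exists_mem_range_boundedCombination (k := k) hb (1 : B)
  let C := max D1 D2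
  -- Multiplying a module generator by an element of `W` gives coefficients of degree at most `C`,
  -- so each factor of `W` raises the degree bound by at most `C`.
  have hmul (D : ℕ) : W * LinearMap.range (boundedCombination (k := k) (e := e) b D) ≤
      LinearMap.range (boundedCombination (k := k) (e := e) b (D + C)) := by
    rw [Submodule.mul_le]
    rintro w hw _ ⟨p, rfl⟩
    rw [boundedCombination_apply, Finset.mul_sum]
    refine Submodule.sum_mem _ fun l _ => ?_
    rw [mul_smul_comm]
    exact smul_mem_range_boundedCombination (p l).2 (range_boundedCombination_mono b
      (le_max_left D1 D2) (hD1 (Submodule.mul_mem_mul hw (Submodule.subset_span ⟨l, rfl⟩))))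
  have hpow (N : ℕ) : W ^ N ≤
      LinearMap.range (boundedCombination (k := k) (e := e) b (C * (N + 1))) := by
    induction N with
    | zero =>
      rw [pow_zero, Submodule.one_le]
      exact range_boundedCombination_mono b (by simp [C]) hD2
    | succ N ih =>
      rw [pow_succ']
      exact (mul_le_mul_right ih W).trans (hmul _)
  refine ⟨r, C, fun N => ?_⟩
  have := (MvPolynomial.finite_finrank_restrictDegree_le k e (C * (N + 1))).1
  refine (Submodule.finrank_mono (hpow N)).trans ((LinearMap.finrank_range_le _).trans ?_)
  rw [Module.finrank_pi_fintype]
  refine (Finset.sum_le_card_nsmul _ _ _ fun _ _ =>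
    (MvPolynomial.finite_finrank_restrictDegree_le k e (C * (N + 1))).2).trans ?_
  simp

end Growth

theorem le_of_forall_pow_le {e e' r C a : ℕ}
    (h : ∀ N : ℕ, (N + 1) ^ e' ≤ r * (C * (a * N + 1) + 1) ^ e) : e' ≤ e := by
  by_contra! hlt
  let K := C * (a + 1) + 1
  have h1 (N : ℕ) : (N + 1) ^ e' ≤ r * K ^ e * (N + 1) ^ e := by
    refine (h N).trans ?_
    rw [mul_assoc, ← mul_pow]
    refine Nat.mul_le_mul_left _ (Nat.pow_le_pow_left ?_ _)
    simp only [K]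
    nlinarith [Nat.zero_le (C * a), Nat.zero_le (C * N), Nat.zero_le N]
  -- For `N = r K^e` the bound would give `(N + 1)^(e + 1) ≤ N (N + 1)^e`, which is impossible.
  have h2 := h1 (r * K ^ e)
  have h3 : (r * K ^ e + 1) ^ (e + 1) ≤ (r * K ^ e + 1) ^ e' :=
    Nat.pow_le_pow_right (by omega) hlt
  have h4 := h3.trans h2
  rw [pow_succ'] at h4
  have := Nat.le_of_mul_le_mul_right h4 (by positivity)
  omega

/-! ### The Hilbert function controls the Krull dimension. -/

section DimensionComparison

variable {k B k' B' : Type*} [Field k] [CommRing B] [Algebra k B] [Field k'] [CommRing B']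
  [Algebra k' B'] (𝓑 : ℕ → Submodule k B) [GradedAlgebra 𝓑] (𝓑' : ℕ → Submodule k' B')
  [GradedAlgebra 𝓑']

/-- The Hilbert function of a graded algebra over a field bounds its Krull dimension. -/
theorem ringKrullDim_le_of_finrank_eq [Nontrivial B] [Nontrivial B'] [Algebra.FiniteType k B]
    [Algebra.FiniteType k' B'] [∀ d, Module.Finite k (𝓑 d)] [∀ d, Module.Finite k' (𝓑' d)]
    (hrank : ∀ d, Module.finrank k (𝓑 d) = Module.finrank k' (𝓑' d)) {W : Submodule k B}
    (hW : W.FG) (h1 : 1 ≤ W) (hgen : ∀ d, 𝓑 d ≤ W ^ d) :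
    ringKrullDim B' ≤ ringKrullDim B := by
  obtain ⟨e, g, hg, hgf⟩ := exists_finite_inj_algHom_of_fg k B
  obtain ⟨e', g', hg', hgf'⟩ := exists_finite_inj_algHom_of_fg k' B'
  let := g.toRingHom.toAlgebra
  let := g'.toRingHom.toAlgebra
  have : IsScalarTower k (MvPolynomial (Fin e) k) B := .of_algebraMap_eq' g.comp_algebraMap.symm
  have hfin : Module.Finite (MvPolynomial (Fin e) k) B := hgf
  have hfin' : Module.Finite (MvPolynomial (Fin e') k') B' := hgf'
  have hd : ringKrullDim B = e := by
    rw [ringKrullDim_eq_of_isIntegral (P := MvPolynomial (Fin e) k) hg,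
      MvPolynomial.ringKrullDim_of_isNoetherianRing]
    simp
  have hd' : ringKrullDim B' = e' := by
    rw [ringKrullDim_eq_of_isIntegral (P := MvPolynomial (Fin e') k') hg',
      MvPolynomial.ringKrullDim_of_isNoetherianRing]
    simp
  rw [hd, hd']
  obtain ⟨a, ha⟩ := exists_pow_le_finrank_gradedUpTo (𝓑 := 𝓑') g' hg'
  obtain ⟨r, C, hC⟩ := exists_finrank_pow_le hfin hW
  -- The part of degree at most `a N` has the same dimension in both algebras: for `B'` it is at
  -- least `(N + 1)^e'`, for `B` it lies in `W^(a N)`, whose dimension is at most polynomial of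
  -- degree `e` in `N`.
  refine Nat.cast_le.mpr (le_of_forall_pow_le (r := r) (C := C) (a := a) fun N =>
    (ha N).trans (le_trans ?_ (hC (a * N))))
  rw [finrank_gradedUpTo]
  simp_rw [← hrank]
  rw [← finrank_gradedUpTo]
  have : Module.Finite k ↥(W ^ (a * N)) := Module.Finite.iff_fg.mpr (hW.pow _)
  refine Submodule.finrank_mono ?_
  rw [← range_gradedSum]
  rintro _ ⟨x, rfl⟩
  rw [gradedSum_apply]
  exact Submodule.sum_mem _ fun d _ =>
    pow_le_pow_right₀ h1 (Nat.le_of_lt_succ d.2) (hgen d (x d).2)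

end DimensionComparison

/-! ### Graded algebras over `A` and the dimension of their fibers. -/

section GradedOver

open DirectSum

variable {A R : Type u} [CommRing A] [CommRing R] [Algebra A R] (𝓡 : ℕ → Submodule A R)
  [GradedAlgebra 𝓡]

theorem flat_of_graded [Module.Flat A R] (d : ℕ) : Module.Flat A (𝓡 d) :=
  Module.Flat.directSum_iff.mp (Module.Flat.of_linearEquiv (decomposeLinearEquiv 𝓡).symm) d

section Generation

variable {n : ℕ} {δ : Fin n → ℕ} [Algebra (MvPolynomial (Fin n) A) R]

variable (A R n) in
/-- The span of `1` and the algebra generators. -/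
def generatorSpan : Submodule A R :=
  Submodule.span A (insert 1 (Set.range fun i : Fin n =>
    algebraMap (MvPolynomial (Fin n) A) R (MvPolynomial.X i)))


theorem generatorSpan_fg : (generatorSpan A R n).FG :=
  Submodule.fg_span ((Set.finite_range _).insert 1)

theorem one_le_generatorSpan : 1 ≤ generatorSpan A R n :=
  Submodule.one_le.mpr (Submodule.subset_span (Set.mem_insert _ _))

variable [IsScalarTower A (MvPolynomial (Fin n) A) R]

/-- All weights are at least `1`, so the ordinary degree of a monomial is at most its weight; as `1`
lies in the span, the powers increase. -/
theorem algebraMap_monomial_mem_generatorSpan_pow (hδ : ∀ i, 0 < δ i)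
    (m : Fin n →₀ ℕ) (a : A) :
    algebraMap (MvPolynomial (Fin n) A) R (MvPolynomial.monomial m a) ∈
      generatorSpan A R n ^ (Finsupp.weight δ m) := by
  have hle : ∑ i, m i ≤ Finsupp.weight δ m := by
    rw [Finsupp.weight_apply, Finsupp.sum_fintype _ _ (by simp)]
    exact Finset.sum_le_sum fun i _ => Nat.le_mul_of_pos_right _ (hδ i)
  refine pow_le_pow_right₀ one_le_generatorSpan hle ?_
  rw [MvPolynomial.monomial_eq, map_mul, ← MvPolynomial.algebraMap_eq,
    ← IsScalarTower.algebraMap_apply, ← Algebra.smul_def, Finsupp.prod_fintype _ _ (by simp),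
    map_prod, ← Finset.prod_pow_eq_pow_sum]
  refine Submodule.smul_mem _ _ ?_
  generalize (Finset.univ : Finset (Fin n)) = s
  induction s using Finset.induction_on with
  | empty => exact Submodule.one_le.mp le_rfl
  | insert i s hi ih =>
    rw [Finset.prod_insert hi, Finset.prod_insert hi, map_pow]
    exact Submodule.mul_mem_mul (Submodule.pow_mem_pow _
      (Submodule.subset_span (Set.mem_insert_of_mem _ (Set.mem_range_self i))) _) ih

theorem grading_le_generatorSpan_pow (hδ : ∀ i, 0 < δ i)
    (hgraded : ∀ (d : ℕ), ∀ f ∈ MvPolynomial.weightedHomogeneousSubmodule A δ d,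
      algebraMap (MvPolynomial (Fin n) A) R f ∈ 𝓡 d)
    (hsurj : Function.Surjective (algebraMap (MvPolynomial (Fin n) A) R)) (d : ℕ) :
    𝓡 d ≤ generatorSpan A R n ^ d := by
  intro r hr
  obtain ⟨f, rfl⟩ := hsurj r
  rw [← decompose_of_mem_same 𝓡 hr]
  clear hr
  induction f using MvPolynomial.induction_on' with
  | monomial m a =>
    have hm := hgraded _ _ (MvPolynomial.isWeightedHomogeneous_monomial δ m a rfl)
    by_cases hd : Finsupp.weight δ m = d
    · subst hd
      rw [decompose_of_mem_same 𝓡 hm]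
      exact algebraMap_monomial_mem_generatorSpan_pow hδ m a
    · rw [decompose_of_mem_ne 𝓡 hm hd]
      exact Submodule.zero_mem _
  | add p q hp hq =>
    rw [map_add, decompose_add, DirectSum.add_apply, Submodule.coe_add]
    exact Submodule.add_mem _ hp hq

theorem finite_grading [IsNoetherianRing A] (hδ : ∀ i, 0 < δ i)
    (hgraded : ∀ (d : ℕ), ∀ f ∈ MvPolynomial.weightedHomogeneousSubmodule A δ d,
      algebraMap (MvPolynomial (Fin n) A) R f ∈ 𝓡 d)
    (hsurj : Function.Surjective (algebraMap (MvPolynomial (Fin n) A) R)) (d : ℕ) :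
    Module.Finite A (𝓡 d) := by
  have : Module.Finite A ↥(generatorSpan A R n ^ d) :=
    Module.Finite.iff_fg.mpr (generatorSpan_fg.pow d)
  exact Module.Finite.of_injective
    (Submodule.inclusion (grading_le_generatorSpan_pow 𝓡 hδ hgraded hsurj d))
    (Submodule.inclusion_injective _)

/-- `R` is the direct sum of its graded pieces, each flat and finitely presented, hence projective,
over the Noetherian ring `A`. -/
theorem projective_of_graded [IsNoetherianRing A] [Module.Flat A R] (hδ : ∀ i, 0 < δ i)
    (hgraded : ∀ (d : ℕ), ∀ f ∈ MvPolynomial.weightedHomogeneousSubmodule A δ d,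
      algebraMap (MvPolynomial (Fin n) A) R f ∈ 𝓡 d)
    (hsurj : Function.Surjective (algebraMap (MvPolynomial (Fin n) A) R)) :
    Module.Projective A R := by
  have (d : ℕ) : Module.Projective A (𝓡 d) := by
    have := finite_grading 𝓡 hδ hgraded hsurj d
    have := flat_of_graded 𝓡 d
    have := Module.finitePresentation_of_finite A (𝓡 d)
    exact Module.Flat.projective_of_finitePresentation
  exact Module.Projective.of_equiv (decomposeLinearEquiv 𝓡).symm

end Generation

section Fiber

variable (p : Ideal A) [p.IsPrime]

/-- Projection to degree zero is an `A`-linear retraction of `A → R`, and it survives tensoring with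
the residue field. -/
theorem nontrivial_fiber_of_graded (hinj : Function.Injective (algebraMap A R))
    (hzero : ∀ r ∈ 𝓡 0, r ∈ (algebraMap A R).range) : Nontrivial (p.Fiber R) := by
  let f : A →ₗ[A] 𝓡 0 := (Algebra.linearMap A R).codRestrict (𝓡 0) fun a =>
    SetLike.algebraMap_mem_graded 𝓡 a
  have hf : Function.Bijective f := by
    refine ⟨fun a b h => hinj (congrArg Subtype.val h), fun r => ?_⟩
    obtain ⟨a, ha⟩ := hzero r r.2
    exact ⟨a, Subtype.ext ha⟩
  let ε : R →ₗ[A] A := (LinearEquiv.ofBijective f hf).symm.toLinearMap ∘ₗ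
    DirectSum.component A ℕ (fun d => 𝓡 d) 0 ∘ₗ (decomposeLinearEquiv 𝓡).toLinearMap
  have hε (a : A) : ε (algebraMap A R a) = a := by
    refine (LinearEquiv.ofBijective f hf).injective ?_
    refine (LinearEquiv.apply_symm_apply _ _).trans (Subtype.ext ?_)
    exact decompose_of_mem_same 𝓡 (SetLike.algebraMap_mem_graded 𝓡 a)
  have h1 : ε.lTensor p.ResidueField (1 ⊗ₜ algebraMap A R 1) = 1 ⊗ₜ 1 := by
    rw [LinearMap.lTensor_tmul, hε]
  rw [map_one] at h1
  refine ⟨1, 0, fun h => ?_⟩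
  rw [Algebra.TensorProduct.one_def] at h
  rw [h, map_zero] at h1
  have := congrArg (TensorProduct.rid A p.ResidueField) h1
  simp at this

theorem preconnectedSpace_fiber_of_graded (hzero : ∀ r ∈ 𝓡 0, r ∈ (algebraMap A R).range) :
    PreconnectedSpace (PrimeSpectrum (p.Fiber R)) := by
  refine preconnectedSpace_of_graded (k := p.ResidueField)
    (𝓑 := fun d => (𝓡 d).baseChange p.ResidueField) fun x hx => ?_
  obtain ⟨y, rfl⟩ := hx
  induction y using TensorProduct.induction_on with
  | zero => simp
  | add y z hy hz => rw [map_add]; exact add_mem hy hz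
  | tmul c r =>
    obtain ⟨a, ha⟩ := hzero r r.2
    refine ⟨a • c, ?_⟩
    rw [LinearMap.baseChange_tmul, Submodule.subtype_apply, ← ha,
      Algebra.algebraMap_eq_smul_one (A := R), ← TensorProduct.smul_tmul]
    rfl

/-- The graded piece is an `A`-direct summand of `R`, so its base change embeds in the fiber. -/
theorem finrank_baseChange_grading (d : ℕ) [Module.Finite A (𝓡 d)] [Module.Flat A (𝓡 d)] :
    Module.finrank p.ResidueField ((𝓡 d).baseChange p.ResidueField) =
      Module.rankAtStalk (𝓡 d) ⟨p, inferInstance⟩ := by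
  rw [← Ideal.finrank_fiber_eq_rankAtStalk]
  refine LinearMap.finrank_range_of_inj ?_
  let r : R →ₗ[A] 𝓡 d := DirectSum.component A ℕ (fun d => 𝓡 d) d ∘ₗ
    (decomposeLinearEquiv 𝓡).toLinearMap
  have hr : r ∘ₗ (𝓡 d).subtype = LinearMap.id := LinearMap.ext fun x => Subtype.ext
    (decompose_of_mem_same 𝓡 x.2)
  refine Function.LeftInverse.injective (g := r.baseChange p.ResidueField) fun x => ?_
  rw [← LinearMap.comp_apply, ← LinearMap.baseChange_comp, hr, LinearMap.baseChange_id]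
  rfl

theorem baseChange_pow_le (k : Type*) [CommRing k] [Algebra A k] {W : Submodule A R} {d : ℕ} {r : R}
    (hr : r ∈ W ^ d) : (1 : k) ⊗ₜ[A] r ∈ (W.baseChange k) ^ d := by
  induction d generalizing r with
  | zero =>
    rw [pow_zero] at hr ⊢
    obtain ⟨a, rfl⟩ := Submodule.mem_one.mp hr
    refine Submodule.mem_one.mpr ⟨algebraMap A k a, ?_⟩
    rw [Algebra.algebraMap_eq_smul_one (A := R), ← TensorProduct.smul_tmul,
      ← Algebra.algebraMap_eq_smul_one]
    rfl
  | succ d ih =>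
    rw [pow_succ] at hr ⊢
    induction hr using Submodule.mul_induction_on' with
    | mem_mul_mem x hx y hy =>
      have h1 : (1 : k) ⊗ₜ[A] (x * y) = (1 ⊗ₜ x) * (1 ⊗ₜ y) := by
        rw [Algebra.TensorProduct.tmul_mul_tmul, mul_one]
      rw [h1]
      exact Submodule.mul_mem_mul (ih hx) (Submodule.tmul_mem_baseChange_of_mem _ hy)
    | add x _ y _ hx hy =>
      rw [TensorProduct.tmul_add]
      exact Submodule.add_mem _ hx hy

theorem ringKrullDim_fiber_le_of_rankAtStalk_eq [Algebra.FiniteType A R]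
    [∀ d, Module.Finite A (𝓡 d)] [∀ d, Module.Flat A (𝓡 d)] {W : Submodule A R} (hW : W.FG)
    (h1 : 1 ≤ W) (hgen : ∀ d, 𝓡 d ≤ W ^ d) (q : Ideal A) [q.IsPrime] [Nontrivial (p.Fiber R)]
    [Nontrivial (q.Fiber R)]
    (h : ∀ d, Module.rankAtStalk (𝓡 d) ⟨p, inferInstance⟩ =
      Module.rankAtStalk (𝓡 d) ⟨q, inferInstance⟩) :
    ringKrullDim (q.Fiber R) ≤ ringKrullDim (p.Fiber R) := by
  have hfin (p : Ideal A) [p.IsPrime] (d : ℕ) :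
      Module.Finite p.ResidueField ((𝓡 d).baseChange p.ResidueField) :=
    Module.Finite.range _
  refine ringKrullDim_le_of_finrank_eq (k := p.ResidueField) (k' := q.ResidueField)
    (fun d => (𝓡 d).baseChange p.ResidueField)
    (fun d => (𝓡 d).baseChange q.ResidueField) (fun d => ?_) (W := W.baseChange p.ResidueField)
    ?_ ?_ fun d => ?_
  · rw [finrank_baseChange_grading, finrank_baseChange_grading, h]
  · have : Module.Finite A W := Module.Finite.iff_fg.mpr hW
    exact Module.Finite.iff_fg.mp (Module.Finite.range _)
  · exact Submodule.one_le.mpr (Submodule.tmul_mem_baseChange_of_mem _ (Submodule.one_le.mp h1))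
  · rw [Submodule.baseChange_eq_span, Submodule.span_le]
    rintro _ ⟨r, hr, rfl⟩
    exact baseChange_pow_le _ (hgen d hr)

end Fiber

/-- Over a connected base the ranks of the graded pieces agree at any two primes, and the comparison
of Hilbert functions applies in both directions. When `R` is finite over `A` the fibers are Artinian
and the dimension is `0`; this also covers `A = 0`. -/
theorem exists_ringKrullDim_fiber_eq [IsNoetherianRing A] [Module.Flat A R]
    {n : ℕ} {δ : Fin n → ℕ} (hδ : ∀ i, 0 < δ i)
    [Algebra (MvPolynomial (Fin n) A) R] [IsScalarTower A (MvPolynomial (Fin n) A) R]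
    (hgraded : ∀ (d : ℕ), ∀ f ∈ MvPolynomial.weightedHomogeneousSubmodule A δ d,
      algebraMap (MvPolynomial (Fin n) A) R f ∈ 𝓡 d)
    (hsurj : Function.Surjective (algebraMap (MvPolynomial (Fin n) A) R))
    (hinj : Function.Injective (algebraMap A R))
    (hzero : ∀ r ∈ 𝓡 0, r ∈ (algebraMap A R).range)
    (hle : ∀ (p : Ideal A) [p.IsPrime], ringKrullDim (p.Fiber R) ≤ n)
    (hcases : ConnectedSpace (PrimeSpectrum A) ∨ Module.Finite A R) :
    ∃ e : ℕ, e ≤ n ∧ ∀ (p : Ideal A) [p.IsPrime], ringKrullDim (p.Fiber R) = e := by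
  have hnt (p : Ideal A) [p.IsPrime] := nontrivial_fiber_of_graded 𝓡 p hinj hzero
  rcases hcases with hconn | hfin
  · have hft : Algebra.FiniteType A R := by
      refine Algebra.FiniteType.of_surjective
        (IsScalarTower.toAlgHom A (MvPolynomial (Fin n) A) R) hsurj
    have (d : ℕ) := finite_grading 𝓡 hδ hgraded hsurj d
    have (d : ℕ) := flat_of_graded 𝓡 d
    have (d : ℕ) := Module.finitePresentation_of_finite A (𝓡 d)
    have hdim (p q : Ideal A) [p.IsPrime] [q.IsPrime] :
        ringKrullDim (q.Fiber R) ≤ ringKrullDim (p.Fiber R) :=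
      ringKrullDim_fiber_le_of_rankAtStalk_eq 𝓡 p generatorSpan_fg one_le_generatorSpan
        (grading_le_generatorSpan_pow 𝓡 hδ hgraded hsurj) q fun d =>
        Module.isLocallyConstant_rankAtStalk.apply_eq_of_preconnectedSpace _ _
    obtain ⟨p₀⟩ := hconn.toNonempty
    have hp₀ := hle p₀.asIdeal
    obtain ⟨a, ha⟩ := WithBot.ne_bot_iff_exists.mp
      (fun h' => not_le.mpr (WithBot.bot_lt_coe (0 : ℕ∞))
        (h' ▸ ringKrullDim_nonneg_of_nontrivial (R := p₀.asIdeal.Fiber R)))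
    rw [← ha] at hp₀
    have han : a ≤ n := WithBot.coe_le_coe.mp hp₀
    obtain ⟨e, rfl⟩ := ENat.ne_top_iff_exists.mp (ne_top_of_le_ne_top (ENat.natCast_ne_top n) han)
    refine ⟨e, by exact_mod_cast han, fun p hp => ?_⟩
    refine le_antisymm ?_ ?_
    · exact (hdim p₀.asIdeal p).trans ha.ge
    · exact ha.le.trans (hdim p p₀.asIdeal)
  · refine ⟨0, Nat.zero_le _, fun p hp => ?_⟩
    have : IsArtinianRing (p.Fiber R) := IsArtinianRing.of_finite p.ResidueField _
    exact (ringKrullDimZero_iff_ringKrullDim_eq_zero.mp inferInstance)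

end GradedOver

/-! ### Local cyclicity in terms of elements. -/

section CyclicAt

/-- The localization of `M` at the prime `q` is cyclic, in terms of elements of `M`. -/
def CyclicAt (S M : Type*) [CommRing S] [AddCommGroup M] [Module S M] (q : Ideal S) : Prop :=
  ∃ x : M, ∀ y : M, ∃ a s : S, s ∉ q ∧ s • y = a • x

variable {S R M M' : Type*} [CommRing S] [CommRing R] [AddCommGroup M] [Module S M]
  [AddCommGroup M'] [Module S M']

theorem CyclicAt.of_surjective {q : Ideal S} (h : CyclicAt S M q) (f : M →ₗ[S] M')
    (hf : Function.Surjective f) : CyclicAt S M' q := by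
  obtain ⟨x, hx⟩ := h
  refine ⟨f x, fun y => ?_⟩
  obtain ⟨y, rfl⟩ := hf y
  obtain ⟨a, s, hs, h⟩ := hx y
  exact ⟨a, s, hs, by rw [← map_smul, h, map_smul]⟩

theorem CyclicAt.mono {q q' : Ideal S} (h : CyclicAt S M q) (hq : q' ≤ q) : CyclicAt S M q' := by
  obtain ⟨x, hx⟩ := h
  refine ⟨x, fun y => ?_⟩
  obtain ⟨a, s, hs, h⟩ := hx y
  exact ⟨a, s, fun h' => hs (hq h'), h⟩

theorem cyclicAt_comap_iff [Algebra S R] [Module R M] [IsScalarTower S R M]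
    (hR : Function.Surjective (algebraMap S R)) (P : Ideal R) :
    CyclicAt S M (P.comap (algebraMap S R)) ↔ CyclicAt R M P := by
  constructor
  · rintro ⟨x, hx⟩
    refine ⟨x, fun y => ?_⟩
    obtain ⟨a, s, hs, h⟩ := hx y
    exact ⟨algebraMap S R a, algebraMap S R s, hs, by rw [algebraMap_smul, algebraMap_smul, h]⟩
  · rintro ⟨x, hx⟩
    refine ⟨x, fun y => ?_⟩
    obtain ⟨a, s, hs, h⟩ := hx y
    obtain ⟨a, rfl⟩ := hR a
    obtain ⟨s, rfl⟩ := hR s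
    exact ⟨a, s, hs, by rwa [algebraMap_smul, algebraMap_smul] at h⟩

theorem isLocallyCyclic_iff : IsLocallyCyclic S M ↔ ∀ (q : Ideal S) [q.IsPrime], CyclicAt S M q := by
  refine forall_congr' fun q => forall_congr' fun hq => ?_
  constructor
  · rintro ⟨x, hx⟩
    induction x using LocalizedModule.induction_on with | _ m s =>
    refine ⟨m, fun y => ?_⟩
    have hy : LocalizedModule.mk y 1 ∈ Submodule.span (Localization.AtPrime q)
      {LocalizedModule.mk m s} := hx ▸ Submodule.mem_top
    obtain ⟨c, hc⟩ := Submodule.mem_span_singleton.mp hy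
    induction c using Localization.induction_on with | _ bt =>
    obtain ⟨b, t⟩ := bt
    rw [LocalizedModule.mk_smul_mk, LocalizedModule.mk_eq] at hc
    obtain ⟨u, hu⟩ := hc
    refine ⟨u * b, u * (t * s), (u * (t * s)).2, ?_⟩
    rw [one_smul] at hu
    simpa only [Submonoid.smul_def, Submonoid.coe_mul, mul_smul] using hu.symm
  · rintro ⟨x, hx⟩
    refine ⟨LocalizedModule.mk x 1, eq_top_iff.mpr fun z _ => ?_⟩
    induction z using LocalizedModule.induction_on with | _ y t =>
    obtain ⟨a, s, hs, h⟩ := hx y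
    refine Submodule.mem_span_singleton.mpr ⟨Localization.mk a (⟨s, hs⟩ * t), ?_⟩
    rw [LocalizedModule.mk_smul_mk, LocalizedModule.mk_eq]
    refine ⟨1, ?_⟩
    rw [one_smul, one_smul, mul_one, mul_comm, Submonoid.smul_def, Submonoid.smul_def,
      Submonoid.coe_mul, mul_smul, ← h]

end CyclicAt

/-! ### Descent of cyclicity along maps to local rings. -/

section LocalCyclic

variable {S L M : Type u} [CommRing S] [CommRing L] [IsLocalRing L] [Algebra S L] [AddCommGroup M]
  [Module S M]

theorem CyclicAt.isCyclicModule_tensor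
    (h : CyclicAt S M ((IsLocalRing.maximalIdeal L).comap (algebraMap S L))) :
    IsCyclicModule L (L ⊗[S] M) := by
  obtain ⟨x, hx⟩ := h
  refine ⟨1 ⊗ₜ x, fun y => ?_⟩
  induction y with
  | zero => exact ⟨0, by simp⟩
  | add y z hy hz =>
    obtain ⟨a, ha⟩ := hy
    obtain ⟨b, hb⟩ := hz
    exact ⟨a + b, by rw [add_smul, ← ha, ← hb]⟩
  | tmul l m =>
    obtain ⟨a, s, hs, h⟩ := hx m
    have hu : IsUnit (algebraMap S L s) := by
      by_contra h'
      exact hs h'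
    obtain ⟨v, hv⟩ := hu.exists_right_inv
    refine ⟨l * v * algebraMap S L a, ?_⟩
    rw [TensorProduct.smul_tmul', smul_eq_mul, mul_one, mul_comm, ← Algebra.smul_def,
      TensorProduct.smul_tmul, ← h, ← TensorProduct.smul_tmul, Algebra.smul_def]
    congr 1
    linear_combination (-l) * hv

/-- If no element of `G` is a unit multiple of the generator `x`, then `X = 𝔪 x`, so `x = 0`;
membership of `0` in `G` takes care of that case. -/
theorem IsCyclicModule.exists_mem_generator {X : Type*} [AddCommGroup X] [Module L X]
    (h : IsCyclicModule L X) {G : Set X} (hG : Submodule.span L G = ⊤) (h0 : (0 : X) ∈ G) :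
    ∃ x ∈ G, ∀ y, ∃ a : L, y = a • x := by
  obtain ⟨x, hx⟩ := h
  by_cases hu : ∃ g ∈ G, ∃ u : L, IsUnit u ∧ g = u • x
  · obtain ⟨_, hg, u, hu, rfl⟩ := hu
    obtain ⟨v, hv⟩ := hu.exists_right_inv
    refine ⟨_, hg, fun y => ?_⟩
    obtain ⟨a, rfl⟩ := hx y
    exact ⟨a * v, by rw [smul_smul, mul_assoc, mul_comm v, hv, mul_one]⟩
  · have hle : Submodule.span L G ≤ Submodule.map
        (LinearMap.toSpanSingleton L X x) (IsLocalRing.maximalIdeal L) := by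
      refine Submodule.span_le.mpr fun g hg => ?_
      obtain ⟨a, rfl⟩ := hx g
      exact ⟨a, fun ha => hu ⟨_, hg, a, ha, rfl⟩, rfl⟩
    obtain ⟨a, ha, hax⟩ := hle (hG ▸ Submodule.mem_top : x ∈ Submodule.span L G)
    have hunit : IsUnit (1 - a) := (IsLocalRing.isUnit_or_isUnit_one_sub_self a).resolve_left ha
    have hx0 : x = 0 := by
      refine hunit.smul_eq_zero.mp ?_
      rw [sub_smul, one_smul, sub_eq_zero]
      exact hax.symm
    refine ⟨0, h0, fun y => ?_⟩
    obtain ⟨a, rfl⟩ := hx y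
    exact ⟨a, by rw [hx0]⟩

/-- No flatness of `L` is needed: the residue field of `L` is a field extension of `κ(q)`, so `κ(q)
⊗ M = 0` by faithful flatness, and Nakayama gives `M_q = 0`. -/
theorem exists_smul_eq_zero_of_subsingleton_tensor [Module.Finite S M] (h : Subsingleton (L ⊗[S] M))
    (y : M) : ∃ s ∉ (IsLocalRing.maximalIdeal L).comap (algebraMap S L), s • y = 0 := by
  let q := (IsLocalRing.maximalIdeal L).comap (algebraMap S L)
  let k := IsLocalRing.ResidueField L
  let g : q.ResidueField →+* k := Ideal.ResidueField.lift q (algebraMap S k)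
    (fun s hs => by
      rw [RingHom.mem_ker, IsScalarTower.algebraMap_apply S L k]
      exact (IsLocalRing.residue_eq_zero_iff _).mpr hs)
    (fun s hs => by
      refine IsUnit.mk0 _ fun h0 => hs ?_
      rw [IsScalarTower.algebraMap_apply S L k] at h0
      exact (IsLocalRing.residue_eq_zero_iff _).mp h0)
  let := g.toAlgebra
  have : IsScalarTower S q.ResidueField k := .of_algebraMap_eq fun s =>
    (Ideal.ResidueField.lift_algebraMap ..).symm
  have h1 : Subsingleton (k ⊗[S] M) :=
    (AlgebraTensorModule.cancelBaseChange S L k k M).symm.injective.subsingleton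
  have h2 : Subsingleton (k ⊗[q.ResidueField] (q.ResidueField ⊗[S] M)) :=
    (AlgebraTensorModule.cancelBaseChange S q.ResidueField k k M).injective.subsingleton
  have h3 : Subsingleton (q.ResidueField ⊗[S] M) :=
    (Module.FaithfullyFlat.subsingleton_tensorProduct_iff_right q.ResidueField k).mp h2
  have h4 : (⟨q, inferInstance⟩ : PrimeSpectrum S) ∉ Module.support S M := by
    rw [Module.mem_support_iff_nontrivial_residueField_tensorProduct]
    exact not_nontrivial_iff_subsingleton.mpr h3
  exact Module.notMem_support_iff'.mp h4 y

theorem isCyclicModule_tensor_iff_cyclicAt [Module.Finite S M] :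
    IsCyclicModule L (L ⊗[S] M) ↔
      CyclicAt S M ((IsLocalRing.maximalIdeal L).comap (algebraMap S L)) := by
  refine ⟨fun h => ?_, CyclicAt.isCyclicModule_tensor⟩
  obtain ⟨_, ⟨x, rfl⟩, hx⟩ := h.exists_mem_generator
    (G := Set.range fun m : M => (1 : L) ⊗ₜ[S] m) (by
      refine eq_top_iff.mpr fun z _ => ?_
      induction z with
      | zero => exact zero_mem _
      | add y z hy hz => exact add_mem (hy trivial) (hz trivial)
      | tmul l m =>
        rw [show l ⊗ₜ[S] m = l • ((1 : L) ⊗ₜ[S] m) by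
          rw [TensorProduct.smul_tmul', smul_eq_mul, mul_one]]
        exact Submodule.smul_mem _ _ (Submodule.subset_span ⟨m, rfl⟩)) ⟨0, tmul_zero _ _⟩
  -- A generator of the form `1 ⊗ x` becomes zero in the quotient, so the quotient of `M` by `x`
  -- vanishes near the prime.
  have hsub : Subsingleton (L ⊗[S] (M ⧸ Submodule.span S {x})) := by
    have hs := LinearMap.lTensor_surjective L (Submodule.span S {x}).mkQ_surjective
    have h0 (z : L ⊗[S] (M ⧸ Submodule.span S {x})) : z = 0 := by
      obtain ⟨z, rfl⟩ := hs z
      obtain ⟨a, rfl⟩ := hx z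
      rw [TensorProduct.smul_tmul', LinearMap.lTensor_tmul,
        show (Submodule.span S {x}).mkQ x = 0 from (Submodule.Quotient.mk_eq_zero _).mpr
          (Submodule.mem_span_singleton_self x), tmul_zero]
    exact ⟨fun a b => (h0 a).trans (h0 b).symm⟩
  refine ⟨x, fun y => ?_⟩
  obtain ⟨s, hs, h⟩ := exists_smul_eq_zero_of_subsingleton_tensor hsub
    ((Submodule.span S {x}).mkQ y)
  rw [← map_smul] at h
  obtain ⟨a, ha⟩ := Submodule.mem_span_singleton.mp ((Submodule.Quotient.mk_eq_zero _).mp h)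
  exact ⟨a, s, hs, ha.symm⟩

end LocalCyclic

/-! ### From local to global concentration on a connected fiber. -/

section ConnectedFiber

variable {A S R T B k : Type u} [CommRing A] [CommRing S] [Algebra A S] [CommRing R] [CommRing T]
  [CommRing B] [Algebra S R] [Algebra S T] [Field k] {M F : ℕ → Type u}
  [∀ i, AddCommGroup (M i)] [∀ i, Module S (M i)] [∀ i, AddCommGroup (F i)]
  [∀ i, Module S (F i)] {ι : ∀ i, M (i + 1) →ₗ[S] F i} {π : ∀ i, F i →ₗ[S] M i} {N : ℕ}

theorem notMem_support_iff_subsingleton_tensor (G : Type*) [AddCommGroup G] [Module T G]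
    (q : PrimeSpectrum T) :
    q ∉ Module.support T G ↔ Subsingleton (Localization.AtPrime q.asIdeal ⊗[T] G) := by
  rw [Module.notMem_support_iff]
  exact (LocalizedModule.equivTensorProduct q.asIdeal.primeCompl G).toEquiv.subsingleton_congr

/-- The fiber cohomology of `F`. -/
abbrev fiberCohomology (ι : ∀ i, M (i + 1) →ₗ[S] F i) (π : ∀ i, F i →ₗ[S] M i) (T : Type u)
    [CommRing T] [Algebra S T] (i : ℕ) : Type u :=
  cohomology (fun i => (homDifferential ι π S i).baseChange T) i

theorem IsFlatResolution.finite_fiberCohomology [IsNoetherianRing T]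
    (h : IsFlatResolution A ι π N) (i : ℕ) : Module.Finite T (fiberCohomology ι π T i) := by
  have := h.proj i
  have := h.finite i
  have : Module.Finite S (F i →ₗ[S] S) := Module.dual_finite
  infer_instance

theorem IsFlatResolution.subsingleton_fiberCohomology (h : IsFlatResolution A ι π N) (i : ℕ)
    (hi : N < i) : Subsingleton (fiberCohomology ι π T i) := by
  have := h.dual_bounded i hi
  infer_instance

variable (k) in
/-- For a Gorenstein fiber with connected spectrum, the degree in which the localized cohomology is
concentrated is the codimension of the fiber. -/
theorem IsFlatResolution.concentrated_of_preconnected [Algebra k T]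
    (h : IsFlatResolution A ι π N) (e : M 0 ≃ₗ[S] R) (hT : IsFlatExactBaseChange A S T)
    {n : ℕ} (hTn : IsPolynomialLike T n)
    (hR : Function.Surjective (algebraMap S R)) (φ : T →+* B) (hφ : Function.Surjective φ)
    (hker : RingHom.ker φ = (RingHom.ker (algebraMap S R)).map (algebraMap S T))
    (hconn : PreconnectedSpace (PrimeSpectrum B))
    {E : ℕ} (hdim : ringKrullDim B = E)
    (hG : ∀ (P : Ideal B) [P.IsPrime], ∃ r, HasInjectiveDimensionLE
      (ModuleCat.of (Localization.AtPrime P) (Localization.AtPrime P)) r)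
    (P : Ideal B) [P.IsMaximal] :
    (∀ i, i ≠ n - E → Subsingleton (Localization.AtPrime (P.comap φ) ⊗[T] fiberCohomology ι π T i)) ∧
      IsCyclicModule (Localization.AtPrime (P.comap φ))
        (Localization.AtPrime (P.comap φ) ⊗[T] fiberCohomology ι π T (n - E)) := by
  have := hTn.noeth
  have (i : ℕ) := h.finite_fiberCohomology (T := T) i
  -- These sets are open since supports of finite modules are closed, cover the spectrum since every
  -- prime lies in a maximal ideal, and are disjoint since not all the `Ext` vanish at a prime.
  -- Connectedness leaves only one.
  let U (c : ℕ) : Set (PrimeSpectrum B) := {P | ∀ i, i ≠ c →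
    PrimeSpectrum.comap φ P ∉ Module.support T (fiberCohomology ι π T i)}
  have hUopen (c : ℕ) : IsOpen (U c) := by
    have hU : U c = ⋂ i ∈ (Finset.range (N + 1)).erase c, PrimeSpectrum.comap φ ⁻¹'
        (Module.support T (fiberCohomology ι π T i))ᶜ := by
      ext P
      simp only [Set.mem_iInter, Finset.mem_erase, Finset.mem_range]
      refine ⟨fun hP i hi => hP i hi.1, fun hP i hi => ?_⟩
      by_cases hiN : i < N + 1
      · exact hP i ⟨hi, hiN⟩
      · have := h.subsingleton_fiberCohomology (T := T) i (by omega)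
        rw [Module.support_eq_empty]
        exact Set.notMem_empty _
    rw [hU]
    exact isOpen_biInter_finset fun i _ =>
      Module.isClosed_support.isOpen_compl.preimage (PrimeSpectrum.continuous_comap φ)
  have hUmax (P : Ideal B) [P.IsMaximal] : ∃ c D : ℕ, P.height = D ∧ c + D = n ∧
      (⟨P, inferInstance⟩ : PrimeSpectrum B) ∈ U c ∧
      IsCyclicModule (Localization.AtPrime (P.comap φ))
        (Localization.AtPrime (P.comap φ) ⊗[T] fiberCohomology ι π T c) := by
    obtain ⟨c, D, hD, hcD, hc, hcyc⟩ := h.exists_concentrated (k := k) e hT hTn hR φ hφ hker P (hG P)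
    refine ⟨c, D, ?_, hcD, fun i hi => ?_, hcyc⟩
    · rw [IsLocalization.AtPrime.ringKrullDim_eq_height P] at hD
      exact WithBot.coe_inj.mp hD
    · rw [notMem_support_iff_subsingleton_tensor]
      exact hc i hi
  have hUcover (P : PrimeSpectrum B) : ∃ c, P ∈ U c := by
    obtain ⟨m, hm, hPm⟩ := P.asIdeal.exists_le_maximal P.isPrime.ne_top
    obtain ⟨c, -, -, -, hc, -⟩ := hUmax m
    exact ⟨c, fun i hi hP => hc i hi (Module.mem_support_mono (Ideal.comap_mono hPm) hP)⟩
  have hUuniq (P : PrimeSpectrum B) (c c' : ℕ) (hc : P ∈ U c) (hc' : P ∈ U c') : c = c' := by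
    by_contra hne
    refine h.not_forall_subsingleton (k := k) e hT hR φ hφ hker P.asIdeal fun i => ?_
    refine (notMem_support_iff_subsingleton_tensor _ (PrimeSpectrum.comap φ P)).mp ?_
    by_cases hi : i = c
    · exact hc' i (by omega)
    · exact hc i hi
  choose c hc using hUcover
  have hconst : IsLocallyConstant c := (IsLocallyConstant.iff_exists_open c).mpr fun P =>
    ⟨U (c P), hUopen _, hc P, fun P' hP' => hUuniq P' _ _ (hc P') hP'⟩
  have hnt : Nontrivial B := by
    by_contra hnt
    rw [not_nontrivial_iff_subsingleton] at hnt
    rw [ringKrullDim_eq_bot_of_subsingleton] at hdim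
    exact WithBot.bot_ne_coe hdim
  obtain ⟨c₀, D₀, hD₀, hcD₀, hc₀, hcyc₀⟩ := hUmax P
  -- A common degree `c` means that all maximal ideals have the same height `n - c`, which is then
  -- the Krull dimension.
  have hE : (E : ℕ∞) = D₀ := by
    rw [← Ideal.sup_isMaximal_height_eq_ringKrullDim] at hdim
    rw [← WithBot.coe_inj.mp hdim]
    refine le_antisymm (iSup₂_le fun m hm => ?_) (hD₀ ▸ le_iSup₂ (f := fun (I : Ideal B)
      (_ : I.IsMaximal) => I.height) P inferInstance)
    obtain ⟨c₁, D₁, hD₁, hcD₁, hc₁, -⟩ := hUmax m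
    have h1 := hUuniq _ _ _ hc₁ (hc ⟨m, inferInstance⟩)
    have h2 := hUuniq _ _ _ hc₀ (hc ⟨P, inferInstance⟩)
    have h3 := hconst.apply_eq_of_preconnectedSpace ⟨m, inferInstance⟩ ⟨P, inferInstance⟩
    rw [hD₁]
    exact Nat.cast_le.mpr (by omega)
  obtain rfl : E = D₀ := by exact_mod_cast hE
  obtain rfl : c₀ = n - E := by omega
  exact ⟨fun i hi => (notMem_support_iff_subsingleton_tensor _
    (PrimeSpectrum.comap φ ⟨P, inferInstance⟩)).mp (hc₀ i hi), hcyc₀⟩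

theorem subsingleton_localization_tensor_of_not_ker_le {L : Type u} [CommRing L] [Algebra S L]
    {s : S} (hs : algebraMap S R s = 0) (hu : IsUnit (algebraMap S L s)) :
    Subsingleton (L ⊗[S] R) := by
  obtain ⟨v, hv⟩ := hu.exists_left_inv
  refine subsingleton_of_zero_eq_one ?_
  rw [Algebra.TensorProduct.one_def, ← hv, mul_comm, ← Algebra.smul_def, TensorProduct.smul_tmul,
    Algebra.smul_def, hs, zero_mul, tmul_zero]

variable (k) in
-- Exactness is tested at the maximal ideals of `T`. Those containing the kernel of `φ` come from
-- `B`; at the others the base change of `R` vanishes, and so does its `Ext`.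
theorem IsFlatResolution.exactAt_of_concentrated [Algebra k T]
    (h : IsFlatResolution A ι π N) (e : M 0 ≃ₗ[S] R) (hT : IsFlatExactBaseChange A S T)
    (φ : T →+* B) (hφ : Function.Surjective φ)
    (hker : RingHom.ker φ = (RingHom.ker (algebraMap S R)).map (algebraMap S T))
    {c : ℕ}
    (hc : ∀ (P : Ideal B) [P.IsMaximal] (i : ℕ), i ≠ c →
      Subsingleton (Localization.AtPrime (P.comap φ) ⊗[T] fiberCohomology ι π T i))
    (i : ℕ) (hi : i ≠ c) : ExactAt (fun i => (homDifferential ι π S i).baseChange T) i := by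
  rw [← subsingleton_cohomology_iff]
  refine subsingleton_of_localization_tensor (T := T) (fiberCohomology ι π T i) fun Q hQ => ?_
  by_cases hle : RingHom.ker φ ≤ Q
  · have hQ' : (Q.map φ).comap φ = Q := by
      rw [Ideal.comap_map_of_surjective φ hφ, ← RingHom.ker_eq_comap_bot, sup_eq_left]
      exact hle
    have hmax : (Q.map φ).IsMaximal := by
      refine (Ideal.map_eq_top_or_isMaximal_of_surjective φ hφ hQ).resolve_left fun htop => ?_
      rw [htop, Ideal.comap_top] at hQ'
      exact hQ.ne_top hQ'.symm
    have key (Q' : Ideal T) [Q'.IsPrime] (hQQ' : Q' = Q)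
        (hsub : Subsingleton (Localization.AtPrime Q' ⊗[T] fiberCohomology ι π T i)) :
        Subsingleton (Localization.AtPrime Q ⊗[T] fiberCohomology ι π T i) := by
      subst hQQ'
      exact hsub
    exact key _ hQ' (hc (Q.map φ) i hi)
  · rw [hker, Ideal.map_le_iff_le_comap] at hle
    obtain ⟨s, hs, hsQ⟩ := Set.not_subset.mp hle
    have hsub : Subsingleton (Localization.AtPrime Q ⊗[S] R) := by
      refine subsingleton_localization_tensor_of_not_ker_le hs ?_
      rw [IsScalarTower.algebraMap_apply S T (Localization.AtPrime Q)]
      exact IsLocalization.map_units (Localization.AtPrime Q) (⟨_, hsQ⟩ : Q.primeCompl)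
    obtain ⟨e'⟩ := h.ext_localization_equiv k e hT Q i
    have h0 (x : ExtMod (Localization.AtPrime Q) (Localization.AtPrime Q ⊗[S] R)
        (Localization.AtPrime Q) i) : x = 0 := by
      rw [← one_smul (Localization.AtPrime Q) x]
      exact ExtMod.smul_eq_zero_of_left (fun m => Subsingleton.elim _ _) x
    have : Subsingleton (ExtMod (Localization.AtPrime Q) (Localization.AtPrime Q ⊗[S] R)
        (Localization.AtPrime Q) i) := ⟨fun x y => (h0 x).trans (h0 y).symm⟩
    exact e'.symm.injective.subsingleton

end ConnectedFiber

theorem IsCyclicModule.of_linearEquiv {R M N : Type*} [CommRing R] [AddCommGroup M] [Module R M]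
    [AddCommGroup N] [Module R N] (h : IsCyclicModule R M) (e : M ≃ₗ[R] N) : IsCyclicModule R N :=
  h.of_surjective e.toLinearMap e.surjective

/-! ### Passing between `R` and all of its fibers. -/

section FiberMap

attribute [local instance] Algebra.TensorProduct.rightAlgebra

variable {A S R : Type u} [CommRing A] [CommRing S] [Algebra A S] [CommRing R] [Algebra A R]
  [Algebra S R] [IsScalarTower A S R]

variable (S R) in
/-- The map induced on fibers by the structure map of an `S`-algebra `R`. -/
def fiberMap (p : Ideal A) [p.IsPrime] : p.Fiber S →ₐ[p.ResidueField] p.Fiber R :=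
  Algebra.TensorProduct.map (AlgHom.id p.ResidueField p.ResidueField) (IsScalarTower.toAlgHom A S R)

theorem fiberMap_surjective (hR : Function.Surjective (algebraMap S R)) (p : Ideal A) [p.IsPrime] :
    Function.Surjective (fiberMap S R p) :=
  LinearMap.lTensor_surjective p.ResidueField (g := (IsScalarTower.toAlgHom A S R).toLinearMap) hR

theorem ker_fiberMap (hR : Function.Surjective (algebraMap S R)) (p : Ideal A) [p.IsPrime] :
    RingHom.ker (fiberMap S R p).toRingHom =
      (RingHom.ker (algebraMap S R)).map (algebraMap S (p.Fiber S)) :=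
  Algebra.TensorProduct.lTensor_ker (IsScalarTower.toAlgHom A S R) hR

theorem isPolynomialLike_fiber_mvPolynomial (n : ℕ) (p : Ideal A) [p.IsPrime] :
    IsPolynomialLike (p.Fiber (MvPolynomial (Fin n) A)) n :=
  IsPolynomialLike.of_ringEquiv (k := p.ResidueField)
    (MvPolynomial.algebraTensorAlgEquiv A p.ResidueField).symm.toRingEquiv

theorem comap_fiberMap_comap (p : Ideal A) [p.IsPrime] (P : Ideal (p.Fiber R)) :
    (P.comap (fiberMap S R p).toRingHom).comap (algebraMap S (p.Fiber S)) =
      (P.comap (algebraMap R (p.Fiber R))).comap (algebraMap S R) := rfl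

theorem comap_maximalIdeal_localization {T : Type u} [CommRing T] [Algebra S T] (Q : Ideal T)
    [Q.IsPrime] :
    (IsLocalRing.maximalIdeal (Localization.AtPrime Q)).comap
      (algebraMap S (Localization.AtPrime Q)) = Q.comap (algebraMap S T) := by
  rw [IsScalarTower.algebraMap_eq S T (Localization.AtPrime Q), ← Ideal.comap_comap]
  exact congrArg (Ideal.comap (algebraMap S T)) Localization.AtPrime.under_maximalIdeal

variable {M F : ℕ → Type u}
  [∀ i, AddCommGroup (M i)] [∀ i, Module S (M i)] [∀ i, AddCommGroup (F i)]
  [∀ i, Module S (F i)] {ι : ∀ i, M (i + 1) →ₗ[S] F i} {π : ∀ i, F i →ₗ[S] M i} {N : ℕ}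

theorem IsFlatResolution.flatOver_dual [Module.Flat A S] (h : IsFlatResolution A ι π N) (i : ℕ) :
    FlatOver A S (F i →ₗ[S] S) := by
  have := h.proj i
  have := h.finite i
  have : Module.Projective S (Module.Dual S (F i)) := inferInstance
  exact FlatOver.of_projective (X := Module.Dual S (F i))

theorem IsFlatResolution.finite_dual (h : IsFlatResolution A ι π N) (i : ℕ) :
    Module.Finite S (F i →ₗ[S] S) := by
  have := h.proj i
  have := h.finite i
  exact Module.dual_finite

variable [Module.Flat A S]

theorem IsFlatResolution.concentrated_of_gorenstein [IsNoetherianRing A] [IsNoetherianRing S] {n : ℕ} (h : IsFlatResolution A ι π N)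
    (e : M 0 ≃ₗ[S] R) (hR : Function.Surjective (algebraMap S R))
    (hTn : ∀ (p : Ideal A) [p.IsPrime], IsPolynomialLike (p.Fiber S) n)
    (hconn : ∀ (p : Ideal A) [p.IsPrime], PreconnectedSpace (PrimeSpectrum (p.Fiber R)))
    {E : ℕ} (hdim : ∀ (p : Ideal A) [p.IsPrime], ringKrullDim (p.Fiber R) = E)
    (hG : ∀ (p : Ideal A) [p.IsPrime], IsGorensteinRing (p.Fiber R)) :
    (∀ i, i ≠ n - E → ExactAt (homDifferential ι π S) i) ∧
      FlatOver A S (cohomology (homDifferential ι π S) (n - E)) ∧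
      ∀ (P : Ideal R) [P.IsPrime], CyclicAt S (cohomology (homDifferential ι π S) (n - E))
        (P.comap (algebraMap S R)) := by
  have hfib (p : Ideal A) [p.IsPrime] (P : Ideal (p.Fiber R)) [P.IsMaximal] :=
    h.concentrated_of_preconnected p.ResidueField e (IsFlatExactBaseChange.fiber p) (hTn p) hR
      (fiberMap S R p).toRingHom (fiberMap_surjective hR p) (ker_fiberMap hR p) (hconn p) (hdim p)
      (hG p).2 P
  have hd := h.chain.homDifferential_comp S
  have := h.finite_dual
  obtain ⟨hex, hflat⟩ := exactAt_and_flatOver_of_fiberwise hd h.flatOver_dual h.finite_dual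
    h.dual_bounded (c := n - E) fun p hp i hi =>
      h.exactAt_of_concentrated p.ResidueField e (IsFlatExactBaseChange.fiber p)
      (fiberMap S R p).toRingHom (fiberMap_surjective hR p) (ker_fiberMap hR p)
      (fun P hP i hi => (hfib p P).1 i hi) i hi
  refine ⟨hex, hflat, fun P hP => ?_⟩
  let p := P.comap (algebraMap A R)
  -- The prime `P` is a point of the fiber over `p = P ∩ A`. Cyclicity is known at maximal ideals of
  -- the fiber, and it passes to smaller primes.
  let P₁ : PrimeSpectrum (p.Fiber R) := PrimeSpectrum.preimageEquivFiber A R ⟨p, inferInstance⟩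
    ⟨⟨P, hP⟩, rfl⟩
  have hP₁ : P₁.asIdeal.comap (algebraMap R (p.Fiber R)) = P :=
    congrArg (fun x => x.1.asIdeal) ((PrimeSpectrum.preimageEquivFiber A R
      ⟨p, inferInstance⟩).symm_apply_apply ⟨⟨P, hP⟩, rfl⟩)
  obtain ⟨m, hm, hle⟩ := P₁.asIdeal.exists_le_maximal P₁.isPrime.ne_top
  refine CyclicAt.mono (q := (m.comap (algebraMap R (p.Fiber R))).comap (algebraMap S R)) ?_
    (Ideal.comap_mono (hP₁.ge.trans (Ideal.comap_mono hle)))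
  obtain ⟨e1⟩ := cohomology_baseChange_equiv hd h.flatOver_dual h.dual_bounded
    (IsFlatExactBaseChange.fiber p) (n - E) fun j hj => by
      have := (subsingleton_cohomology_iff _ _).mpr (hex j (by omega))
      exact FlatOver.of_subsingleton
  rw [← comap_fiberMap_comap, ← comap_maximalIdeal_localization,
    ← isCyclicModule_tensor_iff_cyclicAt]
  let Q := m.comap (fiberMap S R p).toRingHom
  refine (hfib p m).2.of_surjective ((e1.symm.baseChange (p.Fiber S) (Localization.AtPrime Q)).trans
    (AlgebraTensorModule.cancelBaseChange S (p.Fiber S) (Localization.AtPrime Q)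
      (Localization.AtPrime Q) _)).toLinearMap (LinearEquiv.surjective _)

/-- All cohomology is flat, being zero outside degree `c`, so it commutes with base change to the
fiber; concentration and local cyclicity are thereby inherited by each local ring of the fiber. -/
theorem IsFlatResolution.gorenstein_of_concentrated {n : ℕ} (h : IsFlatResolution A ι π N)
    (e : M 0 ≃ₗ[S] R) (hR : Function.Surjective (algebraMap S R))
    (hTn : ∀ (p : Ideal A) [p.IsPrime], IsPolynomialLike (p.Fiber S) n) {c : ℕ}
    (hex : ∀ i, i ≠ c → ExactAt (homDifferential ι π S) i)
    (hflat : FlatOver A S (cohomology (homDifferential ι π S) c))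
    (hcyc : ∀ (P : Ideal R) [P.IsPrime], CyclicAt S (cohomology (homDifferential ι π S) c)
        (P.comap (algebraMap S R))) (p : Ideal A) [p.IsPrime] :
    IsGorensteinRing (p.Fiber R) := by
  have := (hTn p).noeth
  refine ⟨isNoetherianRing_of_surjective _ _ (fiberMap S R p).toRingHom (fiberMap_surjective hR p),
    fun P hP => ?_⟩
  have hH (j : ℕ) : FlatOver A S (cohomology (homDifferential ι π S) j) := by
    by_cases hj : j = c
    · rwa [hj]
    · have := (subsingleton_cohomology_iff _ _).mpr (hex j hj)
      exact FlatOver.of_subsingleton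
  have he (i : ℕ) := cohomology_baseChange_equiv (h.chain.homDifferential_comp S) h.flatOver_dual
    h.dual_bounded (IsFlatExactBaseChange.fiber p) i fun j _ => hH j
  let Q := P.comap (fiberMap S R p).toRingHom
  refine h.exists_hasInjectiveDimensionLE_localization (k := p.ResidueField) e
    (IsFlatExactBaseChange.fiber p) (hTn p) hR (fiberMap S R p).toRingHom (fiberMap_surjective hR p)
    (ker_fiberMap hR p) P (c := c) (fun i hi => ?_) ?_
  · have := (subsingleton_cohomology_iff _ _).mpr (hex i hi)
    obtain ⟨e1⟩ := he i
    have : Subsingleton (fiberCohomology ι π (p.Fiber S) i) := e1.symm.injective.subsingleton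
    infer_instance
  · obtain ⟨e1⟩ := he c
    have h1 : IsCyclicModule (Localization.AtPrime Q)
        (Localization.AtPrime Q ⊗[S] cohomology (homDifferential ι π S) c) := by
      refine CyclicAt.isCyclicModule_tensor (S := S) (L := Localization.AtPrime Q)
        (M := cohomology (homDifferential ι π S) c) ?_
      rw [comap_maximalIdeal_localization, comap_fiberMap_comap]
      exact hcyc _
    have e2 : (Localization.AtPrime Q ⊗[p.Fiber S]
        (p.Fiber S ⊗[S] cohomology (homDifferential ι π S) c)) ≃ₗ[Localization.AtPrime Q]
        (Localization.AtPrime Q ⊗[p.Fiber S] fiberCohomology ι π (p.Fiber S) c) :=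
      e1.baseChange (p.Fiber S) (Localization.AtPrime Q)
    have e3 := AlgebraTensorModule.cancelBaseChange S (p.Fiber S) (Localization.AtPrime Q)
      (Localization.AtPrime Q) (cohomology (homDifferential ι π S) c)
    exact h1.of_linearEquiv (e3.symm.trans e2)

end FiberMap

/-! ### The `R`-module structure on `Ext` versus the `S`-module structure. -/

section ExtAlgComparison

variable {S R N : Type u} [CommRing S] [CommRing R] [Algebra S R] [AddCommGroup N] [Module S N]

theorem ExtAlg.mulHom_algebraMap_comp (s : S) {i : ℕ} (x : ExtMod S R N i) :
    (Ext.mk₀ (ExtAlg.mulHom (algebraMap S R s))).comp x (zero_add i) = s • x := by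
  have h : ExtAlg.mulHom (algebraMap S R s) = s • 𝟙 (ModuleCat.of S R) := by
    ext r
    exact (Algebra.smul_def s r).symm
  rw [h, Ext.mk₀_smul, Ext.smul_comp, Ext.mk₀_id_comp]

variable (S R N) in
/-- Restriction of scalars to `S` of the `R`-module `ExtAlg S R N i` gives the usual `S`-module
structure. -/
theorem ExtAlg.exists_linearEquiv (i : ℕ) [Module S (ExtAlg S R N i)] [IsScalarTower S R (ExtAlg S R N i)] :
    Nonempty (ExtAlg S R N i ≃ₗ[S] ExtMod S R N i) :=
  ⟨{ AddEquiv.refl (ExtAlg S R N i) with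
      map_smul' := fun s x =>
        (_root_.algebraMap_smul R s x).symm.trans (ExtAlg.mulHom_algebraMap_comp s x) }⟩

theorem isLocallyCyclic_extAlg_iff (hR : Function.Surjective (algebraMap S R)) {i : ℕ} {H : Type u}
    [AddCommGroup H] [Module S H] (e : ExtMod S R N i ≃ₗ[S] H) :
    IsLocallyCyclic R (ExtAlg S R N i) ↔
      ∀ (P : Ideal R) [P.IsPrime], CyclicAt S H (P.comap (algebraMap S R)) := by
  let : Module S (ExtAlg S R N i) := Module.compHom _ (algebraMap S R)
  have : IsScalarTower S R (ExtAlg S R N i) := .of_algebraMap_smul fun _ _ => rfl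
  obtain ⟨e'⟩ := ExtAlg.exists_linearEquiv S R N i
  rw [isLocallyCyclic_iff]
  refine forall_congr' fun P => forall_congr' fun hP => ?_
  rw [← cyclicAt_comap_iff hR]
  exact ⟨fun h => h.of_surjective (e'.trans e).toLinearMap (e'.trans e).surjective,
    fun h => h.of_surjective (e'.trans e).symm.toLinearMap (e'.trans e).symm.surjective⟩

theorem flat_extAlg_iff {A : Type u} [CommRing A] [Algebra A S] [Algebra A R] [IsScalarTower A S R]
    {i : ℕ} {H : Type u} [AddCommGroup H] [Module S H] (e : ExtMod S R N i ≃ₗ[S] H) :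
    Module.Flat A (RestrictScalars A R (ExtAlg S R N i)) ↔ FlatOver A S H := by
  let : Module S (ExtAlg S R N i) := Module.compHom _ (algebraMap S R)
  have : IsScalarTower S R (ExtAlg S R N i) := .of_algebraMap_smul fun _ _ => rfl
  obtain ⟨e'⟩ := ExtAlg.exists_linearEquiv S R N i
  let : Module A (ExtAlg S R N i) := Module.compHom _ (algebraMap A R)
  have : IsScalarTower A S (ExtAlg S R N i) := .of_algebraMap_smul fun a x => by
    rw [← _root_.algebraMap_smul R (algebraMap A S a) x, ← IsScalarTower.algebraMap_apply]
    rfl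
  have h1 : FlatOver A S (ExtAlg S R N i) ↔ FlatOver A S H :=
    ⟨fun h => FlatOver.congr (e'.trans e) h, fun h => FlatOver.congr (e'.trans e).symm h⟩
  rw [← h1, flatOver_iff]
  rfl

end ExtAlgComparison

/-! ### The flat resolution of `R` and the conclusion. -/

theorem exists_isFlatResolution {A R : Type u} [CommRing A] [IsNoetherianRing A] [CommRing R]
    [Algebra A R] {n : ℕ} [Algebra (MvPolynomial (Fin n) A) R]
    [IsScalarTower A (MvPolynomial (Fin n) A) R] [Module.Projective A R]
    (hR : Function.Surjective (algebraMap (MvPolynomial (Fin n) A) R)) :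
    ∃ (M F : ℕ → ModuleCat.{u} (MvPolynomial (Fin n) A))
      (ι : ∀ i, M (i + 1) →ₗ[MvPolynomial (Fin n) A] F i)
      (π : ∀ i, F i →ₗ[MvPolynomial (Fin n) A] M i),
      Nonempty (M 0 ≃ₗ[MvPolynomial (Fin n) A] R) ∧
        IsFlatResolution A (M := fun i => M i) (F := fun i => F i) ι π n := by
  have : Module.Finite (MvPolynomial (Fin n) A) R :=
    Module.Finite.of_surjective (Algebra.linearMap (MvPolynomial (Fin n) A) R) hR
  obtain ⟨M, F, ι, π, h0, hchain, hproj, hfin, hbdd⟩ := exists_isSyzygyChain R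
    (hasProjectiveDimensionLE_mvPolynomial (A := A) (n := n) R)
  let e : M 0 ≃ₗ[MvPolynomial (Fin n) A] R := (eqToIso h0).toLinearEquiv
  exact ⟨M, F, ι, π, ⟨e⟩, hchain, fun i => hchain.flatOver hproj
    (FlatOver.congr e.symm (flatOver_iff.mpr inferInstance)) i, hproj, hfin, hbdd⟩

end

theorem mainTheorem9 {A R : Type u} [CommRing A] [IsNoetherianRing A] [CommRing R] [Algebra A R]
    (𝓡 : ℕ → Submodule A R) [GradedAlgebra 𝓡]
    (hinj : Function.Injective (algebraMap A R))
    (hzero : ∀ r ∈ 𝓡 0, r ∈ (algebraMap A R).range)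
    {n : ℕ} (δ : Fin n → ℕ) (hδ : ∀ i, 0 < δ i)
    [Algebra (MvPolynomial (Fin n) A) R] [IsScalarTower A (MvPolynomial (Fin n) A) R]
    (hsurj : Function.Surjective (algebraMap (MvPolynomial (Fin n) A) R))
    (hgraded : ∀ (d : ℕ), ∀ f ∈ MvPolynomial.weightedHomogeneousSubmodule A δ d,
      algebraMap (MvPolynomial (Fin n) A) R f ∈ 𝓡 d)
    (hflat : Module.Flat A R)
    (hcases : ConnectedSpace (PrimeSpectrum A) ∨ Module.Finite A R) :
    ∃ e : ℕ, e ≤ n ∧ (∀ (p : Ideal A) [p.IsPrime], ringKrullDim (p.Fiber R) = (e : WithBot ℕ∞)) ∧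
      (IsGorensteinAlgebra A R ↔
        (∀ i : ℕ, i ≤ n → i ≠ n - e →
          Subsingleton (ExtAlg (MvPolynomial (Fin n) A) R (MvPolynomial (Fin n) A) i)) ∧
        (Module.Flat A (RestrictScalars A R
            (ExtAlg (MvPolynomial (Fin n) A) R (MvPolynomial (Fin n) A) (n - e))) ∧
          IsLocallyCyclic R
            (ExtAlg (MvPolynomial (Fin n) A) R (MvPolynomial (Fin n) A) (n - e)))) := by
  let S := MvPolynomial (Fin n) A
  have hTn (p : Ideal A) [p.IsPrime] : IsPolynomialLike (p.Fiber S) n :=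
    isPolynomialLike_fiber_mvPolynomial n p
  obtain ⟨E, hEn, hdim⟩ := exists_ringKrullDim_fiber_eq 𝓡 hδ hgraded hsurj hinj hzero
    (fun p _ => (ringKrullDim_le_of_surjective (fiberMap S R p).toRingHom
      (fiberMap_surjective hsurj p)).trans (hTn p).krullDim) hcases
  have := projective_of_graded 𝓡 hδ hgraded hsurj
  obtain ⟨M, F, ι, π, ⟨e₀⟩, h⟩ := exists_isFlatResolution hsurj
  have hext (i : ℕ) := h.chain.ext_equiv S h.proj i
  have hExtR (i : ℕ) : Nonempty (ExtMod S R S i ≃ₗ[S] cohomology (homDifferential ι π S) i) := by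
    obtain ⟨e₁⟩ := ExtMod.congr_left (N := S) e₀ i
    obtain ⟨e₂⟩ := hext i
    exact ⟨e₁.trans e₂⟩
  have hvanish (i : ℕ) :
      Subsingleton (ExtAlg S R S i) ↔ ExactAt (homDifferential ι π S) i := by
    obtain ⟨e₁⟩ := hExtR i
    rw [← subsingleton_cohomology_iff]
    exact e₁.toEquiv.subsingleton_congr
  obtain ⟨eE⟩ := hExtR (n - E)
  refine ⟨E, hEn, hdim, ?_⟩
  rw [flat_extAlg_iff (S := S) eE, isLocallyCyclic_extAlg_iff hsurj eE]
  constructor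
  · rintro ⟨-, hG⟩
    obtain ⟨hex, hfl, hcyc⟩ := h.concentrated_of_gorenstein e₀ hsurj hTn
      (fun p _ => preconnectedSpace_fiber_of_graded 𝓡 p hzero) hdim hG
    exact ⟨fun i _ hi => (hvanish i).mpr (hex i hi), hfl, fun P _ => hcyc P⟩
  · rintro ⟨hex, hfl, hcyc⟩
    refine ⟨hflat, fun p _ => h.gorenstein_of_concentrated e₀ hsurj hTn (c := n - E)
      (fun i hi => ?_) hfl (fun P _ => hcyc P) p⟩
    -- Condition (a) only speaks of degrees up to `n`; above `n` the dual complex is zero because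
    -- the resolution has length `n`.
    by_cases hin : i ≤ n
    · exact (hvanish i).mp (hex i hin hi)
    · have := h.dual_bounded i (by omega)
      rw [← subsingleton_cohomology_iff]
      infer_instance
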